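/- Let $n\in\{1,2\}$ and let $\Omega\subset\mathbb{R}^n$ be a bounded open set with smooth boundary. Let $L^2(\Omega)$, $H^k(\Omega)$ be the usual Lebesgue and Sobolev spaces of real- or complex-valued functions, let $$H^2_o(\Omega)=H^2(\Omega)\cap H^1_0(\Omega),\qquad H^4_o(\Omega)=\{\psi\in H^4(\Omega):\ \psi|_{\partial\Omega}=\Delta\psi|_{\partial\Omega}=0\}$$ (boundary values in the sense of traces), and let $\mathfrak{X}=L^2(\Omega)\times H^2_o(\Omega)$ with the norm of $L^2(\Omega)\times H^2(\Omega)$. Let $\mathbb{A}$ be the pinned realization of $\Delta-\Delta^2$, that is, the operator in $L^2(\Omega)$ whose domain $D(\mathbb{A})$ consists of all $\phi\in H^2_o(\Omega)$ for which there is an $f\in L^2(\Omega)$ with $$\int_\Omega \nabla\phi\cdot\nabla\overline{\psi}+\Delta\phi\,\Delta\overline{\psi}\,dx=\int_\Omega f\,\overline{\psi}\,dx\qquad\text{for all }\psi\in H^2_o(\Omega),$$ and $\mathbb{A}\phi=-f$ for such $\phi$. Let $\mathcal{A}$ be the operator in $\mathfrak{X}$ given by $$\mathcal{A}=\begin{pmatrix}0&\mathbb{A}\\1&0\end{pmatrix},\qquad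 \mathcal{A}(v,w)=(\mathbb{A}w,\,v)\quad\text{for } v\in H^2_o(\Omega),\ w\in D(\mathbb{A}).$$ Then the domain of $\mathcal{A}$ is $D(\mathcal{A})=H^2_o(\Omega)\times H^4_o(\Omega)$, and $\mathcal{A}$ is the generator of a strongly continuous semigroup ($C_0$-semigroup) $\{T(t)\in\mathcal{B}(\mathfrak{X}):\ t\in[0,\infty)\}$. -/

import Mathlib

open MeasureTheory Filter Topology
open scoped ContDiff NNReal

noncomputable section

namespace Plate

/-! ## Bounded open sets with smooth boundary -/

/-- `Ω` has a smooth boundary: near each of its boundary points, `Ω` is the sublevel set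
`{ρ < 0}` of a smooth function `ρ` with non-vanishing differential at that point. -/
def HasSmoothBoundary {n : ℕ} (Ω : Set (EuclideanSpace ℝ (Fin n))) : Prop :=
  ∀ x ∈ frontier Ω, ∃ U : Set (EuclideanSpace ℝ (Fin n)), IsOpen U ∧ x ∈ U ∧
    ∃ ρ : EuclideanSpace ℝ (Fin n) → ℝ, ContDiff ℝ ∞ ρ ∧ fderiv ℝ ρ x ≠ 0 ∧
      Ω ∩ U = {y ∈ U | ρ y < 0}

/-! ## Test functions, weak derivatives, Sobolev spaces -/

/-- `φ ∈ C_c^∞(Ω; F)`. -/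
structure IsTest {n : ℕ} {F : Type*} [NormedAddCommGroup F] [NormedSpace ℝ F]
    (Ω : Set (EuclideanSpace ℝ (Fin n))) (φ : EuclideanSpace ℝ (Fin n) → F) : Prop where
  contDiff : ContDiff ℝ ∞ φ
  hasCompactSupport : HasCompactSupport φ
  tsupport_subset : tsupport φ ⊆ Ω

/-- The classical partial derivative `∂_{w 0} ⋯ ∂_{w (m-1)} φ` along a word `w` of coordinate
directions. -/
def pderiv {n m : ℕ} {F : Type*} [NormedAddCommGroup F] [NormedSpace ℝ F] (w : Fin m → Fin n)
    (φ : EuclideanSpace ℝ (Fin n) → F) (x : EuclideanSpace ℝ (Fin n)) : F :=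
  iteratedFDeriv ℝ m φ x (fun j => EuclideanSpace.single (w j) (1 : ℝ))

variable (𝕜 : Type*) [RCLike 𝕜] {n : ℕ} (Ω : Set (EuclideanSpace ℝ (Fin n)))

/-- `L²(Ω)`, with real or complex values. -/
abbrev L2 : Type _ := Lp 𝕜 2 (volume.restrict Ω)

variable {𝕜}

/-- `g` is the weak derivative of `u` on `Ω` along the word `w`:
`∫_Ω (∂_w φ) u = (-1)^m ∫_Ω φ g` for all test functions `φ`. -/
def IsWeakDeriv {m : ℕ} (w : Fin m → Fin n) (u g : L2 𝕜 Ω) : Prop :=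
  ∀ φ : EuclideanSpace ℝ (Fin n) → ℝ, IsTest Ω φ →
    ∫ x in Ω, pderiv w φ x • u x = (-1 : ℝ) ^ m • ∫ x in Ω, φ x • g x

/-- Words of length at most `k` in the `n` coordinate directions. -/
abbrev Word (n k : ℕ) : Type := Σ m : Fin (k + 1), (Fin m → Fin n)

/-- The empty word. -/
def Word.nil (n k : ℕ) : Word n k := ⟨0, Fin.elim0⟩

/-- The one-letter word `i`. -/
def Word.one {k : ℕ} (hk : 1 ≤ k) (i : Fin n) : Word n k := ⟨⟨1, by omega⟩, fun _ => i⟩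

/-- The two-letter word `i i`. -/
def Word.two {k : ℕ} (hk : 2 ≤ k) (i : Fin n) : Word n k := ⟨⟨2, by omega⟩, fun _ => i⟩

theorem integrable_test_smul {φ : EuclideanSpace ℝ (Fin n) → ℝ} (hc : Continuous φ)
    (hs : HasCompactSupport φ) (u : L2 𝕜 Ω) :
    Integrable (fun x => φ x • u x) (volume.restrict Ω) := by
  have h1 : MemLp φ 2 (volume.restrict Ω) := hc.memLp_of_hasCompactSupport hs
  have h2 : MemLp (fun x => φ x • u x) 1 (volume.restrict Ω) := (Lp.memLp u).smul h1
  exact memLp_one_iff_integrable.1 h2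

theorem integral_smul_zero (ψ : EuclideanSpace ℝ (Fin n) → ℝ) :
    ∫ x in Ω, ψ x • ((0 : L2 𝕜 Ω) x) = 0 := by
  apply integral_eq_zero_of_ae
  filter_upwards [Lp.coeFn_zero 𝕜 2 (volume.restrict Ω)] with x hx
  rw [hx]
  simp

theorem integral_smul_add {ψ : EuclideanSpace ℝ (Fin n) → ℝ} (h1 : Continuous ψ)
    (h2 : HasCompactSupport ψ) (u v : L2 𝕜 Ω) :
    ∫ x in Ω, ψ x • ((u + v : L2 𝕜 Ω) x)
      = (∫ x in Ω, ψ x • u x) + ∫ x in Ω, ψ x • v x := by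
  rw [← integral_add (integrable_test_smul Ω h1 h2 u) (integrable_test_smul Ω h1 h2 v)]
  apply integral_congr_ae
  filter_upwards [Lp.coeFn_add u v] with x hx
  rw [hx, Pi.add_apply, smul_add]

theorem integral_smul_smul (ψ : EuclideanSpace ℝ (Fin n) → ℝ) (c : 𝕜) (u : L2 𝕜 Ω) :
    ∫ x in Ω, ψ x • ((c • u : L2 𝕜 Ω) x) = c • ∫ x in Ω, ψ x • u x := by
  rw [← integral_smul]
  apply integral_congr_ae
  filter_upwards [Lp.coeFn_smul c u] with x hx
  rw [hx, Pi.smul_apply]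
  exact smul_comm _ _ _

theorem IsTest.continuous_pderiv {F : Type*} [NormedAddCommGroup F] [NormedSpace ℝ F]
    {Ω : Set (EuclideanSpace ℝ (Fin n))} {φ : EuclideanSpace ℝ (Fin n) → F} (h : IsTest Ω φ)
    {m : ℕ} (w : Fin m → Fin n) : Continuous (pderiv w φ) :=
  (ContinuousMultilinearMap.apply ℝ _ F
    (fun j => EuclideanSpace.single (w j) (1 : ℝ))).continuous.comp
    (h.contDiff.continuous_iteratedFDeriv (by exact_mod_cast le_top))

theorem IsTest.hasCompactSupport_pderiv {F : Type*} [NormedAddCommGroup F] [NormedSpace ℝ F]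
    {Ω : Set (EuclideanSpace ℝ (Fin n))} {φ : EuclideanSpace ℝ (Fin n) → F} (h : IsTest Ω φ)
    {m : ℕ} (w : Fin m → Fin n) : HasCompactSupport (pderiv w φ) := by
  have h1 : HasCompactSupport (iteratedFDeriv ℝ m φ) := h.hasCompactSupport.iteratedFDeriv m
  refine h1.mono' fun x hx => subset_closure ?_
  rw [Function.mem_support] at hx ⊢
  intro h0
  exact hx (by simp [pderiv, h0])

variable (𝕜) in
/-- Families of `L²(Ω)` functions indexed by the words of length at most `k`, with the norm
`‖U‖² = ∑_w ‖U_w‖²_{L²}`. -/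
abbrev Jet (k : ℕ) : Type _ := PiLp 2 (fun _ : Word n k => L2 𝕜 Ω)

variable (𝕜) in
/-- The Sobolev space `H^k(Ω)`. Its elements are recorded as families `(∂_w u)_w` of an `L²`
function `u` (the entry of the empty word) with all its weak derivatives of order at most `k`,
each of which is in `L²`; since weak derivatives are unique, such a family is the same thing as
the function `u`. The norm is `‖u‖² = ∑_w ‖∂_w u‖²_{L²}`. -/
def Sobolev (k : ℕ) : Submodule 𝕜 (Jet 𝕜 Ω k) where
  carrier := {U | ∀ w : Word n k, IsWeakDeriv Ω w.2 (U (Word.nil n k)) (U w)}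
  zero_mem' := by
    intro w φ hφ
    rw [PiLp.zero_apply, PiLp.zero_apply, integral_smul_zero, integral_smul_zero, smul_zero]
  add_mem' := by
    intro U V hU hV w φ hφ
    rw [PiLp.add_apply, PiLp.add_apply,
      integral_smul_add Ω (hφ.continuous_pderiv w.2) (hφ.hasCompactSupport_pderiv w.2),
      integral_smul_add Ω hφ.contDiff.continuous hφ.hasCompactSupport, hU w φ hφ, hV w φ hφ,
      smul_add]
  smul_mem' := by
    intro c U hU w φ hφ
    rw [PiLp.smul_apply, PiLp.smul_apply, integral_smul_smul, integral_smul_smul, hU w φ hφ,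
      smul_comm]

variable {Ω}

/-- The underlying function `u` of a family `(∂_w u)_w`. -/
def Jet.val {k : ℕ} : Jet 𝕜 Ω k →ₗ[𝕜] L2 𝕜 Ω where
  toFun U := U (Word.nil n k)
  map_add' _ _ := rfl
  map_smul' _ _ := rfl

/-- The weak partial derivative `∂_i u` of a family `(∂_w u)_w` of order `k ≥ 1`. -/
def Jet.partial {k : ℕ} (hk : 1 ≤ k) (i : Fin n) : Jet 𝕜 Ω k →ₗ[𝕜] L2 𝕜 Ω where
  toFun U := U (Word.one hk i)
  map_add' _ _ := rfl
  map_smul' _ _ := rfl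

/-- The weak Laplacian `Δu = ∑ i, ∂_i ∂_i u` of a family `(∂_w u)_w` of order `k ≥ 2`. -/
def Jet.laplacian {k : ℕ} (hk : 2 ≤ k) : Jet 𝕜 Ω k →ₗ[𝕜] L2 𝕜 Ω where
  toFun U := ∑ i, U (Word.two hk i)
  map_add' _ _ := by simp [Finset.sum_add_distrib]
  map_smul' _ _ := by simp [Finset.smul_sum]

variable (𝕜 Ω)

/-- The pairs `(φ, ∇φ)`, `φ ∈ C_c^∞(Ω)`, in `L²(Ω) × L²(Ω)ⁿ`. -/
def testGraph : Submodule 𝕜 (L2 𝕜 Ω × (Fin n → L2 𝕜 Ω)) where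
  carrier := {p | ∃ φ : EuclideanSpace ℝ (Fin n) → 𝕜, IsTest Ω φ ∧
    p.1 =ᵐ[volume.restrict Ω] φ ∧
    ∀ i, p.2 i =ᵐ[volume.restrict Ω] fun x => fderiv ℝ φ x (EuclideanSpace.single i (1 : ℝ))}
  zero_mem' := by
    refine ⟨0, ⟨contDiff_const, HasCompactSupport.zero, ?_⟩, Lp.coeFn_zero _ _ _, fun i => ?_⟩
    · simp [tsupport]
    · filter_upwards [Lp.coeFn_zero 𝕜 2 (volume.restrict Ω)] with x hx
      simpa using hx
  add_mem' := by
    rintro p q ⟨φ, hφ, hp, hp'⟩ ⟨ψ, hψ, hq, hq'⟩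
    refine ⟨φ + ψ, ⟨hφ.contDiff.add hψ.contDiff, hφ.hasCompactSupport.add hψ.hasCompactSupport,
      (tsupport_add φ ψ).trans (Set.union_subset hφ.tsupport_subset hψ.tsupport_subset)⟩,
      (Lp.coeFn_add p.1 q.1).trans (hp.add hq), fun i => ?_⟩
    filter_upwards [Lp.coeFn_add (p.2 i) (q.2 i), hp' i, hq' i] with x h1 h2 h3
    have e1 : DifferentiableAt ℝ φ x := (hφ.contDiff.differentiable (by simp)) x
    have e2 : DifferentiableAt ℝ ψ x := (hψ.contDiff.differentiable (by simp)) x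
    rw [fderiv_add e1 e2]
    exact h1.trans (by rw [Pi.add_apply, h2, h3]; rfl)
  smul_mem' := by
    rintro c p ⟨φ, hφ, hp, hp'⟩
    refine ⟨c • φ, ⟨hφ.contDiff.const_smul c, hφ.hasCompactSupport.smul_left (f := fun _ => c),
      (tsupport_smul_subset_right (fun _ => c) φ).trans hφ.tsupport_subset⟩,
      (Lp.coeFn_smul c p.1).trans (hp.const_smul c), fun i => ?_⟩
    filter_upwards [Lp.coeFn_smul c (p.2 i), hp' i] with x h1 h2
    have e1 : DifferentiableAt ℝ φ x := (hφ.contDiff.differentiable (by simp)) x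
    rw [fderiv_const_smul e1 c]
    exact h1.trans (by rw [Pi.smul_apply, h2]; rfl)

/-- `H¹₀(Ω)`, as a space of `L²` functions: the closure of `C_c^∞(Ω)` in the `H¹` norm. Its elements
are the `H¹` functions that vanish on `∂Ω` in the sense of traces. -/
def H10 : Submodule 𝕜 (L2 𝕜 Ω) :=
  (testGraph 𝕜 Ω).topologicalClosure.map (LinearMap.fst 𝕜 (L2 𝕜 Ω) (Fin n → L2 𝕜 Ω))

/-- `H²_o(Ω) = H²(Ω) ∩ H¹₀(Ω)`, with the norm of `H²(Ω)`. -/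
def H2o : Submodule 𝕜 (Jet 𝕜 Ω 2) := Sobolev 𝕜 Ω 2 ⊓ (H10 𝕜 Ω).comap Jet.val

/-- `H⁴_o(Ω) = {u ∈ H⁴(Ω) : u = Δu = 0 on ∂Ω}`. -/
def H4o : Submodule 𝕜 (Jet 𝕜 Ω 4) :=
  Sobolev 𝕜 Ω 4 ⊓ (H10 𝕜 Ω).comap Jet.val ⊓ (H10 𝕜 Ω).comap (Jet.laplacian (by norm_num))

variable {𝕜 Ω}

/-- The underlying `L²` function of an element of `H²_o(Ω)`. -/
def H2o.toL2 : H2o 𝕜 Ω →ₗ[𝕜] L2 𝕜 Ω := Jet.val ∘ₗ (H2o 𝕜 Ω).subtype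

/-- `∂_i : H²_o(Ω) → L²(Ω)`. -/
def H2o.partial (i : Fin n) : H2o 𝕜 Ω →ₗ[𝕜] L2 𝕜 Ω :=
  Jet.partial (by norm_num) i ∘ₗ (H2o 𝕜 Ω).subtype

/-- `Δ : H²_o(Ω) → L²(Ω)`. -/
def H2o.laplacian : H2o 𝕜 Ω →ₗ[𝕜] L2 𝕜 Ω := Jet.laplacian le_rfl ∘ₗ (H2o 𝕜 Ω).subtype

/-! ## The operators -/

/-- The form `∫_Ω ∇φ · conj ∇ψ + Δφ conj Δψ`. (The inner product `inner 𝕜 f g` of `L²` is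
`∫ conj f g`.) -/
def energyForm (φ ψ : H2o 𝕜 Ω) : 𝕜 :=
  (∑ i, inner 𝕜 (H2o.partial i ψ) (H2o.partial i φ)) +
    inner 𝕜 (H2o.laplacian ψ) (H2o.laplacian φ)

variable (𝕜 Ω)

/-- The graph of the pinned realization of `Δ - Δ²`: the pairs `(φ, -f)` in `H²_o(Ω) × L²(Ω)` with
`∫_Ω ∇φ · conj ∇ψ + Δφ conj Δψ = ∫_Ω f conj ψ` for all `ψ ∈ H²_o(Ω)`. -/
def plateGraph : Submodule 𝕜 (H2o 𝕜 Ω × L2 𝕜 Ω) where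
  carrier := {p | ∃ f : L2 𝕜 Ω, p.2 = -f ∧
    ∀ ψ : H2o 𝕜 Ω, energyForm p.1 ψ = inner 𝕜 (H2o.toL2 ψ) f}
  zero_mem' := ⟨0, by simp, fun ψ => by simp [energyForm]⟩
  add_mem' := by
    rintro p q ⟨f, hp, hf⟩ ⟨g, hq, hg⟩
    refine ⟨f + g, by rw [Prod.snd_add, hp, hq, neg_add], fun ψ => ?_⟩
    rw [inner_add_right, ← hf, ← hg]
    simp only [energyForm, Prod.fst_add, map_add, inner_add_right, Finset.sum_add_distrib]
    ring
  smul_mem' := by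
    rintro c p ⟨f, hp, hf⟩
    refine ⟨c • f, by rw [Prod.smul_snd, hp, smul_neg], fun ψ => ?_⟩
    rw [inner_smul_right, ← hf]
    simp only [energyForm, Prod.smul_fst, map_smul, inner_smul_right, mul_add, Finset.mul_sum]

/-- The operator `𝔸`, the pinned realization of `Δ - Δ²`, with domain in `H²_o(Ω)` and with values
in `L²(Ω)`. -/
def plateOp : H2o 𝕜 Ω →ₗ.[𝕜] L2 𝕜 Ω := (plateGraph 𝕜 Ω).toLinearPMap

/-- The state space `𝔛 = L²(Ω) × H²_o(Ω)`, with norm `‖(a, b)‖² = ‖a‖²_{L²} + ‖b‖²_{H²}`. -/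
abbrev StateSpace : Type _ := WithLp 2 (L2 𝕜 Ω × H2o 𝕜 Ω)

/-- The graph of the operator matrix `((0, 𝔸), (1, 0))` in `𝔛`: the pairs `((v, w), (𝔸 w, v))` with
`v ∈ H²_o(Ω)` and `w ∈ D(𝔸)`. -/
def waveGraph : Submodule 𝕜 (StateSpace 𝕜 Ω × StateSpace 𝕜 Ω) where
  carrier := {p | p.1.fst = H2o.toL2 p.2.snd ∧ (p.1.snd, p.2.fst) ∈ (plateOp 𝕜 Ω).graph}
  zero_mem' := ⟨by simp, by exact (plateOp 𝕜 Ω).graph.zero_mem⟩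
  add_mem' := by
    rintro p q ⟨hp, hp'⟩ ⟨hq, hq'⟩
    refine ⟨?_, (plateOp 𝕜 Ω).graph.add_mem hp' hq'⟩
    simp [hp, hq]
  smul_mem' := by
    rintro c p ⟨hp, hp'⟩
    refine ⟨?_, (plateOp 𝕜 Ω).graph.smul_mem c hp'⟩
    simp [hp]

/-- The operator `𝒜 = ((0, 𝔸), (1, 0))` in `𝔛`, which maps `(v, w)` with `v ∈ H²_o(Ω)` and
`w ∈ D(𝔸)` to `(𝔸 w, v)`. -/
def waveOp : StateSpace 𝕜 Ω →ₗ.[𝕜] StateSpace 𝕜 Ω := (waveGraph 𝕜 Ω).toLinearPMap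

variable {𝕜 Ω}

/-! ## The graphs are single-valued

These facts show that the operators defined from the graphs have exactly these graphs. -/

theorem eq_zero_of_forall_test (hΩ : IsOpen Ω) (g : L2 𝕜 Ω)
    (h : ∀ φ : EuclideanSpace ℝ (Fin n) → ℝ, IsTest Ω φ → ∫ x in Ω, φ x • g x = 0) : g = 0 := by
  have hloc : LocallyIntegrableOn g Ω (volume.restrict Ω) :=
    ((Lp.memLp g).locallyIntegrable (by norm_num)).locallyIntegrableOn Ω
  have h1 := hΩ.ae_eq_zero_of_integral_contDiff_smul_eq_zero hloc
    (fun φ h1 h2 h3 => h φ ⟨h1, h2, h3⟩)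
  rw [Lp.eq_zero_iff_ae_eq_zero]
  filter_upwards [h1, ae_restrict_mem hΩ.measurableSet] with x hx hx'
  exact hx hx'

theorem eq_of_isWeakDeriv (hΩ : IsOpen Ω) {m : ℕ} {w : Fin m → Fin n} {u g g' : L2 𝕜 Ω}
    (h : IsWeakDeriv Ω w u g) (h' : IsWeakDeriv Ω w u g') : g = g' := by
  rw [← sub_eq_zero]
  refine eq_zero_of_forall_test hΩ _ fun φ hφ => ?_
  have e : g - g' = g + (-1 : 𝕜) • g' := by simp [sub_eq_add_neg]
  have e2 := (h φ hφ).symm.trans (h' φ hφ)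
  have e3 := smul_right_injective 𝕜 (pow_ne_zero m (by norm_num : (-1 : ℝ) ≠ 0)) e2
  rw [e, integral_smul_add Ω hφ.contDiff.continuous hφ.hasCompactSupport, integral_smul_smul]
  rw [e3, neg_one_smul, add_neg_cancel]

theorem H2o.toL2_injective (hΩ : IsOpen Ω) :
    Function.Injective (H2o.toL2 : H2o 𝕜 Ω →ₗ[𝕜] L2 𝕜 Ω) := by
  intro U V h
  apply Subtype.ext
  apply PiLp.ext
  intro w
  have h' : U.1 (Word.nil n 2) = V.1 (Word.nil n 2) := h
  have hV := V.2.1 w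
  rw [← h'] at hV
  exact eq_of_isWeakDeriv hΩ (U.2.1 w) hV

section Calculus

variable {F : Type*} [NormedAddCommGroup F] [NormedSpace ℝ F]
  {φ : EuclideanSpace ℝ (Fin n) → F}

theorem contDiff_pderiv (h : ContDiff ℝ ∞ φ) {m : ℕ} (w : Fin m → Fin n) :
    ContDiff ℝ ∞ (pderiv w φ) :=
  (ContinuousMultilinearMap.apply ℝ _ F
    (fun j => EuclideanSpace.single (w j) (1 : ℝ))).contDiff.comp
    (h.iteratedFDeriv_right (m := ∞) (i := m) (by exact_mod_cast le_top))

theorem pderiv_succ (h : ContDiff ℝ ∞ φ) {m : ℕ} (w : Fin (m + 1) → Fin n) :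
    pderiv w φ = fun x => fderiv ℝ (pderiv (Fin.tail w) φ) x (EuclideanSpace.single (w 0) (1 : ℝ)) := by
  funext x
  exact DifferentiableAt.iteratedFDeriv_succ_apply_left'
    ((h.differentiable_iteratedFDeriv (by exact_mod_cast ENat.natCast_lt_top m)) x)

theorem pderiv_zero (w : Fin 0 → Fin n) : pderiv w φ = φ := rfl

theorem fderiv_comm (h : ContDiff ℝ ∞ φ) (a b : EuclideanSpace ℝ (Fin n)) :
    (fun x => fderiv ℝ (fun y => fderiv ℝ φ y a) x b)
      = fun x => fderiv ℝ (fun y => fderiv ℝ φ y b) x a := by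
  funext x
  have hd : DifferentiableAt ℝ (fderiv ℝ φ) x :=
    ((h.fderiv_right (m := ∞) (by simp)).differentiable (by simp)) x
  have hs : IsSymmSndFDerivAt ℝ φ x := (h.contDiffAt).isSymmSndFDerivAt (by
    rw [minSmoothness_of_isRCLikeNormedField]
    exact WithTop.coe_le_coe.2 (le_top : (2 : ℕ∞) ≤ ⊤))
  rw [fderiv_clm_apply hd (differentiableAt_const a), fderiv_clm_apply hd (differentiableAt_const b)]
  simpa using hs b a

theorem pderiv_fderiv (h : ContDiff ℝ ∞ φ) {m : ℕ} (w : Fin m → Fin n)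
    (a : EuclideanSpace ℝ (Fin n)) :
    pderiv w (fun x => fderiv ℝ φ x a) = fun x => fderiv ℝ (pderiv w φ) x a := by
  induction m with
  | zero => rfl
  | succ m ih =>
    have h1 : ContDiff ℝ ∞ (fun x => fderiv ℝ φ x a) :=
      (h.fderiv_right (m := ∞) (by simp)).clm_apply contDiff_const
    rw [pderiv_succ h1, pderiv_succ h, ih]
    exact fderiv_comm (contDiff_pderiv h _) _ _

end Calculus

theorem IsTest.fderiv_apply {F : Type*} [NormedAddCommGroup F] [NormedSpace ℝ F]
    {φ : EuclideanSpace ℝ (Fin n) → F} (h : IsTest Ω φ) (a : EuclideanSpace ℝ (Fin n)) :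
    IsTest Ω (fun x => fderiv ℝ φ x a) where
  contDiff := (h.contDiff.fderiv_right (m := ∞) (by simp)).clm_apply contDiff_const
  hasCompactSupport := h.hasCompactSupport.fderiv_apply (𝕜 := ℝ) a
  tsupport_subset := (tsupport_fderiv_apply_subset ℝ a).trans h.tsupport_subset

/-- Repeated integration by parts. -/
theorem integral_pderiv_smul {m : ℕ} (w : Fin m → Fin n) {η : EuclideanSpace ℝ (Fin n) → ℝ}
    {φ : EuclideanSpace ℝ (Fin n) → 𝕜} (hη : IsTest Ω η) (hφ : IsTest Ω φ) :
    ∫ x, pderiv w η x • φ x = (-1 : ℝ) ^ m • ∫ x, η x • pderiv w φ x := by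
  induction m generalizing φ with
  | zero => simp [pderiv_zero]
  | succ m ih =>
    have hc := contDiff_pderiv hη.contDiff (Fin.tail w)
    have hc' : Continuous fun x => fderiv ℝ (pderiv (Fin.tail w) η) x
        (EuclideanSpace.single (w 0) (1 : ℝ)) :=
      ((hc.fderiv_right (m := ∞) (by simp)).clm_apply contDiff_const).continuous
    have hφ' := hφ.fderiv_apply (EuclideanSpace.single (w 0) (1 : ℝ))
    have ibp := integral_smul_fderiv_eq_neg_fderiv_smul_of_integrable (μ := volume)
      (f := pderiv (Fin.tail w) η) (g := φ) (v := EuclideanSpace.single (w 0) (1 : ℝ))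
      ((hc'.smul hφ.contDiff.continuous).integrable_of_hasCompactSupport
        (hφ.hasCompactSupport.smul_left))
      ((hc.continuous.smul hφ'.contDiff.continuous).integrable_of_hasCompactSupport
        (hφ'.hasCompactSupport.smul_left))
      ((hc.continuous.smul hφ.contDiff.continuous).integrable_of_hasCompactSupport
        (hφ.hasCompactSupport.smul_left))
      (fun x _ => hc.differentiable (by simp) x)
      (fun x _ => hφ.contDiff.differentiable (by simp) x)
    rw [ih (Fin.tail w) hφ', pderiv_fderiv hφ.contDiff] at ibp
    rw [pderiv_succ hη.contDiff, pderiv_succ hφ.contDiff, pow_succ, mul_neg_one, neg_smul, ibp,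
      neg_neg]

theorem IsTest.memLp_pderiv {φ : EuclideanSpace ℝ (Fin n) → 𝕜} (h : IsTest Ω φ) {m : ℕ}
    (w : Fin m → Fin n) : MemLp (pderiv w φ) 2 (volume.restrict Ω) :=
  (h.continuous_pderiv w).memLp_of_hasCompactSupport (h.hasCompactSupport_pderiv w)

/-- Test functions belong to `H²_o(Ω)`. -/
theorem exists_H2o_of_isTest {φ : EuclideanSpace ℝ (Fin n) → 𝕜} (h : IsTest Ω φ) :
    ∃ U : H2o 𝕜 Ω, H2o.toL2 U =ᵐ[volume.restrict Ω] φ := by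
  have hout : ∀ {η : EuclideanSpace ℝ (Fin n) → ℝ} (f : EuclideanSpace ℝ (Fin n) → 𝕜), IsTest Ω η →
      ∀ {m : ℕ} (w : Fin m → Fin n), ∫ x in Ω, pderiv w η x • f x = ∫ x, pderiv w η x • f x := by
    intro η f hη m w
    apply setIntegral_eq_integral_of_forall_compl_eq_zero
    intro x hx
    have hx' : iteratedFDeriv ℝ m η x = 0 := by
      by_contra hne
      exact hx (hη.tsupport_subset (support_iteratedFDeriv_subset (𝕜 := ℝ) m hne))
    simp [pderiv, hx']
  let U : Jet 𝕜 Ω 2 := WithLp.toLp 2 fun w => (h.memLp_pderiv w.2).toLp (pderiv w.2 φ)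
  have hU : ∀ w, U w =ᵐ[volume.restrict Ω] pderiv w.2 φ := fun w => MemLp.coeFn_toLp (h.memLp_pderiv w.2)
  have hU0 : U (Word.nil n 2) =ᵐ[volume.restrict Ω] φ := hU _
  refine ⟨⟨U, ?_, ?_⟩, hU0⟩
  · intro w η hη
    have e1 : ∫ x in Ω, pderiv w.2 η x • U (Word.nil n 2) x = ∫ x in Ω, pderiv w.2 η x • φ x := by
      apply integral_congr_ae
      filter_upwards [hU0] with x hx
      rw [hx]
    have e2 : ∫ x in Ω, η x • U w x = ∫ x in Ω, η x • pderiv w.2 φ x := by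
      apply integral_congr_ae
      filter_upwards [hU w] with x hx
      rw [hx]
    have e3 := hout (pderiv w.2 φ) hη (Fin.elim0 : Fin 0 → Fin n)
    rw [pderiv_zero] at e3
    rw [e1, e2, hout φ hη, e3, integral_pderiv_smul w.2 hη h]
  · refine ⟨(U (Word.nil n 2), fun i => U (Word.one (by norm_num) i)),
      subset_closure ⟨φ, h, hU0, fun i => ?_⟩, rfl⟩
    refine (hU _).trans (Eventually.of_forall fun x => ?_)
    change pderiv (fun _ : Fin 1 => i) φ x = _
    rw [pderiv_succ h.contDiff, pderiv_zero]

theorem plateGraph_single_valued (hΩ : IsOpen Ω) (p : H2o 𝕜 Ω × L2 𝕜 Ω)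
    (hp : p ∈ plateGraph 𝕜 Ω) (h0 : p.1 = 0) : p.2 = 0 := by
  obtain ⟨f, hf, hψ⟩ := hp
  rw [hf, neg_eq_zero]
  refine eq_zero_of_forall_test hΩ f fun φ hφ => ?_
  have hof : ContDiff ℝ ∞ (fun r : ℝ => (r : 𝕜)) :=
    ContinuousLinearMap.contDiff (RCLike.ofRealCLM (K := 𝕜))
  have hφ' : IsTest Ω (fun x => (φ x : 𝕜)) :=
    ⟨hof.comp hφ.contDiff,
      hφ.hasCompactSupport.comp_left (g := fun r : ℝ => (r : 𝕜)) (by simp),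
      (tsupport_comp_subset (g := fun r : ℝ => (r : 𝕜)) (by simp) φ).trans hφ.tsupport_subset⟩
  obtain ⟨U, hU⟩ := exists_H2o_of_isTest hφ'
  have h1 := hψ U
  rw [h0] at h1
  have h2 : inner 𝕜 (H2o.toL2 U) f = 0 := by
    rw [← h1]
    simp [energyForm]
  rw [L2.inner_def] at h2
  rw [← h2]
  apply integral_congr_ae
  filter_upwards [hU] with x hx
  rw [hx, RCLike.inner_apply, RCLike.conj_ofReal, RCLike.real_smul_eq_coe_mul, mul_comm]

theorem plateOp_graph (hΩ : IsOpen Ω) : (plateOp 𝕜 Ω).graph = plateGraph 𝕜 Ω :=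
  Submodule.toLinearPMap_graph_eq _ (plateGraph_single_valued hΩ)

theorem waveOp_graph (hΩ : IsOpen Ω) : (waveOp 𝕜 Ω).graph = waveGraph 𝕜 Ω := by
  refine Submodule.toLinearPMap_graph_eq _ ?_
  rintro ⟨x, y⟩ ⟨h1, h2⟩ (rfl : x = 0)
  rw [plateOp_graph hΩ] at h2
  have e1 : y.fst = 0 := plateGraph_single_valued hΩ _ h2 rfl
  have e2 : y.snd = 0 := H2o.toL2_injective hΩ (by rw [map_zero]; exact h1.symm)
  exact WithLp.ofLp_injective 2 (Prod.ext e1 e2)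

variable (𝕜)

/-! ## Semigroups -/

/-- A strongly continuous semigroup of bounded linear operators on `X`. -/
structure C0Semigroup (X : Type*) [NormedAddCommGroup X] [NormedSpace 𝕜 X] where
  /-- The operators of the semigroup. -/
  op : ℝ≥0 → X →L[𝕜] X
  op_zero : op 0 = ContinuousLinearMap.id 𝕜 X
  op_add : ∀ s t, op (s + t) = (op s).comp (op t)
  continuous_orbit : ∀ x, Continuous fun t => op t x

variable {𝕜}

/-- `A` is the generator of the semigroup `T`: its domain consists of all `x` for which
`lim_{h → 0+} (T(h) x - x) / h` exists, and `A x` is this limit. -/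
def Generates {X : Type*} [NormedAddCommGroup X] [NormedSpace 𝕜 X] (A : X →ₗ.[𝕜] X)
    (T : C0Semigroup 𝕜 X) : Prop :=
  ∀ x y : X, (x, y) ∈ A.graph ↔
    Tendsto (fun h : ℝ≥0 => ((h : ℝ) : 𝕜)⁻¹ • (T.op h x - x)) (𝓝[>] 0) (𝓝 y)

end Plate

end

/-! The equation is a first-order system whose natural energy is the squared norm of `(v, w, Δw,
∇w)` in `L²`. The generation statement is the Lumer–Phillips theorem for this energy; the domain
statement is elliptic regularity for the Dirichlet Laplacian. Both rest on the fact that `1 - Δ`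
maps `H²_o(Ω)` onto `L²(Ω)` (`H2o.exists_sub_laplacian_eq`): the Riesz projection gives a weak
solution in `H¹₀`, and `hasReg_dirichlet` with `k = 0` makes it `H²`.

Domain. Green's formula turns the form into `⟨Δψ, Δφ - φ⟩`. If this equals `⟨ψ, f⟩` for all `ψ`,
then `Δφ - φ` is a very weak solution of a Dirichlet problem, and surjectivity of `1 - Δ` on the
test side forces `Δφ ∈ H²_o` (`mem_plateGraph_iff`). Then `φ` solves a Dirichlet problem with
right-hand side in `H²`, so `φ ∈ H⁴`. Conversely, if `φ ∈ H⁴_o` then `Δφ ∈ H²_o`, and Green's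
formula applies twice.

Regularity. In dimension one, `Δu` is already the second derivative. In dimension two, a cutoff
replaces `Ω` by a region `G` on one side of a graph `x_j = γ(x_i)`. Translating `x_i` and shearing
`x_j` along `γ` gives a flow that preserves `G` and Lebesgue measure, so composition with it acts
isometrically on `L²(G)` and maps `H¹₀(G)` to itself. Nirenberg's difference method along this flow
shows that the tangential derivative `∂_i u + γ' ∂_j u` is again in `H¹₀(G)`
(`ShearDomain.tangential_mem`), without flattening the boundary. The remaining second derivatives
follow algebraically from the equation (`ShearDomain.weakPd_normal`), and higher orders by
induction, because the tangential derivative solves a Dirichlet problem of the same kind.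

Generation. In the energy inner product the two terms coupling `v` and `𝔸w` cancel in the real part,
leaving only `Re ⟨w, v⟩`, which the energy bounds: the operator is quasi-dissipative
(`re_inner_energyMap_le`). The range condition is Lax–Milgram (`exists_sub_mem_waveOp_graph`). The
energy norm is equivalent to the norm of `𝔛` by the bounded inverse of `1 - Δ`, and the semigroup is
the limit of the exponentials of the Yosida approximations (`exists_semigroup_of_resolvents`). -/

noncomputable section

namespace Plate

variable {𝕜 : Type*} [RCLike 𝕜] {n : ℕ} {Ω : Set (EuclideanSpace ℝ (Fin n))}

/-! ## Partial derivatives and bounded smooth coefficients -/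

/-- Euclidean space of dimension `n`. -/
abbrev Euc (n : ℕ) : Type := EuclideanSpace ℝ (Fin n)

/-- The classical partial derivative `∂_i φ`. -/
def pd {F : Type*} [NormedAddCommGroup F] [NormedSpace ℝ F] (i : Fin n) (φ : Euc n → F)
    (x : Euc n) : F :=
  fderiv ℝ φ x (EuclideanSpace.single i (1 : ℝ))

theorem IsTest.pd {F : Type*} [NormedAddCommGroup F] [NormedSpace ℝ F]
    {φ : Euc n → F} (h : IsTest Ω φ) (i : Fin n) : IsTest Ω (pd i φ) :=
  h.fderiv_apply _

theorem pd_comm {F : Type*} [NormedAddCommGroup F] [NormedSpace ℝ F] {φ : Euc n → F}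
    (h : ContDiff ℝ ∞ φ) (i j : Fin n) : pd i (pd j φ) = pd j (pd i φ) :=
  fderiv_comm h _ _

theorem pd_mul {a b : Euc n → ℝ} (ha : ContDiff ℝ ∞ a) (hb : ContDiff ℝ ∞ b) (i : Fin n)
    (x : Euc n) : pd i (fun y => a y * b y) x = a x * pd i b x + pd i a x * b x := by
  unfold pd
  rw [fderiv_fun_mul (ha.differentiable (by simp) x) (hb.differentiable (by simp) x)]
  simp [mul_comm]

theorem IsTest.mul_left {a φ : Euc n → ℝ} (ha : ContDiff ℝ ∞ a) (h : IsTest Ω φ) :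
    IsTest Ω (fun x => a x * φ x) where
  contDiff := ha.mul h.contDiff
  hasCompactSupport := h.hasCompactSupport.mul_left
  tsupport_subset := (tsupport_mul_subset_right (f := a) (g := φ)).trans h.tsupport_subset

/-- Smooth functions all of whose derivatives are bounded. -/
def SmoothBdd (a : Euc n → ℝ) : Prop :=
  ∃ P : (Euc n → ℝ) → Prop, P a ∧
    ∀ b, P b → ContDiff ℝ ∞ b ∧ (∃ C, ∀ x, |b x| ≤ C) ∧ ∀ i, P (pd i b)

theorem SmoothBdd.contDiff {a : Euc n → ℝ} (h : SmoothBdd a) : ContDiff ℝ ∞ a := by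
  obtain ⟨P, h, hP⟩ := h
  exact (hP a h).1

theorem SmoothBdd.bdd {a : Euc n → ℝ} (h : SmoothBdd a) : ∃ C, ∀ x, |a x| ≤ C := by
  obtain ⟨P, h, hP⟩ := h
  exact (hP a h).2.1

theorem SmoothBdd.pd {a : Euc n → ℝ} (h : SmoothBdd a) (i : Fin n) : SmoothBdd (pd i a) := by
  obtain ⟨P, h, hP⟩ := h
  exact ⟨P, (hP a h).2.2 i, hP⟩

/-- The class of compactly supported smooth functions is closed under partial derivatives, so it
serves as the class `P` that `SmoothBdd` asks for. -/
theorem smoothBdd_of_hasCompactSupport {a : Euc n → ℝ} (h : ContDiff ℝ ∞ a)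
    (hs : HasCompactSupport a) : SmoothBdd a := by
  refine ⟨fun b => IsTest Set.univ b, ⟨h, hs, Set.subset_univ _⟩, fun b hb =>
    ⟨hb.contDiff, ?_, fun i => hb.pd i⟩⟩
  obtain ⟨C, hC⟩ := hb.hasCompactSupport.exists_bound_of_continuous hb.contDiff.continuous
  exact ⟨C, hC⟩

theorem pd_comp_coord {c : ℝ → ℝ} (hc : ContDiff ℝ ∞ c) (i l : Fin n) :
    pd l (fun x : Euc n => c (x i)) = fun x => if l = i then deriv c (x i) else 0 := by
  funext x
  have h1 : HasFDerivAt (fun x : Euc n => x i) (EuclideanSpace.proj i : Euc n →L[ℝ] ℝ) x :=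
    (EuclideanSpace.proj i : Euc n →L[ℝ] ℝ).hasFDerivAt
  have h2 := ((hc.differentiable (by simp)) (x i)).hasDerivAt.comp_hasFDerivAt x h1
  have h3 : pd l (fun x : Euc n => c (x i)) x = _ := congrArg
    (fun L : Euc n →L[ℝ] ℝ => L (EuclideanSpace.single l (1 : ℝ))) h2.fderiv
  rw [h3]
  simp [eq_comm]

/-- Coefficients such as `γ'(x_i)` and `1 / (1 + γ'(x_i)²)` need not have compact support in space.
The invariant class here consists of the functions `c(x_i)` with `c` bounded and `c'` compactly
supported; `∂_l` sends `c(x_i)` to `c'(x_i)` or to `0`. -/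
theorem smoothBdd_comp_coord {c : ℝ → ℝ} (hc : ContDiff ℝ ∞ c) (hb : ∃ C, ∀ s, |c s| ≤ C)
    (hs : HasCompactSupport (deriv c)) (i : Fin n) : SmoothBdd (fun x : Euc n => c (x i)) := by
  refine ⟨fun b => ∃ c : ℝ → ℝ, ContDiff ℝ ∞ c ∧ (∃ C, ∀ s, |c s| ≤ C) ∧
    HasCompactSupport (deriv c) ∧ b = fun x => c (x i), ⟨c, hc, hb, hs, rfl⟩, ?_⟩
  rintro b ⟨c, hc, ⟨C, hC⟩, hs, rfl⟩
  have hc' : ContDiff ℝ ∞ (deriv c) := ((contDiff_succ_iff_deriv (n := ∞)).1 (by simpa using hc)).2.2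
  have hco : ContDiff ℝ ∞ (fun x : Euc n => x i) :=
    (EuclideanSpace.proj i : Euc n →L[ℝ] ℝ).contDiff
  refine ⟨hc.comp hco, ⟨C, fun x => hC _⟩, fun l => ?_⟩
  rw [pd_comp_coord hc]
  by_cases h : l = i
  · obtain ⟨C', hC'⟩ := hs.exists_bound_of_continuous hc'.continuous
    exact ⟨deriv c, hc', ⟨C', hC'⟩, hs.deriv, by simp [h]⟩
  · exact ⟨0, contDiff_const, ⟨0, by simp⟩, by
      have : deriv (0 : ℝ → ℝ) = 0 := by funext s; exact deriv_const s (0 : ℝ)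
      rw [this]; exact HasCompactSupport.zero, by simp [h]⟩

theorem SmoothBdd.memLp_smul {a : Euc n → ℝ} (ha : SmoothBdd a) {u : Euc n → 𝕜}
    {μ : Measure (Euc n)} (hu : MemLp u 2 μ) : MemLp (fun x => a x • u x) 2 μ := by
  obtain ⟨C, hC⟩ := ha.bdd
  refine MemLp.of_le_mul (c := C) hu
    (ha.contDiff.continuous.aestronglyMeasurable.smul hu.1) (Eventually.of_forall fun x => ?_)
  rw [norm_smul]
  exact mul_le_mul_of_nonneg_right (hC x) (norm_nonneg _)

/-! ## Weak divergence of square integrable fields -/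

theorem IsTest.integrable_smul {φ : Euc n → ℝ} (h : IsTest Ω φ) {u : Euc n → 𝕜}
    (hu : MemLp u 2 (volume.restrict Ω)) :
    Integrable (fun x => φ x • u x) (volume.restrict Ω) := by
  have h1 : MemLp φ 2 (volume.restrict Ω) :=
    h.contDiff.continuous.memLp_of_hasCompactSupport h.hasCompactSupport
  exact memLp_one_iff_integrable.1 (hu.smul h1)

/-- The square integrable function `f` is the weak divergence on `Ω` of the square integrable
vector field `W`. -/
structure WeakDiv (Ω : Set (Euc n)) (W : Fin n → Euc n → 𝕜) (f : Euc n → 𝕜) : Prop where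
  memLp_field : ∀ l, MemLp (W l) 2 (volume.restrict Ω)
  memLp : MemLp f 2 (volume.restrict Ω)
  integral_eq : ∀ ψ : Euc n → ℝ, IsTest Ω ψ →
    ∑ l, ∫ x in Ω, pd l ψ x • W l x = -∫ x in Ω, ψ x • f x

/-! ### Calculus of weak divergences: linearity, product rule, uniqueness. -/

namespace WeakDiv

variable {W V : Fin n → Euc n → 𝕜} {f g : Euc n → 𝕜}

theorem congr (h : WeakDiv Ω W f) (hW : ∀ l, W l =ᵐ[volume.restrict Ω] V l)
    (hf : f =ᵐ[volume.restrict Ω] g) : WeakDiv Ω V g where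
  memLp_field l := (memLp_congr_ae (hW l)).1 (h.memLp_field l)
  memLp := (memLp_congr_ae hf).1 h.memLp
  integral_eq ψ hψ := by
    have e1 : ∀ l, ∫ x in Ω, pd l ψ x • V l x = ∫ x in Ω, pd l ψ x • W l x := fun l =>
      integral_congr_ae ((hW l).mono fun x hx => by simp only [hx])
    have e2 : ∫ x in Ω, ψ x • g x = ∫ x in Ω, ψ x • f x :=
      integral_congr_ae (hf.mono fun x hx => by simp only [hx])
    rw [e2, ← h.integral_eq ψ hψ, Finset.sum_congr rfl fun l _ => e1 l]

theorem add (h : WeakDiv Ω W f) (h' : WeakDiv Ω V g) :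
    WeakDiv Ω (fun l x => W l x + V l x) (fun x => f x + g x) where
  memLp_field l := (h.memLp_field l).add (h'.memLp_field l)
  memLp := h.memLp.add h'.memLp
  integral_eq ψ hψ := by
    simp only [smul_add]
    rw [integral_add (hψ.integrable_smul h.memLp) (hψ.integrable_smul h'.memLp), neg_add,
      ← h.integral_eq ψ hψ, ← h'.integral_eq ψ hψ, ← Finset.sum_add_distrib]
    exact Finset.sum_congr rfl fun l _ => integral_add
      ((hψ.pd l).integrable_smul (h.memLp_field l)) ((hψ.pd l).integrable_smul (h'.memLp_field l))

/-- The product rule comes from testing the identity for `W` with `a ψ`; the terms carrying `∂_l a`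
go to the right-hand side. -/
theorem smul {a : Euc n → ℝ} (ha : SmoothBdd a) (h : WeakDiv Ω W f) :
    WeakDiv Ω (fun l x => a x • W l x) (fun x => a x • f x + ∑ l, pd l a x • W l x) where
  memLp_field l := ha.memLp_smul (h.memLp_field l)
  memLp := (ha.memLp_smul h.memLp).add
    (memLp_finsetSum _ fun l _ => (ha.pd l).memLp_smul (h.memLp_field l))
  integral_eq ψ hψ := by
    have hθ : IsTest Ω (fun x => a x * ψ x) := hψ.mul_left ha.contDiff
    have i1 : ∀ l, Integrable (fun x => (a x * pd l ψ x) • W l x) (volume.restrict Ω) := fun l =>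
      ((hψ.pd l).mul_left ha.contDiff).integrable_smul (h.memLp_field l)
    have i2 : ∀ l, Integrable (fun x => (pd l a x * ψ x) • W l x) (volume.restrict Ω) := fun l =>
      (hψ.mul_left (ha.pd l).contDiff).integrable_smul (h.memLp_field l)
    have e1 : ∀ l, ∫ x in Ω, pd l (fun y => a y * ψ y) x • W l x =
        (∫ x in Ω, (a x * pd l ψ x) • W l x) + ∫ x in Ω, (pd l a x * ψ x) • W l x := by
      intro l
      rw [← integral_add (i1 l) (i2 l)]
      congr 1
      funext x
      rw [pd_mul ha.contDiff hψ.contDiff, add_smul]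
    have e2 := h.integral_eq _ hθ
    simp only [e1, Finset.sum_add_distrib] at e2
    have e3 : ∫ x in Ω, ψ x • (a x • f x + ∑ l, pd l a x • W l x) =
        (∫ x in Ω, (a x * ψ x) • f x) + ∑ l, ∫ x in Ω, (pd l a x * ψ x) • W l x := by
      rw [← integral_finsetSum _ fun l _ => i2 l,
        ← integral_add (hθ.integrable_smul h.memLp) (integrable_finsetSum _ fun l _ => i2 l)]
      congr 1
      funext x
      simp only [smul_add, Finset.smul_sum, smul_smul, mul_comm (ψ x)]
    rw [e3, neg_add, ← e2, add_neg_cancel_right]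
    refine Finset.sum_congr rfl fun l _ => ?_
    congr 1
    funext x
    rw [smul_smul, mul_comm]

theorem const_mul (c : ℝ) (h : WeakDiv Ω W f) :
    WeakDiv Ω (fun l x => c • W l x) (fun x => c • f x) where
  memLp_field l := (h.memLp_field l).const_smul c
  memLp := h.memLp.const_smul c
  integral_eq ψ hψ := by
    simp only [smul_comm _ c, integral_smul]
    rw [← Finset.smul_sum, h.integral_eq ψ hψ, smul_neg]

theorem neg (h : WeakDiv Ω W f) : WeakDiv Ω (fun l x => - W l x) (fun x => - f x) := by
  simpa using h.const_mul (-1)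

theorem sub (h : WeakDiv Ω W f) (h' : WeakDiv Ω V g) :
    WeakDiv Ω (fun l x => W l x - V l x) (fun x => f x - g x) := by
  simpa only [sub_eq_add_neg] using h.add h'.neg

theorem sum {ι : Type*} (s : Finset ι) {W : ι → Fin n → Euc n → 𝕜} {f : ι → Euc n → 𝕜}
    (h : ∀ k, WeakDiv Ω (W k) (f k)) :
    WeakDiv Ω (fun l x => ∑ k ∈ s, W k l x) (fun x => ∑ k ∈ s, f k x) := by
  classical
  induction s using Finset.induction_on with
  | empty => exact ⟨fun l => by simp, by simp, fun ψ _ => by simp⟩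
  | insert k s hk ih =>
    simp only [Finset.sum_insert hk]
    exact (h k).add ih

theorem unique (hΩ : IsOpen Ω) (h : WeakDiv Ω W f) (h' : WeakDiv Ω W g) :
    f =ᵐ[volume.restrict Ω] g := by
  have hd := h.memLp.sub h'.memLp
  have hz : hd.toLp _ = 0 := by
    refine eq_zero_of_forall_test hΩ _ fun φ hφ => ?_
    have e1 : ∫ x in Ω, φ x • hd.toLp (f - g) x = ∫ x in Ω, (φ x • f x - φ x • g x) := by
      refine integral_congr_ae (hd.coeFn_toLp.mono fun x hx => ?_)
      simp only [hx, Pi.sub_apply, smul_sub]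
    rw [e1, integral_sub (hφ.integrable_smul h.memLp) (hφ.integrable_smul h'.memLp), sub_eq_zero]
    exact neg_injective ((h.integral_eq φ hφ).symm.trans (h'.integral_eq φ hφ))
  have h0 := hd.coeFn_toLp
  rw [hz] at h0
  filter_upwards [h0, Lp.coeFn_zero 𝕜 2 (volume.restrict Ω)] with x h1 h2
  rw [h2] at h1
  exact (sub_eq_zero.1 h1.symm)

end WeakDiv

/-- `g` is the weak partial derivative `∂_i u` on `Ω`, both functions being square integrable. -/
def WeakPd (Ω : Set (Euc n)) (i : Fin n) (u g : Euc n → 𝕜) : Prop :=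
  WeakDiv Ω (fun l x => if l = i then u x else 0) g

/-- A partial derivative is treated as the divergence of a field with one nonzero component, so that
the rules for `WeakDiv` carry over. Here the encoding is unwound to the usual definition. -/
theorem weakPd_iff {i : Fin n} {u g : Euc n → 𝕜} :
    WeakPd Ω i u g ↔ MemLp u 2 (volume.restrict Ω) ∧ MemLp g 2 (volume.restrict Ω) ∧
      ∀ ψ : Euc n → ℝ, IsTest Ω ψ → ∫ x in Ω, pd i ψ x • u x = -∫ x in Ω, ψ x • g x := by
  have e : ∀ ψ : Euc n → ℝ, ∑ l, ∫ x in Ω, pd l ψ x • (if l = i then u x else 0) =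
      ∫ x in Ω, pd i ψ x • u x := by
    intro ψ
    rw [Finset.sum_eq_single i (fun l _ hl => by simp [hl]) (by simp)]
    simp
  constructor
  · intro h
    refine ⟨by simpa using h.memLp_field i, h.memLp, fun ψ hψ => ?_⟩
    rw [← e, h.integral_eq ψ hψ]
  · rintro ⟨h1, h2, h3⟩
    refine ⟨fun l => ?_, h2, fun ψ hψ => ?_⟩
    · by_cases hl : l = i
      · simpa [hl] using h1
      · simp [hl]
    · rw [e, h3 ψ hψ]

namespace WeakPd

variable {i : Fin n} {u v g h : Euc n → 𝕜}

theorem memLp (hu : WeakPd Ω i u g) : MemLp u 2 (volume.restrict Ω) := (weakPd_iff.1 hu).1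

theorem memLp_deriv (hu : WeakPd Ω i u g) : MemLp g 2 (volume.restrict Ω) := WeakDiv.memLp hu

theorem congr (hu : WeakPd Ω i u g) (h1 : u =ᵐ[volume.restrict Ω] v)
    (h2 : g =ᵐ[volume.restrict Ω] h) : WeakPd Ω i v h :=
  WeakDiv.congr hu (fun l => h1.mono fun x hx => by simp only [hx]) h2

theorem add (hu : WeakPd Ω i u g) (hv : WeakPd Ω i v h) :
    WeakPd Ω i (fun x => u x + v x) (fun x => g x + h x) :=
  (WeakDiv.add hu hv).congr (fun l => Eventually.of_forall fun x => by
    by_cases hl : l = i <;> simp [hl]) (ae_eq_refl _)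

theorem sub (hu : WeakPd Ω i u g) (hv : WeakPd Ω i v h) :
    WeakPd Ω i (fun x => u x - v x) (fun x => g x - h x) :=
  (WeakDiv.sub hu hv).congr (fun l => Eventually.of_forall fun x => by
    by_cases hl : l = i <;> simp [hl]) (ae_eq_refl _)

theorem smul {a : Euc n → ℝ} (ha : SmoothBdd a) (hu : WeakPd Ω i u g) :
    WeakPd Ω i (fun x => a x • u x) (fun x => a x • g x + pd i a x • u x) :=
  (WeakDiv.smul ha hu).congr (fun l => Eventually.of_forall fun x => by
    by_cases hl : l = i <;> simp [hl]) (Eventually.of_forall fun x => by simp)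

theorem unique (hΩ : IsOpen Ω) (hu : WeakPd Ω i u g) (hu' : WeakPd Ω i u h) :
    g =ᵐ[volume.restrict Ω] h :=
  WeakDiv.unique hΩ hu hu'

/-- Existence of `∂_i ∂_j w` is a conclusion, not an assumption: the derivatives are moved to the
test function, where they commute. This later supplies a mixed derivative that is known in one order
only. -/
theorem symm {j : Fin n} {w wi wj wij : Euc n → 𝕜} (hi : WeakPd Ω i w wi) (hj : WeakPd Ω j w wj)
    (hij : WeakPd Ω j wi wij) : WeakPd Ω i wj wij := by
  refine weakPd_iff.2 ⟨hj.memLp_deriv, hij.memLp_deriv, fun ψ hψ => ?_⟩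
  have e1 := (weakPd_iff.1 hj).2.2 _ (hψ.pd i)
  have e2 := (weakPd_iff.1 hi).2.2 _ (hψ.pd j)
  have e3 := (weakPd_iff.1 hij).2.2 _ hψ
  rw [pd_comm hψ.contDiff, e2] at e1
  rw [← e3, neg_injective e1]

end WeakPd

theorem WeakDiv.of_weakPd {W g : Fin n → Euc n → 𝕜} (h : ∀ l, WeakPd Ω l (W l) (g l)) :
    WeakDiv Ω W (fun x => ∑ l, g l x) := by
  refine (WeakDiv.sum Finset.univ h).congr (fun l => Eventually.of_forall fun x => ?_)
    (ae_eq_refl _)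
  simp

/-- The divergence commutes with partial derivatives. -/
theorem WeakDiv.deriv {W W' : Fin n → Euc n → 𝕜} {f f' : Euc n → 𝕜} {i : Fin n}
    (h : WeakDiv Ω W f) (hW : ∀ l, WeakPd Ω i (W l) (W' l)) (hf : WeakPd Ω i f f') :
    WeakDiv Ω W' f' := by
  refine ⟨fun l => (hW l).memLp_deriv, hf.memLp_deriv, fun ψ hψ => ?_⟩
  have e1 : ∀ l, ∫ x in Ω, pd l ψ x • W' l x = -∫ x in Ω, pd l (pd i ψ) x • W l x := by
    intro l
    rw [pd_comm hψ.contDiff, (weakPd_iff.1 (hW l)).2.2 _ (hψ.pd l), neg_neg]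
  rw [Finset.sum_congr rfl fun l _ => e1 l, Finset.sum_neg_distrib, h.integral_eq _ (hψ.pd i),
    (weakPd_iff.1 hf).2.2 _ hψ, neg_neg]

/-! ## Square integrable functions with square integrable derivatives up to order `k` -/

/-- `u` and its weak derivatives of order at most `k` are square integrable on `Ω`. -/
def HasReg (Ω : Set (Euc n)) : ℕ → (Euc n → 𝕜) → Prop
  | 0, u => MemLp u 2 (volume.restrict Ω)
  | k + 1, u => MemLp u 2 (volume.restrict Ω) ∧ ∀ i, ∃ g, WeakPd Ω i u g ∧ HasReg Ω k g

namespace HasReg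

theorem memLp {k : ℕ} {u : Euc n → 𝕜} (h : HasReg Ω k u) : MemLp u 2 (volume.restrict Ω) := by
  cases k with
  | zero => exact h
  | succ k => exact h.1

theorem of_succ {k : ℕ} {u : Euc n → 𝕜} (h : HasReg Ω (k + 1) u) : HasReg Ω k u := by
  induction k generalizing u with
  | zero => exact h.1
  | succ k ih =>
    refine ⟨h.1, fun i => ?_⟩
    obtain ⟨g, h1, h2⟩ := h.2 i
    exact ⟨g, h1, ih h2⟩

theorem congr {k : ℕ} {u v : Euc n → 𝕜} (h : HasReg Ω k u) (huv : u =ᵐ[volume.restrict Ω] v) :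
    HasReg Ω k v := by
  cases k with
  | zero => exact (memLp_congr_ae huv).1 h
  | succ k =>
    refine ⟨(memLp_congr_ae huv).1 h.1, fun i => ?_⟩
    obtain ⟨g, h1, h2⟩ := h.2 i
    exact ⟨g, h1.congr huv (ae_eq_refl _), h2⟩

theorem deriv (hΩ : IsOpen Ω) {k : ℕ} {u g : Euc n → 𝕜} {i : Fin n} (h : HasReg Ω (k + 1) u)
    (hg : WeakPd Ω i u g) : HasReg Ω k g := by
  obtain ⟨g', h1, h2⟩ := h.2 i
  exact h2.congr (h1.unique hΩ hg)

theorem add {k : ℕ} {u v : Euc n → 𝕜} (hu : HasReg Ω k u) (hv : HasReg Ω k v) :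
    HasReg Ω k (fun x => u x + v x) := by
  induction k generalizing u v with
  | zero => exact MemLp.add hu hv
  | succ k ih =>
    refine ⟨MemLp.add hu.1 hv.1, fun i => ?_⟩
    obtain ⟨g, h1, h2⟩ := hu.2 i
    obtain ⟨g', h1', h2'⟩ := hv.2 i
    exact ⟨_, h1.add h1', ih h2 h2'⟩

theorem smul {k : ℕ} {a : Euc n → ℝ} (ha : SmoothBdd a) {u : Euc n → 𝕜} (hu : HasReg Ω k u) :
    HasReg Ω k (fun x => a x • u x) := by
  induction k generalizing a u with
  | zero => exact ha.memLp_smul hu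
  | succ k ih =>
    refine ⟨ha.memLp_smul hu.1, fun i => ?_⟩
    obtain ⟨g, h1, h2⟩ := hu.2 i
    exact ⟨_, h1.smul ha, (ih ha h2).add (ih (ha.pd i) hu.of_succ)⟩

theorem sub {k : ℕ} {u v : Euc n → 𝕜} (hu : HasReg Ω k u) (hv : HasReg Ω k v) :
    HasReg Ω k (fun x => u x - v x) := by
  induction k generalizing u v with
  | zero => exact MemLp.sub hu hv
  | succ k ih =>
    refine ⟨MemLp.sub hu.1 hv.1, fun i => ?_⟩
    obtain ⟨g, h1, h2⟩ := hu.2 i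
    obtain ⟨g', h1', h2'⟩ := hv.2 i
    exact ⟨_, h1.sub h1', ih h2 h2'⟩

theorem zero (k : ℕ) : HasReg Ω k (fun _ : Euc n => (0 : 𝕜)) := by
  induction k with
  | zero => exact MemLp.zero'
  | succ k ih =>
    exact ⟨MemLp.zero', fun i => ⟨fun _ => 0,
      weakPd_iff.2 ⟨MemLp.zero', MemLp.zero', fun ψ _ => by simp⟩, ih⟩⟩

theorem sum {ι : Type*} (s : Finset ι) {k : ℕ} {u : ι → Euc n → 𝕜}
    (hu : ∀ m, HasReg Ω k (u m)) : HasReg Ω k (fun x => ∑ m ∈ s, u m x) := by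
  classical
  induction s using Finset.induction_on with
  | empty =>
    simpa using zero k
  | insert m s hm ih =>
    simp only [Finset.sum_insert hm]
    exact (hu m).add ih

end HasReg

/-! ## Transfer between sets that agree on a ball -/

section Transfer

variable {G : Set (Euc n)} {x₀ : Euc n} {r s : ℝ}

theorem eLpNorm_transfer {U : Set (Euc n)} (hU : MeasurableSet U) (hG : Ω ∩ U = G ∩ U)
    {f : Euc n → 𝕜} (hf : ∀ x, x ∉ U → f x = 0) :
    eLpNorm f 2 (volume.restrict G) = eLpNorm f 2 (volume.restrict Ω) := by
  have e : U.indicator f = f := Set.indicator_eq_self.2 fun x hx => by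
    by_contra h
    exact hx (hf x h)
  rw [← e, eLpNorm_indicator_eq_eLpNorm_restrict hU, eLpNorm_indicator_eq_eLpNorm_restrict hU,
    Measure.restrict_restrict hU, Measure.restrict_restrict hU, Set.inter_comm U, Set.inter_comm U,
    hG]

theorem memLp_transfer {U : Set (Euc n)} (hU : MeasurableSet U) (hG : Ω ∩ U = G ∩ U)
    {f : Euc n → 𝕜} (hf : ∀ x, x ∉ U → f x = 0) (h : MemLp f 2 (volume.restrict Ω)) :
    MemLp f 2 (volume.restrict G) := by
  have e : U.indicator f = f := Set.indicator_eq_self.2 fun x hx => by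
    by_contra h
    exact hx (hf x h)
  rw [← e, memLp_indicator_iff_restrict hU, Measure.restrict_restrict hU, Set.inter_comm U] at h ⊢
  rwa [← hG]

theorem integral_transfer {U : Set (Euc n)} (hU : MeasurableSet U) (hG : Ω ∩ U = G ∩ U)
    {f : Euc n → 𝕜} (hf : ∀ x, x ∉ U → f x = 0) : ∫ x in G, f x = ∫ x in Ω, f x := by
  have e : U.indicator f = f := Set.indicator_eq_self.2 fun x hx => by
    by_contra h
    exact hx (hf x h)
  rw [← e, setIntegral_indicator hU, setIntegral_indicator hU, hG]

/-- A smooth cutoff function equal to one near a ball and supported in a larger one. -/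
theorem exists_cutoff (x₀ : Euc n) (hs : 0 < s) (hsr : s < r) :
    ∃ (χ : Euc n → ℝ) (s' : ℝ), s < s' ∧ s' < r ∧ SmoothBdd χ ∧ IsTest (Metric.ball x₀ r) χ ∧
      (∀ x, x ∉ Metric.closedBall x₀ s' → χ x = 0) ∧
      (∀ x ∈ Metric.closedBall x₀ s, χ =ᶠ[𝓝 x] 1) := by
  let χ : ContDiffBump x₀ := ⟨(2 * s + r) / 3, (s + 2 * r) / 3, by linarith, by linarith⟩
  have ht : tsupport χ = Metric.closedBall x₀ ((s + 2 * r) / 3) := χ.tsupport_eq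
  refine ⟨χ, (s + 2 * r) / 3, by linarith, by linarith,
    smoothBdd_of_hasCompactSupport χ.contDiff χ.hasCompactSupport,
    ⟨χ.contDiff, χ.hasCompactSupport, ?_⟩, fun x hx => ?_, fun x hx => ?_⟩
  · rw [ht]
    exact Metric.closedBall_subset_ball (by linarith)
  · rw [← ht] at hx
    exact image_eq_zero_of_notMem_tsupport hx
  · refine χ.eventuallyEq_one_of_mem_ball ?_
    rw [Metric.mem_closedBall] at hx
    rw [Metric.mem_ball]
    change dist x x₀ < (2 * s + r) / 3
    linarith

theorem pd_eq_of_eventuallyEq {F : Type*} [NormedAddCommGroup F] [NormedSpace ℝ F]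
    {φ ψ : Euc n → F} {x : Euc n} (h : φ =ᶠ[𝓝 x] ψ) (i : Fin n) : pd i φ x = pd i ψ x := by
  unfold pd
  rw [h.fderiv_eq]

theorem pd_one (i : Fin n) (x : Euc n) : pd i (1 : Euc n → ℝ) x = 0 := by
  change fderiv ℝ (fun _ => (1 : ℝ)) x _ = 0
  simp

/-- A test function on `G`, multiplied by a cutoff that is one near the supports of `W` and `f` and
is supported in the ball, becomes a test function on `Ω`; no integral changes. -/
theorem WeakDiv.transfer (hs : 0 < s) (hsr : s < r)
    (hG : Ω ∩ Metric.ball x₀ r = G ∩ Metric.ball x₀ r) {W : Fin n → Euc n → 𝕜} {f : Euc n → 𝕜}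
    (hW : ∀ l x, x ∉ Metric.closedBall x₀ s → W l x = 0)
    (hf : ∀ x, x ∉ Metric.closedBall x₀ s → f x = 0) (h : WeakDiv Ω W f) : WeakDiv G W f := by
  have hU : MeasurableSet (Metric.ball x₀ r) := measurableSet_ball
  have hsub : ∀ x, x ∉ Metric.ball x₀ r → x ∉ Metric.closedBall x₀ s := fun x hx hx' =>
    hx (Metric.closedBall_subset_ball hsr hx')
  obtain ⟨χ, s', -, -, hχ, hχt, -, hχ1⟩ := exists_cutoff x₀ hs hsr
  refine ⟨fun l => memLp_transfer hU hG (fun x hx => hW l x (hsub x hx)) (h.memLp_field l),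
    memLp_transfer hU hG (fun x hx => hf x (hsub x hx)) h.memLp, fun ψ hψ => ?_⟩
  have hθ : IsTest Ω (fun x => χ x * ψ x) := by
    refine ⟨hχ.contDiff.mul hψ.contDiff, hψ.hasCompactSupport.mul_left, fun x hx => ?_⟩
    have h1 : x ∈ G ∩ Metric.ball x₀ r :=
      ⟨hψ.tsupport_subset (tsupport_mul_subset_right (f := χ) (g := ψ) hx),
        hχt.tsupport_subset (tsupport_mul_subset_left (f := χ) (g := ψ) hx)⟩
    rw [← hG] at h1
    exact h1.1
  have e1 : ∀ l, ∫ x in G, pd l ψ x • W l x = ∫ x in Ω, pd l (fun x => χ x * ψ x) x • W l x := by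
    intro l
    rw [integral_transfer hU hG fun x hx => by rw [hW l x (hsub x hx), smul_zero]]
    congr 1
    funext x
    by_cases hx : x ∈ Metric.closedBall x₀ s
    · rw [pd_mul hχ.contDiff hψ.contDiff, pd_eq_of_eventuallyEq (hχ1 x hx), (hχ1 x hx).eq_of_nhds,
        pd_one]
      simp
    · rw [hW l x hx, smul_zero, smul_zero]
  have e2 : ∫ x in G, ψ x • f x = ∫ x in Ω, (χ x * ψ x) • f x := by
    rw [integral_transfer hU hG fun x hx => by rw [hf x (hsub x hx), smul_zero]]
    congr 1
    funext x
    by_cases hx : x ∈ Metric.closedBall x₀ s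
    · rw [(hχ1 x hx).eq_of_nhds]
      simp
    · rw [hf x hx, smul_zero, smul_zero]
  rw [e2, Finset.sum_congr rfl fun l _ => e1 l]
  exact h.integral_eq _ hθ

/-- A weak derivative is only defined almost everywhere on `Ω`, so it need not vanish pointwise
outside the small ball. It is replaced by its product with a cutoff, at the price of a slightly
larger radius `s' < r` at each order; hence the induction generalizes over `s`. -/
theorem HasReg.transfer (hs : 0 < s) (hsr : s < r)
    (hG : Ω ∩ Metric.ball x₀ r = G ∩ Metric.ball x₀ r) {k : ℕ} {w : Euc n → 𝕜}
    (hw : ∀ x, x ∉ Metric.closedBall x₀ s → w x = 0) (h : HasReg Ω k w) : HasReg G k w := by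
  induction k generalizing w s with
  | zero =>
    exact memLp_transfer measurableSet_ball hG
      (fun x hx => hw x fun hx' => hx (Metric.closedBall_subset_ball hsr hx')) h
  | succ k ih =>
    refine ⟨memLp_transfer measurableSet_ball hG
      (fun x hx => hw x fun hx' => hx (Metric.closedBall_subset_ball hsr hx')) h.1, fun i => ?_⟩
    obtain ⟨g, h1, h2⟩ := h.2 i
    obtain ⟨χ, s', hs', hs'r, hχ, hχt, hχ0, hχ1⟩ := exists_cutoff x₀ hs hsr
    have h0 : ∀ x, x ∉ Metric.closedBall x₀ s' → χ x • g x = 0 := fun x hx => by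
      rw [hχ0 x hx, zero_smul]
    have h3 : WeakPd Ω i w (fun x => χ x • g x) := by
      refine (h1.smul hχ).congr (Eventually.of_forall fun x => ?_)
        (Eventually.of_forall fun x => ?_)
      · by_cases hx : x ∈ Metric.closedBall x₀ s
        · simp [(hχ1 x hx).eq_of_nhds]
        · simp [hw x hx]
      · by_cases hx : x ∈ Metric.closedBall x₀ s
        · simp [pd_eq_of_eventuallyEq (hχ1 x hx), pd_one]
        · simp [hw x hx]
    refine ⟨_, WeakDiv.transfer (hs.trans hs') hs'r hG (fun l x hx => ?_) h0 h3,
      ih (hs.trans hs') hs'r h0 (h2.smul hχ)⟩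
    rw [hw x fun hx' => hx (Metric.closedBall_subset_closedBall hs'.le hx'), ite_self]

end Transfer

/-! ## Functions with vanishing trace -/

/-- `u` belongs to `H¹₀(Ω)` and has the weak gradient `g`. -/
def ZeroTrace (Ω : Set (Euc n)) (u : Euc n → 𝕜) (g : Fin n → Euc n → 𝕜) : Prop :=
  ∃ p ∈ (testGraph 𝕜 Ω).topologicalClosure, p.1 =ᵐ[volume.restrict Ω] u ∧
    ∀ i, p.2 i =ᵐ[volume.restrict Ω] g i

theorem IsTest.memLp {φ : Euc n → 𝕜} (h : IsTest Ω φ) : MemLp φ 2 (volume.restrict Ω) :=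
  h.contDiff.continuous.memLp_of_hasCompactSupport h.hasCompactSupport

theorem IsTest.smul_left {a : Euc n → ℝ} (ha : ContDiff ℝ ∞ a) {φ : Euc n → 𝕜} (h : IsTest Ω φ) :
    IsTest Ω (fun x => a x • φ x) where
  contDiff := ha.smul h.contDiff
  hasCompactSupport := HasCompactSupport.smul_left (f := a) (f' := φ) h.hasCompactSupport
  tsupport_subset := (tsupport_smul_subset_right a φ).trans h.tsupport_subset

theorem pd_smul {a : Euc n → ℝ} (ha : ContDiff ℝ ∞ a) {φ : Euc n → 𝕜} (hφ : ContDiff ℝ ∞ φ)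
    (i : Fin n) (x : Euc n) :
    pd i (fun y => a y • φ y) x = a x • pd i φ x + pd i a x • φ x := by
  unfold pd
  rw [fderiv_fun_smul (ha.differentiable (by simp) x) (hφ.differentiable (by simp) x)]
  simp

/-- The pair `(φ, ∇φ)` in `L² × (L²)ⁿ`. -/
theorem IsTest.mem_testGraph {φ : Euc n → 𝕜} (h : IsTest Ω φ) :
    ((h.memLp.toLp φ, fun i => (h.pd i).memLp.toLp (Plate.pd i φ)) :
      L2 𝕜 Ω × (Fin n → L2 𝕜 Ω)) ∈ testGraph 𝕜 Ω :=
  ⟨φ, h, h.memLp.coeFn_toLp, fun i => (h.pd i).memLp.coeFn_toLp⟩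

namespace ZeroTrace

variable {u : Euc n → 𝕜} {g : Fin n → Euc n → 𝕜}

theorem memLp (h : ZeroTrace Ω u g) : MemLp u 2 (volume.restrict Ω) := by
  obtain ⟨p, -, h1, -⟩ := h
  exact (memLp_congr_ae h1).1 (Lp.memLp _)

theorem memLp_grad (h : ZeroTrace Ω u g) (i : Fin n) : MemLp (g i) 2 (volume.restrict Ω) := by
  obtain ⟨p, -, -, h1⟩ := h
  exact (memLp_congr_ae (h1 i)).1 (Lp.memLp _)

theorem exists_seq (h : ZeroTrace Ω u g) : ∃ φ : ℕ → Euc n → 𝕜, (∀ k, IsTest Ω (φ k)) ∧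
    Tendsto (fun k => eLpNorm (φ k - u) 2 (volume.restrict Ω)) atTop (𝓝 0) ∧
    ∀ i, Tendsto (fun k => eLpNorm (pd i (φ k) - g i) 2 (volume.restrict Ω)) atTop (𝓝 0) := by
  obtain ⟨p, hp, h1, h2⟩ := h
  obtain ⟨q, hq, hqp⟩ := mem_closure_iff_seq_limit.1 hp
  choose φ hφ hq1 hq2 using hq
  refine ⟨φ, hφ, ?_, fun i => ?_⟩
  · have := (Lp.tendsto_Lp_iff_tendsto_eLpNorm' _ _).1 ((continuous_fst.tendsto p).comp hqp)
    refine this.congr fun k => eLpNorm_congr_ae ?_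
    exact (hq1 k).sub h1
  · have := (Lp.tendsto_Lp_iff_tendsto_eLpNorm' _ _).1
      (((continuous_apply i).comp continuous_snd).tendsto p |>.comp hqp)
    refine this.congr fun k => eLpNorm_congr_ae ?_
    exact (hq2 k i).sub (h2 i)

theorem of_seq (hu : MemLp u 2 (volume.restrict Ω)) (hg : ∀ i, MemLp (g i) 2 (volume.restrict Ω))
    {φ : ℕ → Euc n → 𝕜} (hφ : ∀ k, IsTest Ω (φ k))
    (h1 : Tendsto (fun k => eLpNorm (φ k - u) 2 (volume.restrict Ω)) atTop (𝓝 0))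
    (h2 : ∀ i, Tendsto (fun k => eLpNorm (pd i (φ k) - g i) 2 (volume.restrict Ω)) atTop (𝓝 0)) :
    ZeroTrace Ω u g := by
  refine ⟨(hu.toLp u, fun i => (hg i).toLp (g i)), ?_, hu.coeFn_toLp, fun i => (hg i).coeFn_toLp⟩
  refine mem_closure_iff_seq_limit.2 ⟨_, fun k => (hφ k).mem_testGraph, ?_⟩
  refine Tendsto.prodMk_nhds ?_ (tendsto_pi_nhds.2 fun i => ?_)
  · exact (Lp.tendsto_Lp_iff_tendsto_eLpNorm'' _ _ _ _).2 h1
  · exact (Lp.tendsto_Lp_iff_tendsto_eLpNorm'' _ (fun k => ((hφ k).pd i).memLp) _ _).2 (h2 i)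

end ZeroTrace

/-- Pairing with a test function as an inner product. -/
theorem exists_inner_eq_integral {ψ : Euc n → ℝ} (hψ : IsTest Ω ψ) :
    ∃ η : L2 𝕜 Ω, ∀ u : L2 𝕜 Ω, inner 𝕜 η u = ∫ x in Ω, ψ x • u x := by
  have hm : MemLp ψ 2 (volume.restrict Ω) :=
    hψ.contDiff.continuous.memLp_of_hasCompactSupport hψ.hasCompactSupport
  have hm' : MemLp (fun x => (ψ x : 𝕜)) 2 (volume.restrict Ω) := hm.ofReal
  refine ⟨hm'.toLp _, fun u => ?_⟩
  rw [L2.inner_def]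
  refine integral_congr_ae (hm'.coeFn_toLp.mono fun x hx => ?_)
  simp only [hx]
  rw [RCLike.inner_apply, RCLike.conj_ofReal, RCLike.real_smul_eq_coe_mul, mul_comm]

theorem IsTest.integral_pd_smul {ψ : Euc n → ℝ} {φ : Euc n → 𝕜} (hψ : IsTest Ω ψ)
    (hφ : IsTest Ω φ) (i : Fin n) :
    ∫ x in Ω, Plate.pd i ψ x • φ x = -∫ x in Ω, ψ x • Plate.pd i φ x := by
  have key : ∀ {η : Euc n → ℝ} (u : Euc n → 𝕜), IsTest Ω η →
      ∫ x in Ω, η x • u x = ∫ x, η x • u x := fun u hη =>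
    setIntegral_eq_integral_of_forall_compl_eq_zero fun x hx => by
      rw [image_eq_zero_of_notMem_tsupport fun hx' => hx (hη.tsupport_subset hx'), zero_smul]
  have h := integral_pderiv_smul (fun _ : Fin 1 => i) hψ hφ
  rw [pderiv_succ hψ.contDiff, pderiv_succ hφ.contDiff, pderiv_zero, pderiv_zero, pow_one,
    neg_one_smul] at h
  rw [key φ (hψ.pd i), key _ hψ]
  exact h

/-- The identity holds for test functions, and both of its sides are continuous on `L² × (L²)ⁿ`, so
it passes to the closure. -/
theorem ZeroTrace.weakPd {u : Euc n → 𝕜} {g : Fin n → Euc n → 𝕜} (h : ZeroTrace Ω u g)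
    (i : Fin n) : WeakPd Ω i u (g i) := by
  refine weakPd_iff.2 ⟨h.memLp, h.memLp_grad i, fun ψ hψ => ?_⟩
  obtain ⟨p, hp, h1, h2⟩ := h
  obtain ⟨η, hη⟩ := exists_inner_eq_integral (𝕜 := 𝕜) hψ
  obtain ⟨η', hη'⟩ := exists_inner_eq_integral (𝕜 := 𝕜) (hψ.pd i)
  have hcl : IsClosed {p : L2 𝕜 Ω × (Fin n → L2 𝕜 Ω) | inner 𝕜 η' p.1 = -inner 𝕜 η (p.2 i)} :=
    isClosed_eq (continuous_const.inner continuous_fst)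
      (continuous_const.inner ((continuous_apply i).comp continuous_snd)).neg
  have hsub : ((testGraph 𝕜 Ω : Submodule 𝕜 (L2 𝕜 Ω × (Fin n → L2 𝕜 Ω))) : Set _) ⊆
      {p : L2 𝕜 Ω × (Fin n → L2 𝕜 Ω) | inner 𝕜 η' p.1 = -inner 𝕜 η (p.2 i)} := by
    rintro q ⟨φ, hφ, hq1, hq2⟩
    change inner 𝕜 η' q.1 = -inner 𝕜 η (q.2 i)
    rw [hη, hη']
    calc _ = ∫ x in Ω, pd i ψ x • φ x :=
          integral_congr_ae (hq1.mono fun x hx => by simp only [hx])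
      _ = -∫ x in Ω, ψ x • pd i φ x := hψ.integral_pd_smul hφ i
      _ = _ := by
        congr 1
        exact integral_congr_ae ((hq2 i).mono fun x hx => by simp only [hx]; rfl)
  have := closure_minimal hsub hcl hp
  change inner 𝕜 η' p.1 = -inner 𝕜 η (p.2 i) at this
  rw [hη, hη'] at this
  calc _ = ∫ x in Ω, pd i ψ x • p.1 x :=
        integral_congr_ae (h1.mono fun x hx => by simp only [hx])
    _ = -∫ x in Ω, ψ x • p.2 i x := this
    _ = _ := by
      congr 1
      exact integral_congr_ae ((h2 i).mono fun x hx => by simp only [hx])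

theorem tendsto_eLpNorm_smul {a : Euc n → ℝ} (ha : ∃ C, ∀ x, |a x| ≤ C) {μ : Measure (Euc n)}
    {φ : ℕ → Euc n → 𝕜} {u : Euc n → 𝕜}
    (h : Tendsto (fun k => eLpNorm (φ k - u) 2 μ) atTop (𝓝 0)) :
    Tendsto (fun k => eLpNorm ((fun x => a x • φ k x) - fun x => a x • u x) 2 μ) atTop (𝓝 0) := by
  obtain ⟨C, hC⟩ := ha
  have h1 : Tendsto (fun k => ENNReal.ofReal C * eLpNorm (φ k - u) 2 μ) atTop (𝓝 0) := by
    simpa using ENNReal.Tendsto.const_mul h (Or.inr ENNReal.ofReal_ne_top)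
  refine tendsto_of_tendsto_of_tendsto_of_le_of_le tendsto_const_nhds h1
    (fun _ => zero_le) fun k => ?_
  refine eLpNorm_le_mul_eLpNorm_of_ae_le_mul (Eventually.of_forall fun x => ?_) 2
  rw [Pi.sub_apply, ← smul_sub, norm_smul]
  exact mul_le_mul_of_nonneg_right (hC x) (norm_nonneg _)

/-- Multiplication by a cutoff function maps `H¹₀(Ω)` to `H¹₀(G)` if `Ω` and `G` agree on a ball
that contains the support of the cutoff. -/
theorem ZeroTrace.localize {G : Set (Euc n)} {x₀ : Euc n} {r : ℝ}
    (hG : Ω ∩ Metric.ball x₀ r = G ∩ Metric.ball x₀ r) {ζ : Euc n → ℝ}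
    (hζ : IsTest (Metric.ball x₀ r) ζ) {u : Euc n → 𝕜} {g : Fin n → Euc n → 𝕜}
    (h : ZeroTrace Ω u g) :
    ZeroTrace G (fun x => ζ x • u x) (fun l x => ζ x • g l x + pd l ζ x • u x) := by
  have hU : MeasurableSet (Metric.ball x₀ r) := measurableSet_ball
  have hb : SmoothBdd ζ := smoothBdd_of_hasCompactSupport hζ.contDiff hζ.hasCompactSupport
  have h0 : ∀ x, x ∉ Metric.ball x₀ r → ζ x = 0 := fun x hx =>
    image_eq_zero_of_notMem_tsupport fun hx' => hx (hζ.tsupport_subset hx')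
  have h0' : ∀ l x, x ∉ Metric.ball x₀ r → pd l ζ x = 0 := fun l x hx =>
    image_eq_zero_of_notMem_tsupport fun hx' => hx ((hζ.pd l).tsupport_subset hx')
  obtain ⟨φ, hφ, h1, h2⟩ := h.exists_seq
  have hφ' : ∀ k, IsTest G (fun x => ζ x • φ k x) := by
    intro k
    refine ⟨hζ.contDiff.smul (hφ k).contDiff, HasCompactSupport.smul_left (f := ζ) (f' := φ k) (hφ k).hasCompactSupport,
      fun x hx => ?_⟩
    have h3 : x ∈ Ω ∩ Metric.ball x₀ r :=
      ⟨(hφ k).tsupport_subset (tsupport_smul_subset_right ζ (φ k) hx),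
        hζ.tsupport_subset (tsupport_smul_subset_left ζ (φ k) hx)⟩
    rw [hG] at h3
    exact h3.1
  refine ZeroTrace.of_seq (memLp_transfer hU hG (fun x hx => by simp [h0 x hx])
    (hb.memLp_smul h.memLp)) (fun l => memLp_transfer hU hG
      (fun x hx => by simp [h0 x hx, h0' l x hx])
      ((hb.memLp_smul (h.memLp_grad l)).add ((hb.pd l).memLp_smul h.memLp))) hφ' ?_ fun l => ?_
  · refine (tendsto_eLpNorm_smul hb.bdd h1).congr fun k => ?_
    rw [eLpNorm_transfer hU hG]
    intro x hx
    simp [h0 x hx]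
  · have h3 := (tendsto_eLpNorm_smul hb.bdd (h2 l)).add (tendsto_eLpNorm_smul (hb.pd l).bdd h1)
    rw [add_zero] at h3
    refine tendsto_of_tendsto_of_tendsto_of_le_of_le tendsto_const_nhds h3
      (fun _ => zero_le) fun k => ?_
    change eLpNorm _ 2 (volume.restrict G) ≤ _
    rw [eLpNorm_transfer hU hG fun x hx => by
      simp [pd_smul hζ.contDiff (hφ k).contDiff, h0 x hx, h0' l x hx]]
    refine le_trans (le_of_eq ?_) (eLpNorm_add_le ?_ ?_ (by norm_num))
    · congr 1
      funext x
      simp only [Pi.add_apply, Pi.sub_apply, pd_smul hζ.contDiff (hφ k).contDiff]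
      ring
    · exact ((hb.memLp_smul ((hφ k).pd l).memLp).sub (hb.memLp_smul (h.memLp_grad l))).1
    · exact (((hb.pd l).memLp_smul (hφ k).memLp).sub ((hb.pd l).memLp_smul h.memLp)).1

/-- The equation satisfied by the product of a cutoff function with a solution. -/
theorem WeakDiv.localize {ζ : Euc n → ℝ} (hζ : SmoothBdd ζ)
    {u f : Euc n → 𝕜} {g : Fin n → Euc n → 𝕜} (hu : ∀ l, WeakPd Ω l u (g l))
    (h : WeakDiv Ω g f) :
    WeakDiv Ω (fun l x => ζ x • g l x + pd l ζ x • u x)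
      (fun x => (ζ x • f x + ∑ l, pd l ζ x • g l x) +
        ∑ l, (pd l ζ x • g l x + pd l (pd l ζ) x • u x)) :=
  (h.smul hζ).add (WeakDiv.of_weakPd fun l => (hu l).smul (hζ.pd l))

/-! ## Weak limits in Hilbert spaces -/

section WeakLimit

variable {H : Type*} [NormedAddCommGroup H] [InnerProductSpace 𝕜 H] [CompleteSpace H]

/-- Bounded families in a closed subspace of a Hilbert space have weak limits along
ultrafilters. -/
theorem exists_weak_limit {K : Submodule 𝕜 H} (hK : IsClosed (K : Set H)) {ι : Type*}
    (U : Ultrafilter ι) {x : ι → H} (hx : ∀ i, x i ∈ K) {C : ℝ} (hC : ∀ i, ‖x i‖ ≤ C) :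
    ∃ y ∈ K, ∀ z, Tendsto (fun i => inner 𝕜 z (x i)) U (𝓝 (inner 𝕜 z y)) := by
  let f : ι → WeakDual 𝕜 H := fun i =>
    StrongDual.toWeakDual (InnerProductSpace.toDual 𝕜 H (x i))
  -- Banach–Alaoglu: the ultrafilter converges weak-* in the dual ball, and the Riesz isomorphism
  -- turns the limit into a vector.
  have hcpt := WeakDual.isCompact_closedBall (𝕜 := 𝕜) (E := H) 0 C
  obtain ⟨y', -, hy'⟩ := isCompact_iff_ultrafilter_le_nhds.1 hcpt (U.map f) (by
    rw [Ultrafilter.coe_map, le_principal_iff, mem_map]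
    refine Filter.univ_mem' fun i => ?_
    simp only [Set.mem_preimage, Metric.mem_closedBall, dist_zero_right]
    exact ((InnerProductSpace.toDual 𝕜 H).norm_map (x i)).trans_le (hC i))
  let y : H := (InnerProductSpace.toDual 𝕜 H).symm (WeakDual.toStrongDual y')
  have hlim : ∀ z, Tendsto (fun i => inner 𝕜 z (x i)) U (𝓝 (inner 𝕜 z y)) := by
    intro z
    have h1 : Tendsto (fun i => (f i) z) U (𝓝 (y' z)) :=
      ((WeakDual.eval_continuous z).tendsto y').comp hy'
    have h2 : y' z = inner 𝕜 y z := by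
      rw [InnerProductSpace.toDual_symm_apply]
      rfl
    rw [h2] at h1
    have h3 := (RCLike.continuous_conj (K := 𝕜)).tendsto _ |>.comp h1
    rw [inner_conj_symm] at h3
    refine h3.congr fun i => ?_
    exact inner_conj_symm z (x i)
  refine ⟨y, ?_, hlim⟩
  have : CompleteSpace K := hK.completeSpace_coe
  -- A closed subspace equals its double orthogonal complement, and orthogonality to a fixed vector
  -- survives weak limits.
  rw [← Submodule.orthogonal_orthogonal K, Submodule.mem_orthogonal]
  intro z hz
  refine tendsto_nhds_unique (hlim z) (tendsto_const_nhds.congr fun i => ?_)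
  exact ((Submodule.mem_orthogonal' K z).1 hz (x i) (hx i)).symm

/-- The Hilbert space norm on `H × Hⁿ`. -/
def hilbertEquiv (𝕜 : Type*) [RCLike 𝕜] (n : ℕ) (H : Type*) [NormedAddCommGroup H]
    [InnerProductSpace 𝕜 H] :
    WithLp 2 (H × PiLp 2 (fun _ : Fin n => H)) ≃L[𝕜] H × (Fin n → H) :=
  (WithLp.prodContinuousLinearEquiv 2 𝕜 H (PiLp 2 (fun _ : Fin n => H))).trans
    ((ContinuousLinearEquiv.refl 𝕜 H).prodCongr (PiLp.continuousLinearEquiv 2 𝕜 fun _ => H))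

/-- The sup norm on `H × Hⁿ` does not come from an inner product. The statement is pulled back to
the equivalent Hilbert norm, and weak convergence is recorded for the first component only. -/
theorem exists_weak_limit_prod {K : Submodule 𝕜 (H × (Fin n → H))}
    (hK : IsClosed (K : Set (H × (Fin n → H)))) {ι : Type*} (U : Ultrafilter ι)
    {x : ι → H × (Fin n → H)} (hx : ∀ i, x i ∈ K) {C : ℝ} (hC : ∀ i, ‖x i‖ ≤ C) :
    ∃ y ∈ K, ∀ z, Tendsto (fun i => inner 𝕜 z (x i).1) U (𝓝 (inner 𝕜 z y.1)) := by
  let e := hilbertEquiv 𝕜 n H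
  let K' : Submodule 𝕜 (WithLp 2 (H × PiLp 2 (fun _ : Fin n => H))) :=
    K.comap (e.toLinearEquiv : _ →ₗ[𝕜] H × (Fin n → H))
  have hK' : IsClosed (K' : Set (WithLp 2 (H × PiLp 2 (fun _ : Fin n => H)))) :=
    hK.preimage e.continuous
  obtain ⟨y, hy, hlim⟩ := exists_weak_limit hK' U (x := fun i => e.symm (x i))
    (fun i => by
      change e (e.symm (x i)) ∈ K
      rw [e.apply_symm_apply]
      exact hx i)
    (C := ‖e.symm.toContinuousLinearMap‖ * C)
    (fun i => (e.symm.toContinuousLinearMap.le_opNorm (x i)).trans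
      (mul_le_mul_of_nonneg_left (hC i) (norm_nonneg _)))
  refine ⟨e y, hy, fun z => ?_⟩
  have h := hlim (WithLp.toLp 2 (z, 0))
  simp only [WithLp.prod_inner_apply] at h
  convert! h using 2
  · simp [e, hilbertEquiv]
  · simp [e, hilbertEquiv]

end WeakLimit

/-! ## Multiplication operators -/

theorem exists_mulOp {μ : Measure (Euc n)} {a : Euc n → ℝ} (ha : Continuous a) {C : ℝ}
    (hC : ∀ x, |a x| ≤ C) : ∃ M : Lp 𝕜 2 μ →L[𝕜] Lp 𝕜 2 μ,
      (∀ u : Lp 𝕜 2 μ, M u =ᵐ[μ] fun x => a x • u x) ∧ ∀ u, ‖M u‖ ≤ C * ‖u‖ := by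
  have hm : ∀ u : Lp 𝕜 2 μ, MemLp (fun x => a x • u x) 2 μ := fun u =>
    MemLp.of_le_mul (c := C) (Lp.memLp u)
      (ha.aestronglyMeasurable.smul (Lp.memLp u).1) (Eventually.of_forall fun x => by
        rw [norm_smul]
        exact mul_le_mul_of_nonneg_right (hC x) (norm_nonneg _))
  let L : Lp 𝕜 2 μ →ₗ[𝕜] Lp 𝕜 2 μ :=
    { toFun := fun u => (hm u).toLp _
      map_add' := fun u v => by
        apply Lp.ext
        filter_upwards [(hm (u + v)).coeFn_toLp, (hm u).coeFn_toLp, (hm v).coeFn_toLp,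
          Lp.coeFn_add u v, Lp.coeFn_add ((hm u).toLp _) ((hm v).toLp _)] with x h1 h2 h3 h4 h5
        rw [h5, Pi.add_apply, h1, h2, h3, h4, Pi.add_apply, smul_add]
      map_smul' := fun c u => by
        apply Lp.ext
        filter_upwards [(hm (c • u)).coeFn_toLp, (hm u).coeFn_toLp,
          Lp.coeFn_smul c u, Lp.coeFn_smul c ((hm u).toLp _)] with x h1 h2 h3 h4
        rw [RingHom.id_apply, h4, Pi.smul_apply, h1, h2, h3, Pi.smul_apply, smul_comm] }
  have hL : ∀ u, ‖L u‖ ≤ C * ‖u‖ := fun u => by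
    refine Lp.norm_le_mul_norm_of_ae_le_mul ?_
    filter_upwards [(hm u).coeFn_toLp] with x hx
    change ‖(hm u).toLp _ x‖ ≤ _
    rw [hx, norm_smul]
    exact mul_le_mul_of_nonneg_right (hC x) (norm_nonneg _)
  exact ⟨L.mkContinuous C hL, fun u => (hm u).coeFn_toLp, hL⟩

/-! ## Testing with functions of vanishing trace -/

/-- Weak divergences are tested with real functions. Splitting `conj φ = Re φ - i Im φ` reduces
pairings with a scalar-valued test function to that case. -/
theorem inner_toLp_eq {φ : Euc n → 𝕜} (hφ : IsTest Ω φ) {u : L2 𝕜 Ω}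
    (hu : u =ᵐ[volume.restrict Ω] φ) (F : L2 𝕜 Ω) :
    inner 𝕜 u F = (∫ x in Ω, RCLike.re (φ x) • F x) -
      RCLike.I * ∫ x in Ω, RCLike.im (φ x) • F x := by
  have hr : MemLp (fun x => RCLike.re (φ x)) 2 (volume.restrict Ω) := hφ.memLp.re
  have hi : MemLp (fun x => RCLike.im (φ x)) 2 (volume.restrict Ω) := hφ.memLp.im
  have ir : Integrable (fun x => RCLike.re (φ x) • F x) (volume.restrict Ω) :=
    memLp_one_iff_integrable.1 ((Lp.memLp F).smul hr)
  have ii : Integrable (fun x => RCLike.im (φ x) • F x) (volume.restrict Ω) :=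
    memLp_one_iff_integrable.1 ((Lp.memLp F).smul hi)
  rw [L2.inner_def, ← integral_const_mul, ← integral_sub ir (ii.const_mul _)]
  refine integral_congr_ae (hu.mono fun x hx => ?_)
  simp only [hx]
  rw [RCLike.inner_apply, RCLike.conj_eq_re_sub_im, RCLike.real_smul_eq_coe_mul,
    RCLike.real_smul_eq_coe_mul]
  ring

theorem IsTest.re {φ : Euc n → 𝕜} (hφ : IsTest Ω φ) : IsTest Ω (fun x => RCLike.re (φ x)) :=
  ⟨(RCLike.reCLM (K := 𝕜)).contDiff.comp hφ.contDiff,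
    hφ.hasCompactSupport.comp_left (g := fun z : 𝕜 => RCLike.re z) (by simp),
    (tsupport_comp_subset (g := fun z : 𝕜 => RCLike.re z) (by simp) φ).trans hφ.tsupport_subset⟩

theorem IsTest.im {φ : Euc n → 𝕜} (hφ : IsTest Ω φ) : IsTest Ω (fun x => RCLike.im (φ x)) :=
  ⟨(RCLike.imCLM (K := 𝕜)).contDiff.comp hφ.contDiff,
    hφ.hasCompactSupport.comp_left (g := fun z : 𝕜 => RCLike.im z) (by simp),
    (tsupport_comp_subset (g := fun z : 𝕜 => RCLike.im z) (by simp) φ).trans hφ.tsupport_subset⟩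

theorem pd_clm_comp {F F' : Type*} [NormedAddCommGroup F] [NormedSpace ℝ F]
    [NormedAddCommGroup F'] [NormedSpace ℝ F'] (L : F →L[ℝ] F') {φ : Euc n → F}
    (hφ : ContDiff ℝ ∞ φ) (i : Fin n) (x : Euc n) :
    Plate.pd i (fun y => L (φ y)) x = L (Plate.pd i φ x) := by
  have h := (L.hasFDerivAt.comp x (hφ.differentiable (by simp) x).hasFDerivAt).fderiv
  exact congrArg (fun A : Euc n →L[ℝ] F' => A (EuclideanSpace.single i (1 : ℝ))) h

/-- The weak divergence may be tested with functions of vanishing trace. -/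
theorem WeakDiv.inner_eq {g : Fin n → L2 𝕜 Ω} {F : L2 𝕜 Ω} (h : WeakDiv Ω (fun l => g l) F)
    {q : L2 𝕜 Ω × (Fin n → L2 𝕜 Ω)} (hq : q ∈ (testGraph 𝕜 Ω).topologicalClosure) :
    ∑ l, inner 𝕜 (q.2 l) (g l) = -inner 𝕜 q.1 F := by
  have hcl : IsClosed {q : L2 𝕜 Ω × (Fin n → L2 𝕜 Ω) |
      ∑ l, inner 𝕜 (q.2 l) (g l) = -inner 𝕜 q.1 F} :=
    isClosed_eq (continuous_finsetSum _ fun l _ =>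
      ((continuous_apply l).comp continuous_snd).inner continuous_const)
      (continuous_fst.inner continuous_const).neg
  refine closure_minimal ?_ hcl hq
  rintro q ⟨φ, hφ, h1, h2⟩
  change ∑ l, inner 𝕜 (q.2 l) (g l) = -inner 𝕜 q.1 F
  have e1 : ∀ l, inner 𝕜 (q.2 l) (g l) =
      (∫ x in Ω, pd l (fun y => RCLike.re (φ y)) x • g l x) -
      RCLike.I * ∫ x in Ω, pd l (fun y => RCLike.im (φ y)) x • g l x := by
    intro l
    rw [inner_toLp_eq (hφ.pd l) (h2 l)]
    have er := fun x => pd_clm_comp (RCLike.reCLM (K := 𝕜)) hφ.contDiff l x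
    have ei := fun x => pd_clm_comp (RCLike.imCLM (K := 𝕜)) hφ.contDiff l x
    simp only [RCLike.reCLM_apply, RCLike.imCLM_apply] at er ei
    simp only [er, ei]
  rw [Finset.sum_congr rfl fun l _ => e1 l, Finset.sum_sub_distrib, ← Finset.mul_sum,
    h.integral_eq _ hφ.re, h.integral_eq _ hφ.im, inner_toLp_eq hφ h1]
  ring

/-! ## Minkowski's integral inequality -/

/-- For the exponent two this needs only Cauchy–Schwarz in `s` for each fixed `x`, then Tonelli to
interchange the integrals of `‖Ψ s x‖²`. -/
theorem eLpNorm_intervalIntegral_le {μ : Measure (Euc n)} [SFinite μ] {Ψ : ℝ → Euc n → 𝕜}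
    (hΨ : Continuous (Function.uncurry Ψ)) {h : ℝ} {C : ENNReal}
    (hC : ∀ s ∈ Set.uIoc 0 h, eLpNorm (Ψ s) 2 μ ≤ C) :
    eLpNorm (fun x => ∫ s in (0 : ℝ)..h, Ψ s x) 2 μ ≤ ENNReal.ofReal |h| * C := by
  have sq : ∀ f : Euc n → 𝕜, eLpNorm f 2 μ ^ 2 = ∫⁻ x, ‖f x‖ₑ ^ 2 ∂μ := by
    intro f
    rw [eLpNorm_eq_lintegral_rpow_enorm_toReal (by norm_num) (by norm_num), ← ENNReal.rpow_natCast,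
      ← ENNReal.rpow_mul]
    norm_num
  set ν := (volume : Measure ℝ).restrict (Set.uIoc 0 h) with hν
  have hνu : ν Set.univ = ENNReal.ofReal |h| := by
    rw [hν, Measure.restrict_apply_univ, Set.uIoc, Real.volume_Ioc, max_sub_min_eq_abs, sub_zero]
  have hmeas : Measurable (fun p : ℝ × Euc n => ‖Ψ p.1 p.2‖ₑ) := hΨ.measurable.enorm
  have key : ∀ x, ‖∫ s in (0 : ℝ)..h, Ψ s x‖ₑ ^ 2 ≤ ENNReal.ofReal |h| * ∫⁻ s, ‖Ψ s x‖ₑ ^ 2 ∂ν := by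
    intro x
    have h1 : ‖∫ s in (0 : ℝ)..h, Ψ s x‖ₑ ≤ ∫⁻ s, ‖Ψ s x‖ₑ ∂ν := by
      have e : ‖∫ s in (0 : ℝ)..h, Ψ s x‖ₑ = ‖∫ s, Ψ s x ∂ν‖ₑ := by
        rw [← ofReal_norm, ← ofReal_norm, intervalIntegral.norm_intervalIntegral_eq]
      rw [e]
      exact enorm_integral_le_lintegral_enorm _
    have hm : AEMeasurable (fun s => ‖Ψ s x‖ₑ) ν :=
      (hmeas.comp (measurable_id.prodMk measurable_const)).aemeasurable
    have h2 := ENNReal.lintegral_mul_le_Lp_mul_Lq ν Real.HolderConjugate.two_two hm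
      (aemeasurable_const (b := (1 : ENNReal)))
    simp only [Pi.mul_apply, mul_one, ENNReal.one_rpow, lintegral_const, one_mul, hνu] at h2
    calc _ ≤ ((∫⁻ s, ‖Ψ s x‖ₑ ^ (2 : ℝ) ∂ν) ^ (1 / (2 : ℝ)) *
          ENNReal.ofReal |h| ^ (1 / (2 : ℝ))) ^ 2 := by
            gcongr
            exact h1.trans h2
      _ = _ := by
        rw [mul_pow, ← ENNReal.rpow_natCast, ← ENNReal.rpow_mul, ← ENNReal.rpow_natCast,
          ← ENNReal.rpow_mul, mul_comm]
        norm_num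
  have main : eLpNorm (fun x => ∫ s in (0 : ℝ)..h, Ψ s x) 2 μ ^ 2 ≤ (ENNReal.ofReal |h| * C) ^ 2 := by
    rw [sq]
    calc _ ≤ ∫⁻ x, ENNReal.ofReal |h| * ∫⁻ s, ‖Ψ s x‖ₑ ^ 2 ∂ν ∂μ := lintegral_mono key
      _ = ENNReal.ofReal |h| * ∫⁻ x, ∫⁻ s, ‖Ψ s x‖ₑ ^ 2 ∂ν ∂μ :=
        lintegral_const_mul' _ _ ENNReal.ofReal_ne_top
      _ = ENNReal.ofReal |h| * ∫⁻ s, ∫⁻ x, ‖Ψ s x‖ₑ ^ 2 ∂μ ∂ν := by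
        rw [lintegral_lintegral_swap]
        exact ((hmeas.comp measurable_swap).pow_const 2).aemeasurable
      _ ≤ ENNReal.ofReal |h| * ∫⁻ _, C ^ 2 ∂ν := by
        refine mul_le_mul_right ?_ _
        refine setLIntegral_mono measurable_const fun s hs => ?_
        rw [← sq]
        gcongr
        exact hC s hs
      _ = _ := by
        rw [lintegral_const, hνu]
        ring
  exact (ENNReal.pow_le_pow_left_iff (by norm_num)).1 main

/-! ## The shear flow along a graph -/

/-- The flow `x ↦ x + h e_i + (γ (x_i + h) - γ (x_i)) e_j`, which preserves the sets
`{x_j - γ (x_i) < 0}`. -/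
def shear (γ : ℝ → ℝ) (i j : Fin n) (h : ℝ) (x : Euc n) : Euc n :=
  x + (h • EuclideanSpace.single i (1 : ℝ) +
    (γ (x i + h) - γ (x i)) • EuclideanSpace.single j (1 : ℝ))

/-- The derivative `∂_i φ + γ' (x_i) ∂_j φ` along the shear flow. -/
def tang (γ : ℝ → ℝ) (i j : Fin n) (φ : Euc n → 𝕜) (x : Euc n) : 𝕜 :=
  pd i φ x + deriv γ (x i) • pd j φ x

/-! ### The shear flow: group law, invariance of measure, first and second order differences. -/

section Shear

variable {γ : ℝ → ℝ} {i j : Fin n}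

theorem shear_apply_self (hij : i ≠ j) (h : ℝ) (x : Euc n) : shear γ i j h x i = x i + h := by
  simp [shear, hij]

theorem shear_zero (x : Euc n) : shear γ i j 0 x = x := by
  simp [shear]

/-- Since `i ≠ j`, the coordinate `x_i` is only translated, so the increments of `γ` telescope and
the shears form a one-parameter group. -/
theorem shear_shear (hij : i ≠ j) (s h : ℝ) (x : Euc n) :
    shear γ i j s (shear γ i j h x) = shear γ i j (h + s) x := by
  have e := shear_apply_self (γ := γ) hij h x
  conv_lhs => rw [shear, e]
  simp only [shear, ← add_assoc]
  module

theorem shear_neg_shear (hij : i ≠ j) (h : ℝ) (x : Euc n) :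
    shear γ i j (-h) (shear γ i j h x) = x := by
  rw [shear_shear hij, add_neg_cancel, shear_zero]

theorem shear_shear_neg (hij : i ≠ j) (h : ℝ) (x : Euc n) :
    shear γ i j h (shear γ i j (-h) x) = x := by
  rw [shear_shear hij, neg_add_cancel, shear_zero]

theorem contDiff_shear (hγ : ContDiff ℝ ∞ γ) :
    ContDiff ℝ ∞ (fun p : ℝ × Euc n => shear γ i j p.1 p.2) := by
  have hc : ContDiff ℝ ∞ (fun p : ℝ × Euc n => p.2 i) :=
    (EuclideanSpace.proj i : Euc n →L[ℝ] ℝ).contDiff.comp contDiff_snd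
  exact contDiff_snd.add ((contDiff_fst.smul contDiff_const).add
    (((hγ.comp (hc.add contDiff_fst)).sub (hγ.comp hc)).smul contDiff_const))

theorem contDiff_shear_right (hγ : ContDiff ℝ ∞ γ) (h : ℝ) : ContDiff ℝ ∞ (shear γ i j h) :=
  (contDiff_shear hγ).comp (contDiff_const.prodMk contDiff_id)

theorem hasFDerivAt_shear (hγ : ContDiff ℝ ∞ γ) (h : ℝ) (x : Euc n) :
    HasFDerivAt (shear γ i j h) (ContinuousLinearMap.id ℝ (Euc n) +
      ((deriv γ (x i + h) - deriv γ (x i)) • (EuclideanSpace.proj i : Euc n →L[ℝ] ℝ)).smulRight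
        (EuclideanSpace.single j (1 : ℝ))) x := by
  have hd : Differentiable ℝ γ := hγ.differentiable (by simp)
  have hp : HasFDerivAt (fun y : Euc n => y i) (EuclideanSpace.proj i : Euc n →L[ℝ] ℝ) x :=
    (EuclideanSpace.proj i : Euc n →L[ℝ] ℝ).hasFDerivAt
  have h1 := (hd (x i + h)).hasDerivAt.comp_hasFDerivAt x (hp.add_const h)
  have h2 := (hd (x i)).hasDerivAt.comp_hasFDerivAt x hp
  have h3 := (hasFDerivAt_id x).add
    (((h1.sub h2).smul_const (EuclideanSpace.single j (1 : ℝ))).const_add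
      (h • EuclideanSpace.single i (1 : ℝ)))
  rw [← sub_smul] at h3
  exact h3

/-- The derivative is the identity plus a multiple of `e_j ⊗ dx_i` with `i ≠ j`: a transvection, of
determinant one. The preimage of a set is its image under the inverse flow, so the change of
variables formula applies. -/
theorem measurePreserving_shear (hij : i ≠ j) (hγ : ContDiff ℝ ∞ γ) (h : ℝ) :
    MeasurePreserving (shear γ i j h : Euc n → Euc n) volume volume := by
  have hcont : ∀ h, Continuous (shear γ i j h : Euc n → Euc n) := fun h =>
    (contDiff_shear_right hγ h).continuous
  refine ⟨(hcont h).measurable, Measure.ext fun s hs => ?_⟩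
  rw [Measure.map_apply (hcont h).measurable hs]
  have himg : shear γ i j h ⁻¹' s = shear γ i j (-h) '' s := by
    ext x
    constructor
    · intro hx
      exact ⟨_, hx, shear_neg_shear hij h x⟩
    · rintro ⟨y, hy, rfl⟩
      rw [Set.mem_preimage, shear_shear_neg hij]
      exact hy
  rw [himg, ← lintegral_abs_det_fderiv_eq_addHaar_image volume hs
    (fun x _ => (hasFDerivAt_shear hγ (-h) x).hasFDerivWithinAt)
    (Function.LeftInverse.injective (shear_shear_neg hij h)).injOn]
  have hdet : ∀ c : ℝ, (ContinuousLinearMap.id ℝ (Euc n) +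
      (c • (EuclideanSpace.proj i : Euc n →L[ℝ] ℝ)).smulRight
        (EuclideanSpace.single j (1 : ℝ))).det = 1 := by
    intro c
    have e : ((ContinuousLinearMap.id ℝ (Euc n) +
      (c • (EuclideanSpace.proj i : Euc n →L[ℝ] ℝ)).smulRight
        (EuclideanSpace.single j (1 : ℝ)) : Euc n →L[ℝ] Euc n) : Euc n →ₗ[ℝ] Euc n) =
      LinearMap.transvection ((c • (EuclideanSpace.proj i : Euc n →L[ℝ] ℝ) : Euc n →L[ℝ] ℝ) :
        Euc n →ₗ[ℝ] ℝ) (EuclideanSpace.single j (1 : ℝ)) := by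
      ext x
      simp [LinearMap.transvection]
    rw [ContinuousLinearMap.det, e, LinearMap.transvection.det]
    simp [hij]
  simp [hdet]

theorem pd_comp_shear (hγ : ContDiff ℝ ∞ γ) (h : ℝ) {φ : Euc n → 𝕜} (hφ : ContDiff ℝ ∞ φ)
    (l : Fin n) (x : Euc n) :
    pd l (fun y => φ (shear γ i j h y)) x = pd l φ (shear γ i j h x) +
      if l = i then (deriv γ (x i + h) - deriv γ (x i)) • pd j φ (shear γ i j h x) else 0 := by
  have h1 := ((hφ.differentiable (by simp) (shear γ i j h x)).hasFDerivAt.comp x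
    (hasFDerivAt_shear hγ h x)).fderiv
  have h2 : pd l (fun y => φ (shear γ i j h y)) x = _ :=
    congrArg (fun A : Euc n →L[ℝ] 𝕜 => A (EuclideanSpace.single l (1 : ℝ))) h1
  rw [h2]
  by_cases hl : l = i
  · simp [pd, hl]
  · simp [pd, hl, Ne.symm hl]

theorem hasDerivAt_comp_shear (hij : i ≠ j) (hγ : ContDiff ℝ ∞ γ) {φ : Euc n → 𝕜}
    (hφ : ContDiff ℝ ∞ φ) (x : Euc n) (s : ℝ) :
    HasDerivAt (fun s => φ (shear γ i j s x)) (tang γ i j φ (shear γ i j s x)) s := by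
  have hd : Differentiable ℝ γ := hγ.differentiable (by simp)
  have h1 : HasDerivAt (fun s => shear γ i j s x) ((1 : ℝ) • EuclideanSpace.single i (1 : ℝ) +
      deriv γ (x i + s) • EuclideanSpace.single j (1 : ℝ)) s := by
    have h2 : HasDerivAt (fun s => γ (x i + s)) (deriv γ (x i + s)) s := by
      simpa using (hd (x i + s)).hasDerivAt.comp_const_add (x i) s
    exact (((hasDerivAt_id s).smul_const _).add ((h2.sub_const _).smul_const _)).const_add x
  have h3 := (hφ.differentiable (by simp) (shear γ i j s x)).hasFDerivAt.comp_hasDerivAt s h1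
  convert! h3 using 1
  rw [tang, shear_apply_self hij]
  simp [pd]

theorem contDiff_deriv_comp_coord (hγ : ContDiff ℝ ∞ γ) :
    ContDiff ℝ ∞ (fun x : Euc n => deriv γ (x i)) :=
  ((contDiff_succ_iff_deriv (n := ∞)).1 (by simpa using hγ)).2.2.comp
    (EuclideanSpace.proj i : Euc n →L[ℝ] ℝ).contDiff

theorem IsTest.tang (hγ : ContDiff ℝ ∞ γ) {φ : Euc n → 𝕜} (hφ : IsTest Ω φ) :
    IsTest Ω (tang γ i j φ) := by
  have h2 := (hφ.pd j).smul_left (contDiff_deriv_comp_coord (i := i) hγ)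
  exact ⟨(hφ.pd i).contDiff.add h2.contDiff, (hφ.pd i).hasCompactSupport.add h2.hasCompactSupport,
    (tsupport_add _ _).trans (Set.union_subset (hφ.pd i).tsupport_subset h2.tsupport_subset)⟩

theorem IsTest.comp_shear (hij : i ≠ j) (hγ : ContDiff ℝ ∞ γ)
    (hΩ : ∀ h, ∀ x ∈ Ω, shear γ i j h x ∈ Ω) {φ : Euc n → 𝕜} (hφ : IsTest Ω φ) (h : ℝ) :
    IsTest Ω (fun x => φ (shear γ i j h x)) := by
  have hcont : ∀ h, Continuous (shear γ i j h : Euc n → Euc n) := fun h =>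
    (contDiff_shear_right hγ h).continuous
  have hsub : tsupport (fun x => φ (shear γ i j h x)) ⊆ shear γ i j h ⁻¹' tsupport φ :=
    closure_minimal (fun x hx => subset_tsupport φ hx)
      ((isClosed_tsupport φ).preimage (hcont h))
  refine ⟨hφ.contDiff.comp (contDiff_shear_right hγ h), ?_, fun x hx => ?_⟩
  · refine (hφ.hasCompactSupport.isCompact.image (hcont (-h))).of_isClosed_subset
      (isClosed_tsupport _) fun x hx => ⟨_, hsub hx, shear_neg_shear hij h x⟩
  · rw [← shear_neg_shear (γ := γ) hij h x]
    exact hΩ _ _ (hφ.tsupport_subset (hsub hx))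

theorem measurePreserving_shear_restrict (hij : i ≠ j) (hγ : ContDiff ℝ ∞ γ) (hm : IsOpen Ω)
    (hΩ : ∀ h, ∀ x ∈ Ω, shear γ i j h x ∈ Ω) (h : ℝ) :
    MeasurePreserving (shear γ i j h) (volume.restrict Ω) (volume.restrict Ω) := by
  have e : shear γ i j h ⁻¹' Ω = Ω := by
    ext x
    refine ⟨fun hx => ?_, hΩ h x⟩
    rw [← shear_neg_shear (γ := γ) hij h x]
    exact hΩ _ _ hx
  have := (measurePreserving_shear hij hγ h).restrict_preimage hm.measurableSet
  rwa [e] at this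

/-- The difference is the integral of the tangential derivative along the flow. Minkowski's
inequality bounds its norm, and each integrand has the norm of `tang γ i j φ` because the flow
preserves the measure. -/
theorem eLpNorm_shear_sub_le (hij : i ≠ j) (hγ : ContDiff ℝ ∞ γ) (hm : IsOpen Ω)
    (hΩ : ∀ h, ∀ x ∈ Ω, shear γ i j h x ∈ Ω) {φ : Euc n → 𝕜} (hφ : IsTest Ω φ) (h : ℝ) :
    eLpNorm (fun x => φ (shear γ i j h x) - φ x) 2 (volume.restrict Ω) ≤
      ENNReal.ofReal |h| * eLpNorm (tang γ i j φ) 2 (volume.restrict Ω) := by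
  have ht := hφ.tang (i := i) (j := j) hγ
  have hcs : ∀ x, Continuous fun s => tang γ i j φ (shear γ i j s x) := fun x =>
    ht.contDiff.continuous.comp
      ((contDiff_shear hγ).continuous.comp (continuous_id.prodMk continuous_const))
  have e : (fun x => φ (shear γ i j h x) - φ x) =
      fun x => ∫ s in (0 : ℝ)..h, tang γ i j φ (shear γ i j s x) := by
    funext x
    rw [intervalIntegral.integral_eq_sub_of_hasDerivAt
      (fun s _ => hasDerivAt_comp_shear hij hγ hφ.contDiff x s)
      ((hcs x).intervalIntegrable _ _), shear_zero]
  rw [e]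
  refine eLpNorm_intervalIntegral_le (Ψ := fun s x => tang γ i j φ (shear γ i j s x))
    (C := eLpNorm (tang γ i j φ) 2 (volume.restrict Ω))
    (ht.contDiff.continuous.comp (contDiff_shear hγ).continuous) fun s _ => ?_
  have h1 := eLpNorm_comp_measurePreserving (p := 2) (g := tang γ i j φ) ht.memLp.1
    (measurePreserving_shear_restrict hij hγ hm hΩ s)
  exact h1.le

/-- Second order Taylor estimate: the remainder is an integral of differences of `tang γ i j φ`
along the flow, to which the first order bound applies. -/
theorem eLpNorm_shear_sub_sub_le (hij : i ≠ j) (hγ : ContDiff ℝ ∞ γ) (hm : IsOpen Ω)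
    (hΩ : ∀ h, ∀ x ∈ Ω, shear γ i j h x ∈ Ω) {φ : Euc n → 𝕜} (hφ : IsTest Ω φ) (h : ℝ) :
    eLpNorm (fun x => φ (shear γ i j h x) - φ x - h • tang γ i j φ x) 2 (volume.restrict Ω) ≤
      ENNReal.ofReal |h| * (ENNReal.ofReal |h| *
        eLpNorm (tang γ i j (tang γ i j φ)) 2 (volume.restrict Ω)) := by
  have ht := hφ.tang (i := i) (j := j) hγ
  have hcs : ∀ x, Continuous fun s => tang γ i j φ (shear γ i j s x) := fun x =>
    ht.contDiff.continuous.comp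
      ((contDiff_shear hγ).continuous.comp (continuous_id.prodMk continuous_const))
  have e : (fun x => φ (shear γ i j h x) - φ x - h • tang γ i j φ x) =
      fun x => ∫ s in (0 : ℝ)..h, (tang γ i j φ (shear γ i j s x) - tang γ i j φ x) := by
    funext x
    rw [intervalIntegral.integral_sub
      ((hcs x).intervalIntegrable _ _)
      intervalIntegrable_const, intervalIntegral.integral_eq_sub_of_hasDerivAt
      (fun s _ => hasDerivAt_comp_shear hij hγ hφ.contDiff x s)
      ((hcs x).intervalIntegrable _ _), shear_zero,
      intervalIntegral.integral_const, sub_zero]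
  rw [e]
  refine eLpNorm_intervalIntegral_le (Ψ := fun s x => tang γ i j φ (shear γ i j s x) -
      tang γ i j φ x) ((ht.contDiff.continuous.comp (contDiff_shear hγ).continuous).sub
      (ht.contDiff.continuous.comp continuous_snd)) fun s hs => ?_
  refine (eLpNorm_shear_sub_le hij hγ hm hΩ ht s).trans ?_
  gcongr ENNReal.ofReal ?_ * _
  have := Set.abs_sub_left_of_mem_uIcc (Set.uIoc_subset_uIcc hs)
  simpa using this

end Shear

/-! ## Tangential derivatives have vanishing trace -/

/-- `G` is an open set that is invariant under the shear flow given by `γ`, `i`, `j`. -/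
structure ShearDomain (γ : ℝ → ℝ) (i j : Fin n) (G : Set (Euc n)) : Prop where
  ne : i ≠ j
  contDiff : ContDiff ℝ ∞ γ
  hasCompactSupport : HasCompactSupport γ
  isOpen : IsOpen G
  mem : ∀ h, ∀ x ∈ G, shear γ i j h x ∈ G

namespace ShearDomain

variable {γ : ℝ → ℝ} {i j : Fin n} {G : Set (Euc n)}

theorem contDiff_deriv (S : ShearDomain γ i j G) : ContDiff ℝ ∞ (deriv γ) :=
  ((contDiff_succ_iff_deriv (n := ∞)).1 (by simpa using S.contDiff)).2.2

theorem exists_deriv_bound (S : ShearDomain γ i j G) : ∃ C, ∀ s, |deriv γ s| ≤ C :=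
  S.hasCompactSupport.deriv.exists_bound_of_continuous S.contDiff_deriv.continuous

theorem exists_deriv_lipschitz (S : ShearDomain γ i j G) :
    ∃ C, 0 ≤ C ∧ ∀ s h, |deriv γ (s + h) - deriv γ s| ≤ C * |h| := by
  obtain ⟨C, hC⟩ := S.contDiff_deriv.lipschitzWith_of_hasCompactSupport S.hasCompactSupport.deriv
    (by simp)
  refine ⟨C, C.2, fun s h => ?_⟩
  have := hC.dist_le_mul (s + h) s
  rwa [Real.dist_eq, Real.dist_eq, add_sub_cancel_left] at this

theorem measurePreserving (S : ShearDomain γ i j G) (h : ℝ) :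
    MeasurePreserving (shear γ i j h) (volume.restrict G) (volume.restrict G) :=
  measurePreserving_shear_restrict S.ne S.contDiff S.isOpen S.mem h

/-- Composition with the shear flow. -/
def op (S : ShearDomain γ i j G) (h : ℝ) : L2 𝕜 G →ₗᵢ[𝕜] L2 𝕜 G :=
  Lp.compMeasurePreservingₗᵢ 𝕜 _ (S.measurePreserving h)

theorem coeFn_op (S : ShearDomain γ i j G) (h : ℝ) (u : L2 𝕜 G) :
    S.op h u =ᵐ[volume.restrict G] fun x => u (shear γ i j h x) :=
  Lp.coeFn_compMeasurePreserving u (S.measurePreserving h)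

theorem op_congr (S : ShearDomain γ i j G) (h : ℝ) {u : L2 𝕜 G} {φ : Euc n → 𝕜}
    (hu : u =ᵐ[volume.restrict G] φ) :
    S.op h u =ᵐ[volume.restrict G] fun x => φ (shear γ i j h x) :=
  (S.coeFn_op h u).trans ((S.measurePreserving h).quasiMeasurePreserving.ae_eq_comp hu)

theorem op_op_neg (S : ShearDomain γ i j G) (h : ℝ) (u : L2 𝕜 G) : S.op h (S.op (-h) u) = u := by
  apply Lp.ext
  refine (S.op_congr h (S.coeFn_op (-h) u)).trans (Eventually.of_forall fun x => ?_)
  simp only [shear_neg_shear S.ne]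

theorem inner_op_left (S : ShearDomain γ i j G) (h : ℝ) (u v : L2 𝕜 G) :
    inner 𝕜 (S.op h u) v = inner 𝕜 u (S.op (-h) v) := by
  rw [← (S.op h).inner_map_map u, S.op_op_neg]

theorem inner_op_right (S : ShearDomain γ i j G) (h : ℝ) (u v : L2 𝕜 G) :
    inner 𝕜 u (S.op h v) = inner 𝕜 (S.op (-h) u) v := by
  rw [S.inner_op_left, neg_neg]

/-- Composition with the flow keeps test functions in `G` and changes their gradients by the chain
rule, whose only extra term is in direction `i`. The formula is continuous in the pair `(u, ∇u)`,
hence extends to `H¹₀(G)`. -/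
theorem shift_mem (S : ShearDomain γ i j G) (h : ℝ) {M : L2 𝕜 G →L[𝕜] L2 𝕜 G}
    (hM : ∀ u, M u =ᵐ[volume.restrict G]
      fun x => (deriv γ (x i + h) - deriv γ (x i)) • u x)
    {q : L2 𝕜 G × (Fin n → L2 𝕜 G)} (hq : q ∈ (testGraph 𝕜 G).topologicalClosure) :
    ((S.op h q.1, fun l => S.op h (q.2 l) + if l = i then M (S.op h (q.2 j)) else 0) :
      L2 𝕜 G × (Fin n → L2 𝕜 G)) ∈ (testGraph 𝕜 G).topologicalClosure := by
  let f : L2 𝕜 G × (Fin n → L2 𝕜 G) → L2 𝕜 G × (Fin n → L2 𝕜 G) := fun q =>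
    (S.op h q.1, fun l => S.op h (q.2 l) + if l = i then M (S.op h (q.2 j)) else 0)
  have hc : Continuous f := by
    have hA := (S.op (𝕜 := 𝕜) h).continuous
    have h2 : ∀ l, Continuous fun q : L2 𝕜 G × (Fin n → L2 𝕜 G) => q.2 l := fun l =>
      (continuous_apply l).comp continuous_snd
    refine (hA.comp continuous_fst).prodMk (continuous_pi fun l => ?_)
    by_cases hl : l = i
    · simp only [hl, if_true]
      exact (hA.comp (h2 i)).add (M.continuous.comp (hA.comp (h2 j)))
    · simp only [hl, if_false, add_zero]
      exact hA.comp (h2 l)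
  refine map_mem_closure (f := f) hc hq ?_
  rintro q ⟨φ, hφ, h1, h2⟩
  refine ⟨_, hφ.comp_shear S.ne S.contDiff S.mem h, S.op_congr h h1, fun l => ?_⟩
  have e : ∀ x, fderiv ℝ (fun y => φ (shear γ i j h y)) x (EuclideanSpace.single l (1 : ℝ)) = _ :=
    fun x => pd_comp_shear S.contDiff h hφ.contDiff l x
  simp only [e, f]
  by_cases hl : l = i
  · simp only [hl, if_true]
    filter_upwards [Lp.coeFn_add (S.op h (q.2 i)) (M (S.op h (q.2 j))), hM (S.op h (q.2 j)),
      S.op_congr h (h2 i), S.op_congr h (h2 j)] with x e1 e2 e3 e4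
    rw [e1, Pi.add_apply, e2, e3, e4]
    rfl
  · simp only [hl, if_false, add_zero]
    exact S.op_congr h (h2 l)

theorem norm_op_sub_le (S : ShearDomain γ i j G) (h : ℝ) {M : L2 𝕜 G →L[𝕜] L2 𝕜 G}
    (hM : ∀ u, M u =ᵐ[volume.restrict G] fun x => deriv γ (x i) • u x)
    {q : L2 𝕜 G × (Fin n → L2 𝕜 G)} (hq : q ∈ (testGraph 𝕜 G).topologicalClosure) :
    ‖S.op h q.1 - q.1‖ ≤ |h| * ‖q.2 i + M (q.2 j)‖ := by
  have h2 : ∀ l, Continuous fun q : L2 𝕜 G × (Fin n → L2 𝕜 G) => q.2 l := fun l =>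
    (continuous_apply l).comp continuous_snd
  have hcl : IsClosed {q : L2 𝕜 G × (Fin n → L2 𝕜 G) |
      ‖S.op h q.1 - q.1‖ ≤ |h| * ‖q.2 i + M (q.2 j)‖} :=
    isClosed_le (((S.op h).continuous.comp continuous_fst).sub continuous_fst).norm
      (continuous_const.mul ((h2 i).add (M.continuous.comp (h2 j))).norm)
  refine closure_minimal ?_ hcl hq
  rintro q ⟨φ, hφ, h1, h2⟩
  change ‖S.op h q.1 - q.1‖ ≤ |h| * ‖q.2 i + M (q.2 j)‖
  have e1 : S.op h q.1 - q.1 =ᵐ[volume.restrict G] fun x => φ (shear γ i j h x) - φ x := by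
    filter_upwards [Lp.coeFn_sub (S.op h q.1) q.1, S.op_congr h h1, h1] with x a b c
    rw [a, Pi.sub_apply, b, c]
  have e2 : q.2 i + M (q.2 j) =ᵐ[volume.restrict G] tang γ i j φ := by
    filter_upwards [Lp.coeFn_add (q.2 i) (M (q.2 j)), hM (q.2 j), h2 i, h2 j] with x a b c d
    rw [a, Pi.add_apply, b, c, d]
    rfl
  have ht := hφ.tang (i := i) (j := j) S.contDiff
  rw [Lp.norm_def, Lp.norm_def, eLpNorm_congr_ae e1, eLpNorm_congr_ae e2,
    ← ENNReal.toReal_ofReal (abs_nonneg h), ← ENNReal.toReal_mul]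
  exact ENNReal.toReal_mono (ENNReal.mul_ne_top ENNReal.ofReal_ne_top ht.memLp.2.ne)
    (eLpNorm_shear_sub_le S.ne S.contDiff S.isOpen S.mem hφ h)

theorem exists_norm_op_sub_sub_le (S : ShearDomain γ i j G) {M : L2 𝕜 G →L[𝕜] L2 𝕜 G}
    (hM : ∀ u, M u =ᵐ[volume.restrict G] fun x => deriv γ (x i) • u x)
    {q : L2 𝕜 G × (Fin n → L2 𝕜 G)} (hq : q ∈ testGraph 𝕜 G) :
    ∃ C, ∀ h : ℝ, ‖S.op h q.1 - q.1 - (h : 𝕜) • (q.2 i + M (q.2 j))‖ ≤ |h| * (|h| * C) := by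
  obtain ⟨φ, hφ, h1, h2⟩ := hq
  have ht := (hφ.tang (i := i) (j := j) S.contDiff).tang (i := i) (j := j) S.contDiff
  refine ⟨(eLpNorm (tang γ i j (tang γ i j φ)) 2 (volume.restrict G)).toReal, fun h => ?_⟩
  have e1 : S.op h q.1 - q.1 - (h : 𝕜) • (q.2 i + M (q.2 j)) =ᵐ[volume.restrict G]
      fun x => φ (shear γ i j h x) - φ x - h • tang γ i j φ x := by
    filter_upwards [Lp.coeFn_sub (S.op h q.1 - q.1) ((h : 𝕜) • (q.2 i + M (q.2 j))),
      Lp.coeFn_sub (S.op h q.1) q.1, Lp.coeFn_smul (h : 𝕜) (q.2 i + M (q.2 j)),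
      Lp.coeFn_add (q.2 i) (M (q.2 j)), hM (q.2 j), h2 i, h2 j, S.op_congr h h1, h1]
      with x a b c d e f g k l
    rw [a, Pi.sub_apply, b, Pi.sub_apply, c, Pi.smul_apply, d, Pi.add_apply, e, f, g, k, l,
      RCLike.real_smul_eq_coe_mul (K := 𝕜) h]
    rfl
  rw [Lp.norm_def, eLpNorm_congr_ae e1, ← ENNReal.toReal_ofReal (abs_nonneg h),
    ← ENNReal.toReal_mul, ← ENNReal.toReal_mul]
  exact ENNReal.toReal_mono (ENNReal.mul_ne_top ENNReal.ofReal_ne_top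
    (ENNReal.mul_ne_top ENNReal.ofReal_ne_top ht.memLp.2.ne))
    (eLpNorm_shear_sub_sub_le S.ne S.contDiff S.isOpen S.mem hφ h)

/-- An `ε/3` argument: `p` is approximated by a test pair `q`. The difference quotient of `p - q` is
bounded uniformly in `h` by `norm_op_sub_le`, and that of `q` converges by the second order
estimate. -/
theorem tendsto_op (S : ShearDomain γ i j G) {M : L2 𝕜 G →L[𝕜] L2 𝕜 G}
    (hM : ∀ u, M u =ᵐ[volume.restrict G] fun x => deriv γ (x i) • u x)
    {p : L2 𝕜 G × (Fin n → L2 𝕜 G)} (hp : p ∈ (testGraph 𝕜 G).topologicalClosure) :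
    Tendsto (fun h : ℝ => ((h⁻¹ : ℝ) : 𝕜) • (S.op h p.1 - p.1)) (𝓝[≠] 0)
      (𝓝 (p.2 i + M (p.2 j))) := by
  have hX : Continuous fun q : L2 𝕜 G × (Fin n → L2 𝕜 G) => q.2 i + M (q.2 j) :=
    ((continuous_apply i).comp continuous_snd).add
      (M.continuous.comp ((continuous_apply j).comp continuous_snd))
  rw [Metric.tendsto_nhds]
  intro ε hε
  obtain ⟨q, hq, hqp⟩ : ∃ q ∈ (testGraph 𝕜 G : Submodule 𝕜 (L2 𝕜 G × (Fin n → L2 𝕜 G))),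
      dist (q.2 i + M (q.2 j)) (p.2 i + M (p.2 j)) < ε / 3 := by
    have := (mem_closure_iff_frequently.1 hp).and_eventually
      (hX.continuousAt.eventually (Metric.ball_mem_nhds _ (by positivity : 0 < ε / 3)))
    obtain ⟨q, hq, hq'⟩ := this.exists
    exact ⟨q, hq, hq'⟩
  obtain ⟨C, hC⟩ := S.exists_norm_op_sub_sub_le hM hq
  have hsmall : ∀ᶠ h : ℝ in 𝓝[≠] 0, |h| * C < ε / 3 := by
    have : Tendsto (fun h : ℝ => |h| * C) (𝓝 0) (𝓝 (|0| * C)) :=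
      (continuous_abs.mul continuous_const).tendsto 0
    rw [abs_zero, zero_mul] at this
    exact (this.mono_left nhdsWithin_le_nhds).eventually (gt_mem_nhds (by positivity))
  filter_upwards [hsmall, self_mem_nhdsWithin] with h hh h0
  have h0' : h ≠ 0 := h0
  have hd := S.norm_op_sub_le h hM (Submodule.sub_mem _ hp (Submodule.le_topologicalClosure _ hq))
  have habs : 0 < |h| := abs_pos.2 h0'
  have hc : ‖((h⁻¹ : ℝ) : 𝕜)‖ = |h|⁻¹ := by rw [RCLike.norm_ofReal, abs_inv]
  have e : ((h⁻¹ : ℝ) : 𝕜) • (S.op h p.1 - p.1) - (p.2 i + M (p.2 j)) =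
      ((h⁻¹ : ℝ) : 𝕜) • (S.op h (p - q).1 - (p - q).1) +
      ((h⁻¹ : ℝ) : 𝕜) • (S.op h q.1 - q.1 - (h : 𝕜) • (q.2 i + M (q.2 j))) +
      ((q.2 i + M (q.2 j)) - (p.2 i + M (p.2 j))) := by
    have h1 : ((h⁻¹ : ℝ) : 𝕜) • (h : 𝕜) • (q.2 i + M (q.2 j)) = q.2 i + M (q.2 j) := by
      rw [smul_smul, ← RCLike.ofReal_mul, inv_mul_cancel₀ h0', RCLike.ofReal_one, one_smul]
    rw [smul_sub _ (S.op h q.1 - q.1), h1, Prod.fst_sub, map_sub]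
    module
  rw [dist_eq_norm, e]
  have b1 : ‖((h⁻¹ : ℝ) : 𝕜) • (S.op h (p - q).1 - (p - q).1)‖ < ε / 3 := by
    rw [norm_smul, hc]
    calc _ ≤ |h|⁻¹ * (|h| * ‖(p - q).2 i + M ((p - q).2 j)‖) := by gcongr
      _ = ‖(p - q).2 i + M ((p - q).2 j)‖ := by field_simp
      _ = dist (q.2 i + M (q.2 j)) (p.2 i + M (p.2 j)) := by
        rw [dist_comm, dist_eq_norm]
        congr 1
        simp only [Prod.snd_sub, Pi.sub_apply, map_sub]
        abel
      _ < _ := hqp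
  have b2 : ‖((h⁻¹ : ℝ) : 𝕜) • (S.op h q.1 - q.1 - (h : 𝕜) • (q.2 i + M (q.2 j)))‖ < ε / 3 := by
    rw [norm_smul, hc]
    calc _ ≤ |h|⁻¹ * (|h| * (|h| * C)) := by gcongr; exact hC h
      _ = |h| * C := by field_simp
      _ < _ := hh
  rw [dist_eq_norm] at hqp
  calc _ ≤ _ := norm_add₃_le
    _ < ε / 3 + ε / 3 + ε / 3 := by gcongr
    _ = ε := by ring

/-- Nirenberg's argument. The equation is tested with the difference `d` of `p` along the flow and
with its backward shift. The main terms combine into `∑ ‖d_l‖²`; what remains contains either a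
further difference of `d` or a difference of `γ'`, hence is `O(|h|)` times the gradient norm of `d`.
Dividing once by that norm gives the bound. -/
theorem exists_gradient_bound (S : ShearDomain γ i j G)
    {p : L2 𝕜 G × (Fin n → L2 𝕜 G)} (hp : p ∈ (testGraph 𝕜 G).topologicalClosure) {F : L2 𝕜 G}
    (hF : WeakDiv G (fun l => p.2 l) F) :
    ∃ C, ∀ h : ℝ, ∃ q ∈ (testGraph 𝕜 G).topologicalClosure, q.1 = S.op h p.1 - p.1 ∧
      ∀ l, ‖q.2 l‖ ≤ |h| * C := by
  obtain ⟨Γ, hΓ⟩ := S.exists_deriv_bound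
  obtain ⟨B, hB, hBl⟩ := S.exists_deriv_lipschitz
  have hΓ0 : 0 ≤ Γ := (abs_nonneg _).trans (hΓ 0)
  have hcd : Continuous fun x : Euc n => deriv γ (x i) :=
    (contDiff_deriv_comp_coord S.contDiff).continuous
  obtain ⟨M, hM, hMn⟩ := exists_mulOp (𝕜 := 𝕜) (μ := volume.restrict G) hcd (fun x => hΓ (x i))
  have hδ : ∀ h : ℝ, ∃ D : L2 𝕜 G →L[𝕜] L2 𝕜 G, (∀ u, D u =ᵐ[volume.restrict G]
      fun x => (deriv γ (x i + h) - deriv γ (x i)) • u x) ∧ ∀ u, ‖D u‖ ≤ (B * |h|) * ‖u‖ := fun h =>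
    exists_mulOp ((S.contDiff_deriv.continuous.comp (by fun_prop)).sub hcd)
      (fun x => hBl (x i) h)
  choose D hD hDn using hδ
  refine ⟨(1 + Γ) * ‖F‖ + B * ‖p.2 i‖ + B * ‖p.2 j‖, fun h => ?_⟩
  set d : L2 𝕜 G × (Fin n → L2 𝕜 G) :=
    (S.op h p.1, fun l => S.op h (p.2 l) + if l = i then D h (S.op h (p.2 j)) else 0) - p with hd
  have hdK : d ∈ (testGraph 𝕜 G).topologicalClosure :=
    Submodule.sub_mem _ (S.shift_mem h (hD h) hp) hp
  refine ⟨d, hdK, rfl, ?_⟩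
  -- The backward shift of `d` is an admissible test function too; the adjoint of the shift by `h`
  -- is the shift by `-h`.
  have hd'K := S.shift_mem (-h) (hD (-h)) hdK
  set s : ℝ := Real.sqrt (∑ l, ‖d.2 l‖ ^ 2) with hs
  have hsl : ∀ l, ‖d.2 l‖ ≤ s := fun l => by
    refine Real.le_sqrt_of_sq_le ?_
    exact Finset.single_le_sum (f := fun l => ‖d.2 l‖ ^ 2) (fun _ _ => by positivity)
      (Finset.mem_univ l)
  have hs0 : 0 ≤ s := Real.sqrt_nonneg _
  have hs2 : s ^ 2 = ∑ l, ‖d.2 l‖ ^ 2 := Real.sq_sqrt (Finset.sum_nonneg fun _ _ => by positivity)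
  have e1 := hF.inner_eq hdK
  have e2 := hF.inner_eq hd'K
  -- One factor `d.2 l` is expanded and the shift is moved to the other side. The two tested
  -- equations then eliminate the principal terms, leaving `F` and the two commutator terms with
  -- `γ'`.
  have e3 : ∑ l, inner 𝕜 (d.2 l) (d.2 l) =
      -inner 𝕜 (S.op (-h) d.1 - d.1) F - inner 𝕜 (D (-h) (S.op (-h) (d.2 j))) (p.2 i) +
        inner 𝕜 (d.2 i) (D h (S.op h (p.2 j))) := by
    have a1 : ∀ l, inner 𝕜 (d.2 l) (d.2 l) = inner 𝕜 (S.op (-h) (d.2 l)) (p.2 l) -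
        inner 𝕜 (d.2 l) (p.2 l) +
        if l = i then inner 𝕜 (d.2 i) (D h (S.op h (p.2 j))) else 0 := by
      intro l
      have a2 : d.2 l = S.op h (p.2 l) + (if l = i then D h (S.op h (p.2 j)) else 0) - p.2 l := rfl
      refine (congrArg (inner 𝕜 (d.2 l)) a2).trans ?_
      rw [inner_sub_right, inner_add_right, S.inner_op_right]
      by_cases hl : l = i
      · simp only [hl, if_true]
        ring
      · simp only [hl, if_false, inner_zero_right]
        ring
    have a3 : ∀ l, inner 𝕜 (S.op (-h) (d.2 l) + if l = i then D (-h) (S.op (-h) (d.2 j)) else 0)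
        (p.2 l) = inner 𝕜 (S.op (-h) (d.2 l)) (p.2 l) +
          if l = i then inner 𝕜 (D (-h) (S.op (-h) (d.2 j))) (p.2 i) else 0 := by
      intro l
      rw [inner_add_left]
      by_cases hl : l = i
      · simp only [hl, if_true]
      · simp only [hl, if_false, inner_zero_left]
    simp only [a3, Finset.sum_add_distrib, Finset.sum_ite_eq', Finset.mem_univ, if_true] at e2
    rw [Finset.sum_congr rfl fun l _ => a1 l, Finset.sum_add_distrib, Finset.sum_sub_distrib, e1,
      Finset.sum_ite_eq', if_pos (Finset.mem_univ i), eq_sub_of_add_eq e2, inner_sub_left]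
    ring
  have e4 : s ^ 2 = ‖∑ l, inner 𝕜 (d.2 l) (d.2 l)‖ := by
    have : ∑ l, inner 𝕜 (d.2 l) (d.2 l) = ((s ^ 2 : ℝ) : 𝕜) := by
      rw [hs2, RCLike.ofReal_sum]
      exact Finset.sum_congr rfl fun l _ => by rw [inner_self_eq_norm_sq_to_K, RCLike.ofReal_pow]
    rw [this, RCLike.norm_ofReal, abs_of_nonneg (by positivity)]
  have b1 : ‖S.op (-h) d.1 - d.1‖ ≤ |h| * ((1 + Γ) * s) := by
    have := S.norm_op_sub_le (-h) hM hdK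
    rw [abs_neg] at this
    refine this.trans (mul_le_mul_of_nonneg_left ?_ (abs_nonneg h))
    calc _ ≤ ‖d.2 i‖ + ‖M (d.2 j)‖ := norm_add_le _ _
      _ ≤ s + Γ * s := add_le_add (hsl i)
        ((hMn _).trans (mul_le_mul_of_nonneg_left (hsl j) hΓ0))
      _ = _ := by ring
  have b2 : ‖D (-h) (S.op (-h) (d.2 j))‖ ≤ B * |h| * s := by
    refine (hDn _ _).trans ?_
    rw [abs_neg, LinearIsometry.norm_map]
    exact mul_le_mul_of_nonneg_left (hsl j) (by positivity)
  have b3 : ‖D h (S.op h (p.2 j))‖ ≤ B * |h| * ‖p.2 j‖ := by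
    refine (hDn _ _).trans ?_
    rw [LinearIsometry.norm_map]
  have e5 : s ^ 2 ≤ s * (|h| * ((1 + Γ) * ‖F‖ + B * ‖p.2 i‖ + B * ‖p.2 j‖)) := by
    rw [e4, e3]
    calc _ ≤ ‖S.op (-h) d.1 - d.1‖ * ‖F‖ + ‖D (-h) (S.op (-h) (d.2 j))‖ * ‖p.2 i‖ +
          ‖d.2 i‖ * ‖D h (S.op h (p.2 j))‖ := by
          refine (norm_add_le _ _).trans (add_le_add ((norm_sub_le _ _).trans (add_le_add ?_ ?_)) ?_)
          · rw [norm_neg]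
            exact norm_inner_le_norm _ _
          · exact norm_inner_le_norm _ _
          · exact norm_inner_le_norm _ _
      _ ≤ |h| * ((1 + Γ) * s) * ‖F‖ + B * |h| * s * ‖p.2 i‖ + s * (B * |h| * ‖p.2 j‖) := by
          gcongr
          exact hsl i
      _ = _ := by ring
  have e6 : s ≤ |h| * ((1 + Γ) * ‖F‖ + B * ‖p.2 i‖ + B * ‖p.2 j‖) := by
    rcases hs0.eq_or_lt with h0 | h0
    · rw [← h0]
      positivity
    · rw [pow_two] at e5
      exact le_of_mul_le_mul_left e5 h0
  exact fun l => (hsl l).trans e6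

/-- If `u ∈ H¹₀(G)` and `Δu ∈ L²(G)` then the derivative of `u` along the shear flow belongs to
`H¹₀(G)`. -/
theorem tangential_mem (S : ShearDomain γ i j G)
    {p : L2 𝕜 G × (Fin n → L2 𝕜 G)} (hp : p ∈ (testGraph 𝕜 G).topologicalClosure) {F : L2 𝕜 G}
    (hF : WeakDiv G (fun l => p.2 l) F) :
    ∃ q ∈ (testGraph 𝕜 G).topologicalClosure,
      q.1 =ᵐ[volume.restrict G] fun x => p.2 i x + deriv γ (x i) • p.2 j x := by
  obtain ⟨Γ, hΓ⟩ := S.exists_deriv_bound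
  obtain ⟨M, hM, hMn⟩ := exists_mulOp (𝕜 := 𝕜) (μ := volume.restrict G)
    (contDiff_deriv_comp_coord (i := i) S.contDiff).continuous (fun x => hΓ (x i))
  obtain ⟨C, hC⟩ := S.exists_gradient_bound hp hF
  choose d hdK hd1 hd2 using hC
  have hlim := S.tendsto_op hM hp
  let x : {h : ℝ // h ≠ 0} → L2 𝕜 G × (Fin n → L2 𝕜 G) := fun h => ((h.1⁻¹ : ℝ) : 𝕜) • d h.1
  have hx : ∀ h, ‖x h‖ ≤ max ‖p.2 i + M (p.2 j)‖ (max C 0) := by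
    intro h
    have habs : 0 < |h.1| := abs_pos.2 h.2
    have hc : ‖((h.1⁻¹ : ℝ) : 𝕜)‖ = |h.1|⁻¹ := by rw [RCLike.norm_ofReal, abs_inv]
    rw [Prod.norm_def]
    refine max_le_max ?_ ?_
    · change ‖((h.1⁻¹ : ℝ) : 𝕜) • (d h.1).1‖ ≤ _
      rw [norm_smul, hc, hd1]
      calc _ ≤ |h.1|⁻¹ * (|h.1| * ‖p.2 i + M (p.2 j)‖) := by
            gcongr
            exact S.norm_op_sub_le h.1 hM hp
        _ = _ := by field_simp
    · refine (pi_norm_le_iff_of_nonneg (le_max_right _ _)).2 fun l => ?_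
      change ‖((h.1⁻¹ : ℝ) : 𝕜) • (d h.1).2 l‖ ≤ _
      rw [norm_smul, hc]
      refine le_trans ?_ (le_max_left _ _)
      calc _ ≤ |h.1|⁻¹ * (|h.1| * C) := by
            gcongr
            exact hd2 _ _
        _ = _ := by field_simp
  -- The difference quotients are indexed by nonzero `h`; a weak limit is taken along an ultrafilter
  -- finer than `h → 0`, so no subsequence is chosen.
  have hne : (comap ((↑) : {h : ℝ // h ≠ 0} → ℝ) (𝓝[≠] (0 : ℝ))).NeBot := by
    refine comap_coe_neBot_of_le_principal ?_
    exact inf_le_right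
  obtain ⟨q, hq, hw⟩ := exists_weak_limit_prod (Submodule.isClosed_topologicalClosure _)
    (Ultrafilter.of (comap ((↑) : {h : ℝ // h ≠ 0} → ℝ) (𝓝[≠] (0 : ℝ)))) (x := x)
    (fun h => Submodule.smul_mem _ _ (hdK h.1)) hx
  have hs : Tendsto (fun h => (x h).1)
      (Ultrafilter.of (comap ((↑) : {h : ℝ // h ≠ 0} → ℝ) (𝓝[≠] (0 : ℝ))))
      (𝓝 (p.2 i + M (p.2 j))) := by
    refine ((hlim.comp tendsto_comap).mono_left (Ultrafilter.of_le _)).congr fun h => ?_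
    change _ = ((h.1⁻¹ : ℝ) : 𝕜) • (d h.1).1
    rw [hd1]
    rfl
  -- The first components converge strongly to the tangential derivative, which therefore coincides
  -- with the weak limit lying in `H¹₀(G)`.
  have e : q.1 = p.2 i + M (p.2 j) := by
    refine ext_inner_left 𝕜 fun z => tendsto_nhds_unique (hw z) ?_
    exact ((continuous_const.inner continuous_id).tendsto (p.2 i + M (p.2 j))).comp hs
  refine ⟨q, hq, ?_⟩
  rw [e]
  filter_upwards [Lp.coeFn_add (p.2 i) (M (p.2 j)), hM (p.2 j)] with x a b
  rw [a, Pi.add_apply, b]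

theorem exists_zeroTrace_tang (S : ShearDomain γ i j G) {w F : Euc n → 𝕜} {g : Fin n → Euc n → 𝕜}
    (hw : ZeroTrace G w g) (hF : WeakDiv G g F) :
    ∃ v, ZeroTrace G (fun x => g i x + deriv γ (x i) • g j x) v := by
  obtain ⟨p, hp, h1, h2⟩ := hw
  have hF' : WeakDiv G (fun l => p.2 l) (hF.memLp.toLp F) :=
    hF.congr (fun l => (h2 l).symm) hF.memLp.coeFn_toLp.symm
  obtain ⟨q, hq, hq1⟩ := S.tangential_mem hp hF'
  refine ⟨fun l => q.2 l, q, hq, hq1.trans ?_, fun l => ae_eq_refl _⟩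
  filter_upwards [h2 i, h2 j] with x a b
  rw [a, b]

end ShearDomain

/-! ## Regularity near a boundary given by a graph -/

namespace ShearDomain

variable {γ : ℝ → ℝ} {i j : Fin n} {G : Set (Euc n)}

theorem smoothBdd_deriv (S : ShearDomain γ i j G) :
    SmoothBdd (fun x : Euc n => deriv γ (x i)) :=
  smoothBdd_comp_coord S.contDiff_deriv S.exists_deriv_bound S.hasCompactSupport.deriv.deriv i

theorem pd_deriv (S : ShearDomain γ i j G) (l : Fin n) (x : Euc n) :
    pd l (fun x : Euc n => deriv γ (x i)) x = if l = i then deriv (deriv γ) (x i) else 0 :=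
  congrFun (pd_comp_coord S.contDiff_deriv i l) x

/-- The coefficient `1 / (1 + γ'²)`. -/
def coeff (γ : ℝ → ℝ) (s : ℝ) : ℝ := (1 + deriv γ s ^ 2)⁻¹

theorem contDiff_coeff (S : ShearDomain γ i j G) : ContDiff ℝ ∞ (coeff γ) :=
  (contDiff_const.add (S.contDiff_deriv.pow 2)).inv fun s => by positivity

theorem smoothBdd_coeff (S : ShearDomain γ i j G) :
    SmoothBdd (fun x : Euc n => coeff γ (x i)) := by
  refine smoothBdd_comp_coord S.contDiff_coeff ⟨1, fun s => ?_⟩ ?_ i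
  · have h1 : 1 ≤ 1 + deriv γ s ^ 2 := by nlinarith [sq_nonneg (deriv γ s)]
    rw [coeff, abs_of_nonneg (by positivity)]
    exact inv_le_one_of_one_le₀ h1
  · have h1 : HasCompactSupport (fun s => coeff γ s - 1) := by
      refine S.hasCompactSupport.deriv.comp_left (g := fun t : ℝ => (1 + t ^ 2)⁻¹ - 1) ?_
      simp
    have h2 : deriv (coeff γ) = deriv (fun s => coeff γ s - 1) := by
      funext s
      rw [deriv_sub_const]
    rw [h2]
    exact h1.deriv

/-- The rotated gradient is divergence free for any `w` with a weak gradient: the second derivatives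
fall on the test function, where they commute. -/
theorem weakDiv_curl {w : Euc n → 𝕜} {g : Fin n → Euc n → 𝕜} (hg : ∀ l, WeakPd G l w (g l))
    (i j : Fin n) :
    WeakDiv G (fun l x => (if l = j then g i x else 0) - if l = i then g j x else 0)
      (fun _ => 0) := by
  have hm : ∀ a b : Fin n, ∀ l, MemLp (fun x => if l = a then g b x else 0) 2
      (volume.restrict G) := fun a b l => by
    by_cases hl : l = a
    · simpa [hl] using (hg b).memLp_deriv
    · simp [hl]
  have hs : ∀ (ψ : Euc n → ℝ) (a b : Fin n), ∑ l, ∫ x in G, pd l ψ x • (if l = a then g b x else 0)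
      = ∫ x in G, pd a ψ x • g b x := by
    intro ψ a b
    rw [Finset.sum_eq_single a (fun l _ hl => by simp [hl]) (by simp)]
    simp
  refine ⟨fun l => (hm j i l).sub (hm i j l), MemLp.zero', fun ψ hψ => ?_⟩
  have e1 := (weakPd_iff.1 (hg i)).2.2 _ (hψ.pd j)
  have e2 := (weakPd_iff.1 (hg j)).2.2 _ (hψ.pd i)
  rw [pd_comm hψ.contDiff, e2] at e1
  have e3 : ∀ l, ∫ x in G, pd l ψ x • ((if l = j then g i x else 0) - if l = i then g j x else 0) =
      (∫ x in G, pd l ψ x • (if l = j then g i x else 0)) -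
        ∫ x in G, pd l ψ x • (if l = i then g j x else 0) := by
    intro l
    simp only [smul_sub]
    exact integral_sub ((hψ.pd l).integrable_smul (hm j i l))
      ((hψ.pd l).integrable_smul (hm i j l))
  rw [Finset.sum_congr rfl fun l _ => e3 l, Finset.sum_sub_distrib, hs, hs, neg_injective e1]
  simp

/-- The second derivative in the direction `j` in terms of tangential derivatives. -/
theorem weakPd_normal (S : ShearDomain γ i j G) (hij : ∀ l, l = i ∨ l = j) {w F : Euc n → 𝕜}
    {g v : Fin n → Euc n → 𝕜} (hg : ∀ l, WeakPd G l w (g l)) (hF : WeakDiv G g F)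
    (hv : ∀ l, WeakPd G l (fun x => g i x + deriv γ (x i) • g j x) (v l)) :
    WeakPd G j (g j) (fun x => coeff γ (x i) • (F x - v i x + deriv γ (x i) • v j x +
      deriv (deriv γ) (x i) • g j x)) := by
  have hne := S.ne
  have hji := S.ne.symm
  -- Let `t = g_i + γ' g_j`. The field `g - t e_i + γ' t e_j - γ' (g_i e_j - g_j e_i)` has
  -- `i`-component `0` and `j`-component `(1 + γ'²) g_j`. Its divergence involves only `F`, the
  -- gradient `v` of `t`, and `g_j`: the curl contributes no second derivative, and `γ'` depends on
  -- `x_i` alone.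
  have h1 : WeakDiv G (fun l x => if l = j then (1 + deriv γ (x i) ^ 2) • g j x else 0)
      (fun x => F x - v i x + deriv γ (x i) • v j x + deriv (deriv γ) (x i) • g j x) := by
    refine (((hF.sub (hv i)).add ((hv j).smul S.smoothBdd_deriv)).sub
      ((weakDiv_curl hg i j).smul S.smoothBdd_deriv)).congr
      (fun l => Eventually.of_forall fun x => ?_) (Eventually.of_forall fun x => ?_)
    · rcases hij l with rfl | rfl
      · simp [hne]
      · simp only [if_true, hji, if_false]
        module
    · simp only [S.pd_deriv, ite_smul, zero_smul, Finset.sum_ite_eq', Finset.mem_univ, if_true,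
        hji, hne, if_false, zero_sub, smul_zero, zero_add, smul_neg, sub_neg_eq_add, add_zero]
  refine (h1.smul S.smoothBdd_coeff).congr (fun l => Eventually.of_forall fun x => ?_)
    (Eventually.of_forall fun x => ?_)
  · rcases hij l with rfl | rfl
    · simp [hne]
    · have : coeff γ (x i) * (1 + deriv γ (x i) ^ 2) = 1 :=
        inv_mul_cancel₀ (by positivity)
      simp only [if_true, smul_smul, this, one_smul]
  · simp [pd_comp_coord S.contDiff_coeff, hji]

/-- Once `∂_j ∂_j w` is known, `∂_j ∂_i w` follows from the `j`-derivative of the tangential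
derivative, `∂_i ∂_j w` by symmetry, and `∂_i ∂_i w` from the equation. All four are combinations of
`F`, `g`, `v` with smooth bounded coefficients. -/
theorem hasReg_add_two (S : ShearDomain γ i j G) (hij : ∀ l, l = i ∨ l = j) {w F : Euc n → 𝕜}
    {g v : Fin n → Euc n → 𝕜} (hg : ∀ l, WeakPd G l w (g l)) (hF : WeakDiv G g F)
    (hv : ∀ l, WeakPd G l (fun x => g i x + deriv γ (x i) • g j x) (v l)) {k : ℕ}
    (rF : HasReg G k F) (rg : ∀ l, HasReg G k (g l)) (rv : ∀ l, HasReg G k (v l)) :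
    HasReg G (k + 2) w := by
  have hne := S.ne
  have hji := S.ne.symm
  have hjj := S.weakPd_normal hij hg hF hv
  have hs2 : SmoothBdd (fun x : Euc n => deriv (deriv γ) (x i)) := by
    have h := S.smoothBdd_deriv.pd i
    rw [pd_comp_coord S.contDiff_deriv] at h
    simpa using h
  set gjj : Euc n → 𝕜 := fun x => coeff γ (x i) • (F x - v i x + deriv γ (x i) • v j x +
      deriv (deriv γ) (x i) • g j x) with hgjj
  have rjj : HasReg G k gjj :=
    HasReg.smul S.smoothBdd_coeff (((rF.sub (rv i)).add ((rv j).smul S.smoothBdd_deriv)).add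
      ((rg j).smul hs2))
  have hij' : WeakPd G j (g i) (fun x => v j x - deriv γ (x i) • gjj x) := by
    refine ((hv j).sub (hjj.smul S.smoothBdd_deriv)).congr (Eventually.of_forall fun x => ?_)
      (Eventually.of_forall fun x => ?_)
    · simp
    · simp [S.pd_deriv, hji]
  have rij : HasReg G k (fun x => v j x - deriv γ (x i) • gjj x) :=
    (rv j).sub (rjj.smul S.smoothBdd_deriv)
  have hji' : WeakPd G i (g j) (fun x => v j x - deriv γ (x i) • gjj x) :=
    WeakPd.symm (hg i) (hg j) hij'
  have hii : WeakPd G i (g i) (fun x => F x - gjj x) := by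
    refine (hF.sub hjj).congr (fun l => Eventually.of_forall fun x => ?_) (ae_eq_refl _)
    rcases hij l with rfl | rfl
    · simp [hne]
    · simp [hji]
  have rii : HasReg G k (fun x => F x - gjj x) := rF.sub rjj
  refine ⟨(hg i).memLp, fun l => ⟨g l, hg l, (rg l).memLp, fun m => ?_⟩⟩
  rcases hij l with rfl | rfl <;> rcases hij m with rfl | rfl
  exacts [⟨_, hii, rii⟩, ⟨_, hij', rij⟩, ⟨_, hji', rij⟩, ⟨_, hjj, rjj⟩]

/-- The tangential derivative has vanishing trace, and its Laplacian is the tangential derivative of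
`F` plus commutator terms of order at most two in `w`. The induction hypothesis is used twice: for
`w`, to control the commutator, and then for the tangential derivative itself. -/
theorem hasReg_of_weakDiv (S : ShearDomain γ i j G) (hij : ∀ l, l = i ∨ l = j) {k : ℕ}
    {w F : Euc n → 𝕜} {g : Fin n → Euc n → 𝕜} (hw : ZeroTrace G w g) (hF : WeakDiv G g F)
    (rF : HasReg G k F) : HasReg G (k + 2) w := by
  induction k generalizing w F g with
  | zero =>
    obtain ⟨v, hv⟩ := S.exists_zeroTrace_tang hw hF
    exact S.hasReg_add_two hij hw.weakPd hF hv.weakPd rF hw.memLp_grad hv.memLp_grad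
  | succ k ih =>
    obtain ⟨v, hv⟩ := S.exists_zeroTrace_tang hw hF
    have rw : HasReg G (k + 2) w := ih hw hF rF.of_succ
    have rg : ∀ l, HasReg G (k + 1) (g l) := fun l => HasReg.deriv S.isOpen rw (hw.weakPd l)
    choose g2 hg2 rg2 using fun l => (rg l).2
    choose F' hF' rF' using rF.2
    have hsym : ∀ l m, WeakPd G l (g m) (g2 l m) := fun l m =>
      WeakPd.symm (hw.weakPd l) (hw.weakPd m) (hg2 l m)
    have hv' : ∀ l, v l =ᵐ[volume.restrict G] fun x => g2 l i x + (deriv γ (x i) • g2 l j x +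
        pd l (fun x : Euc n => deriv γ (x i)) x • g j x) := fun l =>
      (hv.weakPd l).unique S.isOpen ((hsym l i).add ((hsym l j).smul S.smoothBdd_deriv))
    have hdiv : ∀ m, WeakDiv G (fun l => g2 l m) (F' m) := fun m =>
      hF.deriv (fun l => hg2 l m) (hF' m)
    -- Divergence of the gradient of `∂_i w + γ' ∂_j w`, computed by the product rule from the
    -- differentiated equations.
    have hvdiv := ((hdiv i).add (((hdiv j).smul S.smoothBdd_deriv).add
      (WeakDiv.of_weakPd fun l => (hsym l j).smul (S.smoothBdd_deriv.pd l)))).congr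
      (fun l => (hv' l).symm) (ae_eq_refl _)
    have rv : HasReg G (k + 2) _ := ih hv hvdiv ((rF' i).add ((((rF' j).smul S.smoothBdd_deriv).add
      (HasReg.sum _ fun l => (rg2 l j).smul (S.smoothBdd_deriv.pd l))).add
      (HasReg.sum _ fun l => ((rg2 l j).smul (S.smoothBdd_deriv.pd l)).add
        ((rg j).of_succ.smul ((S.smoothBdd_deriv.pd l).pd l)))))
    exact S.hasReg_add_two hij hw.weakPd hF hv.weakPd rF rg
      fun l => HasReg.deriv S.isOpen rv (hv.weakPd l)

end ShearDomain

/-! ## Boundary charts -/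

theorem isInvertible_of_apply_one_ne_zero {L : ℝ →L[ℝ] ℝ} (h : L 1 ≠ 0) : L.IsInvertible :=
  ⟨ContinuousLinearEquiv.unitsEquivAut ℝ (Units.mk0 (L 1) h), by ext; simp⟩

/-- The implicit function theorem describes the zero set as a graph, and strict monotonicity of `σ
f` in the second variable turns this into a description of the sign of `f`. A cutoff makes `γ`
globally defined with compact support. -/
theorem exists_graph {f : ℝ × ℝ → ℝ} (hf : ContDiff ℝ ∞ f) {p₀ : ℝ × ℝ} (h0 : f p₀ = 0)
    (hσ : fderiv ℝ f p₀ (0, 1) ≠ 0) :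
    ∃ γ : ℝ → ℝ, ContDiff ℝ ∞ γ ∧ HasCompactSupport γ ∧ ∃ δ > 0, ∀ p ∈ Metric.ball p₀ δ,
      (f p < 0 ↔ fderiv ℝ f p₀ (0, 1) * (p.2 - γ p.1) < 0) := by
  set σ := fderiv ℝ f p₀ (0, 1) with hσd
  have hfc : Continuous fun p => σ * fderiv ℝ f p (0, 1) :=
    continuous_const.mul ((hf.continuous_fderiv (by simp)).clm_apply continuous_const)
  obtain ⟨ε, hε, hN⟩ : ∃ ε > 0, ∀ p ∈ Metric.ball p₀ ε, 0 < σ * fderiv ℝ f p (0, 1) := by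
    have h1 : ∀ᶠ p in 𝓝 p₀, 0 < σ * fderiv ℝ f p (0, 1) :=
      hfc.continuousAt.eventually (lt_mem_nhds (mul_self_pos.2 hσ))
    obtain ⟨ε, hε, h⟩ := Metric.eventually_nhds_iff_ball.1 h1
    exact ⟨ε, hε, h⟩
  have hball : ∀ s t : ℝ, (s, t) ∈ Metric.ball p₀ ε ↔ |s - p₀.1| < ε ∧ t ∈ Metric.ball p₀.2 ε := by
    intro s t
    rw [Metric.mem_ball, Prod.dist_eq, max_lt_iff, Real.dist_eq, Metric.mem_ball]
  have hmono : ∀ s : ℝ, |s - p₀.1| < ε →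
      StrictMonoOn (fun t => σ * f (s, t)) (Metric.ball p₀.2 ε) := by
    intro s hs
    have hd : ∀ t, HasDerivAt (fun t => σ * f (s, t)) (σ * fderiv ℝ f (s, t) (0, 1)) t := fun t =>
      ((hf.differentiable (by simp) (s, t)).hasFDerivAt.comp_hasDerivAt t
        ((hasDerivAt_const t s).prodMk (hasDerivAt_id t))).const_mul σ
    refine strictMonoOn_of_deriv_pos (convex_ball _ _)
      (fun t _ => (hd t).continuousAt.continuousWithinAt) fun t ht => ?_
    rw [(hd t).deriv]
    exact hN _ ((hball s t).2 ⟨hs, interior_subset ht⟩)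
  have hinv : ∀ p ∈ Metric.ball p₀ ε, (fderiv ℝ f p ∘L .inr ℝ ℝ ℝ).IsInvertible := fun p hp =>
    isInvertible_of_apply_one_ne_zero (right_ne_zero_of_mul (hN p hp).ne')
  have hp₀ : p₀ ∈ Metric.ball p₀ ε := Metric.mem_ball_self hε
  have himp : ∀ p ∈ Metric.ball p₀ ε, f p = 0 → ∃ ψ : ℝ → ℝ, ContDiffAt ℝ ∞ ψ p.1 ∧ ψ p.1 = p.2 ∧
      ∀ᶠ s in 𝓝 p.1, f (s, ψ s) = 0 ∧ (s, ψ s) ∈ Metric.ball p₀ ε := by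
    intro p hp hfp
    have h1 := hf.contDiffAt (x := p)
    have hψ := h1.contDiffAt_implicitFunction (by simp) (hinv p hp)
    have hψ1 := h1.implicitFunction_apply_self (by simp) (hinv p hp)
    have hψ2 := h1.eventually_apply_implicitFunction (by simp) (hinv p hp)
    refine ⟨_, hψ, hψ1, ?_⟩
    have hc : ContinuousAt (fun s => (s, h1.implicitFunction (by simp) (hinv p hp) s)) p.1 :=
      continuousAt_id.prodMk hψ.continuousAt
    have hc' := hc.eventually (Metric.isOpen_ball.mem_nhds (x := (p.1, _)) (by
      rw [hψ1]
      exact hp))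
    filter_upwards [hψ2, hc'] with s a b
    exact ⟨a.trans hfp, b⟩
  obtain ⟨ψ, hψs, hψ0, hψ⟩ := himp p₀ hp₀ h0
  obtain ⟨δ, hδ, hψδ⟩ := Metric.eventually_nhds_iff_ball.1 hψ
  -- The implicit function theorem gives smoothness of `ψ` at the base point only. At a nearby `s`
  -- it is applied again at `(s, ψ s)`, and monotonicity in the second variable identifies the new
  -- branch with `ψ`.
  have hsmooth : ∀ s ∈ Metric.ball p₀.1 δ, ContDiffAt ℝ ∞ ψ s := by
    intro s hs
    obtain ⟨hs1, hs2⟩ := hψδ s hs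
    obtain ⟨ψ', h1, h2, h3⟩ := himp _ hs2 hs1
    refine h1.congr_of_eventuallyEq ?_
    filter_upwards [h3, Metric.isOpen_ball.mem_nhds hs] with t ht ht'
    obtain ⟨a1, a2⟩ := hψδ t ht'
    obtain ⟨b1, b2⟩ := ht
    rw [hball] at a2 b2
    refine (hmono t a2.1).injOn a2.2 b2.2 ?_
    simp only [a1, b1]
  -- The cutoff is one on the part where the sign of `f` is compared and is supported where `ψ` is
  -- known to be smooth.
  let χ : ContDiffBump p₀.1 := ⟨δ / 3, δ / 2, by positivity, by linarith⟩
  refine ⟨fun s => χ s * ψ s, contDiff_iff_contDiffAt.2 fun s => ?_,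
    χ.hasCompactSupport.mul_right, min (δ / 3) ε, by positivity, ?_⟩
  · by_cases hs : s ∈ tsupport χ
    · rw [χ.tsupport_eq] at hs
      exact χ.contDiff.contDiffAt.mul
        (hsmooth s (Metric.closedBall_subset_ball (by change δ / 2 < δ; linarith) hs))
    · have h1 : (fun s => χ s * ψ s) =ᶠ[𝓝 s] fun _ => 0 := by
        filter_upwards [(notMem_tsupport_iff_eventuallyEq.1 hs)] with t ht
        rw [ht]
        simp
      exact contDiffAt_const.congr_of_eventuallyEq h1
  · rintro ⟨s, t⟩ hp
    rw [Metric.mem_ball, lt_min_iff] at hp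
    have hpε : (s, t) ∈ Metric.ball p₀ ε := hp.2
    have hs : dist s p₀.1 < δ / 3 := (le_max_left _ _).trans_lt hp.1
    have hχ : χ s = 1 := χ.one_of_mem_closedBall hs.le
    obtain ⟨a1, a2⟩ := hψδ s (by rw [Metric.mem_ball]; linarith)
    rw [hball] at a2 hpε
    have hm := hmono s a2.1
    simp only [hχ, one_mul]
    have e1 := hm.lt_iff_lt hpε.2 a2.2
    have e2 := hm.lt_iff_lt a2.2 hpε.2
    simp only [a1, mul_zero] at e1 e2
    rcases lt_or_gt_of_ne hσ with h | h
    · simp only [mul_pos_iff, h.not_gt, h, false_and, true_and, false_or] at e2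
      simp only [mul_neg_iff, h.not_gt, h, false_and, true_and, false_or, e2, sub_pos]
    · simp only [mul_neg_iff, h.not_gt, h, false_and, true_and, or_false] at e1
      simp only [mul_neg_iff, h.not_gt, h, false_and, true_and, or_false, e1, sub_neg]

theorem exists_chart {Ω : Set (Euc 2)} (hΩ : IsOpen Ω) (hs : HasSmoothBoundary Ω) {x₀ : Euc 2}
    (hx₀ : x₀ ∈ closure Ω) : ∃ (i j : Fin 2) (γ : ℝ → ℝ) (G : Set (Euc 2)) (r : ℝ), 0 < r ∧
      ShearDomain γ i j G ∧ (∀ l, l = i ∨ l = j) ∧ Ω ∩ Metric.ball x₀ r = G ∩ Metric.ball x₀ r := by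
  by_cases hx : x₀ ∈ Ω
  -- Interior points use the whole plane with `γ = 0`, so that no separate interior regularity
  -- argument is needed.
  · obtain ⟨r, hr, hrΩ⟩ := Metric.isOpen_iff.1 hΩ x₀ hx
    refine ⟨0, 1, 0, Set.univ, r, hr, ⟨by decide, contDiff_const, HasCompactSupport.zero,
      isOpen_univ, fun _ _ _ => Set.mem_univ _⟩, by decide, ?_⟩
    rw [Set.univ_inter, Set.inter_eq_right.2 hrΩ]
  obtain ⟨U, hU, hxU, ρ, hρ, hρ', hΩU⟩ := hs x₀ (by
    rw [hΩ.frontier_eq]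
    exact ⟨hx₀, hx⟩)
  have hmem : ∀ y ∈ U, (y ∈ Ω ↔ ρ y < 0) := fun y hy => by
    have := Set.ext_iff.1 hΩU y
    simpa [hy] using this
  -- A positive value would exclude points of `Ω` near `x₀`; a negative one would put `x₀` in `Ω`.
  have hρ0 : ρ x₀ = 0 := by
    refine le_antisymm (not_lt.1 fun hpos => ?_) (not_lt.1 fun h => hx ((hmem x₀ hxU).2 h))
    have h1 : ∀ᶠ y in 𝓝 x₀, 0 < ρ y ∧ y ∈ U :=
      (hρ.continuous.continuousAt.eventually (lt_mem_nhds hpos)).and (hU.mem_nhds hxU)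
    obtain ⟨y, hyΩ, hy1, hy2⟩ := ((mem_closure_iff_frequently.1 hx₀).and_eventually h1).exists
    exact hy1.not_gt ((hmem y hy2).1 hyΩ)
  obtain ⟨j, hj⟩ : ∃ j, fderiv ℝ ρ x₀ (EuclideanSpace.single j (1 : ℝ)) ≠ 0 := by
    by_contra! hcon
    refine hρ' (ContinuousLinearMap.coe_injective
      ((EuclideanSpace.basisFun (Fin 2) ℝ).toBasis.ext fun j => ?_))
    simpa using hcon j
  obtain ⟨i, hne, hij⟩ : ∃ i, i ≠ j ∧ ∀ l, l = i ∨ l = j := by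
    fin_cases j
    · exact ⟨1, by decide, by decide⟩
    · exact ⟨0, by decide, by decide⟩
  let P : ℝ × ℝ → Euc 2 := fun p =>
    p.1 • EuclideanSpace.single i (1 : ℝ) + p.2 • EuclideanSpace.single j (1 : ℝ)
  have hP : ∀ y : Euc 2, P (y i, y j) = y := by
    intro y
    ext l
    rcases hij l with rfl | rfl
    · simp [P, hne]
    · simp [P, hne.symm]
  have hPc : ContDiff ℝ ∞ P :=
    (contDiff_fst.smul contDiff_const).add (contDiff_snd.smul contDiff_const)
  have hfd : fderiv ℝ (fun p => ρ (P p)) (x₀ i, x₀ j) (0, 1) =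
      fderiv ℝ ρ x₀ (EuclideanSpace.single j (1 : ℝ)) := by
    have d1 : HasFDerivAt (Prod.fst : ℝ × ℝ → ℝ) (.fst ℝ ℝ ℝ) (x₀ i, x₀ j) := hasFDerivAt_fst
    have d2 : HasFDerivAt (Prod.snd : ℝ × ℝ → ℝ) (.snd ℝ ℝ ℝ) (x₀ i, x₀ j) := hasFDerivAt_snd
    have h1 : HasFDerivAt P _ (x₀ i, x₀ j) :=
      (d1.smul_const (EuclideanSpace.single i (1 : ℝ))).add
        (d2.smul_const (EuclideanSpace.single j (1 : ℝ)))
    have h2 : HasFDerivAt ρ (fderiv ℝ ρ x₀) (P (x₀ i, x₀ j)) := by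
      rw [hP]
      exact (hρ.differentiable (by simp) x₀).hasFDerivAt
    have h3 := (h2.comp _ h1).fderiv
    have h4 := congrArg (fun L : ℝ × ℝ →L[ℝ] ℝ => L (0, 1)) h3
    refine Eq.trans h4 ?_
    simp
  obtain ⟨γ, hγ, hγs, δ, hδ, hδf⟩ := exists_graph (hρ.comp hPc) (p₀ := (x₀ i, x₀ j))
    (by simpa [hP] using hρ0) (by
      intro h
      exact hj (hfd.symm.trans h))
  set σ := fderiv ℝ (ρ ∘ P) (x₀ i, x₀ j) (0, 1)
  obtain ⟨r, hr, hrU⟩ := Metric.isOpen_iff.1 hU x₀ hxU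
  have hcoord : ∀ l, Continuous fun x : Euc 2 => x l := fun l =>
    (EuclideanSpace.proj l : Euc 2 →L[ℝ] ℝ).continuous
  refine ⟨i, j, γ, {x | σ * (x j - γ (x i)) < 0}, min r δ, lt_min hr hδ, ⟨hne, hγ, hγs, ?_, ?_⟩,
    hij, ?_⟩
  · exact isOpen_lt (continuous_const.mul ((hcoord j).sub (hγ.continuous.comp (hcoord i))))
      continuous_const
  · intro h x hx
    have e : (shear γ i j h x) j - γ ((shear γ i j h x) i) = x j - γ (x i) := by
      rw [shear_apply_self hne]
      simp only [shear, PiLp.add_apply, PiLp.smul_apply, PiLp.single_apply, hne.symm, if_false,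
        if_true, smul_eq_mul, mul_one, mul_zero, zero_add]
      ring
    rw [Set.mem_ofPred_eq, e]
    exact hx
  · ext y
    simp only [Set.mem_inter_iff, Set.mem_ofPred_eq, and_congr_left_iff]
    intro hy
    rw [Metric.mem_ball, lt_min_iff] at hy
    rw [hmem y (hrU hy.1)]
    have hyl : ∀ l, dist (y l) (x₀ l) < δ := fun l => by
      refine lt_of_le_of_lt ?_ hy.2
      rw [dist_eq_norm, dist_eq_norm]
      exact PiLp.norm_apply_le (y - x₀) l
    have h1 := hδf (y i, y j) (by
      rw [Metric.mem_ball, Prod.dist_eq]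
      exact max_lt (hyl i) (hyl j))
    simpa [hP] using h1

/-! ## Regularity for the Dirichlet problem -/

/-- The product `ζ u` solves a Dirichlet problem on the model domain `G`. Its right-hand side
contains `∇u` and `u`, whence the requirement that these already be in `H^k`; the result is carried
back to `Ω`. -/
theorem exists_cutoff_regularity {Ω : Set (Euc 2)} (hΩ : IsOpen Ω) (hs : HasSmoothBoundary Ω)
    {k : ℕ} {u f : Euc 2 → 𝕜} {g : Fin 2 → Euc 2 → 𝕜} (hu : ZeroTrace Ω u g)
    (hf : WeakDiv Ω g f) (rf : HasReg Ω k f) (ru : HasReg Ω k u) (rg : ∀ l, HasReg Ω k (g l))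
    {x₀ : Euc 2} (hx₀ : x₀ ∈ closure Ω) :
    ∃ ζ : Euc 2 → ℝ, SmoothBdd ζ ∧ HasReg Ω (k + 2) (fun x => ζ x • u x) ∧
      ∀ᶠ x in 𝓝 x₀, ζ x = 1 := by
  obtain ⟨i, j, γ, G, r, hr, S, hij, hG⟩ := exists_chart hΩ hs hx₀
  obtain ⟨ζ, s', hs', hs'r, hζ, hζt, hζ0, hζ1⟩ :=
    exists_cutoff x₀ (s := r / 2) (r := r) (by positivity) (by linarith)
  have hs'0 : 0 < s' := lt_trans (by positivity) hs'
  have htsupp : tsupport ζ ⊆ Metric.closedBall x₀ s' :=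
    closure_minimal (fun x hx => by
      by_contra h
      exact hx (hζ0 x h)) Metric.isClosed_closedBall
  have hd0 : ∀ l x, x ∉ Metric.closedBall x₀ s' → pd l ζ x = 0 := fun l x hx =>
    image_eq_zero_of_notMem_tsupport fun h =>
      hx (htsupp (tsupport_fderiv_apply_subset ℝ _ h))
  have hdd0 : ∀ l m x, x ∉ Metric.closedBall x₀ s' → pd m (pd l ζ) x = 0 := fun l m x hx =>
    image_eq_zero_of_notMem_tsupport fun h =>
      hx (htsupp (tsupport_fderiv_apply_subset ℝ _ (tsupport_fderiv_apply_subset ℝ _ h)))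
  have rF := (((rf.smul hζ).add (HasReg.sum Finset.univ fun l => (rg l).smul (hζ.pd l))).add
    (HasReg.sum Finset.univ fun l => ((rg l).smul (hζ.pd l)).add (ru.smul ((hζ.pd l).pd l))))
  have h1 := (hf.localize hζ hu.weakPd).transfer hs'0 hs'r hG
    (fun l x hx => by simp [hζ0 x hx, hd0 l x hx])
    (fun x hx => by simp [hζ0 x hx, hd0 _ x hx, hdd0 _ _ x hx])
  have h2 := rF.transfer hs'0 hs'r hG (fun x hx => by simp [hζ0 x hx, hd0 _ x hx, hdd0 _ _ x hx])
  have h3 := S.hasReg_of_weakDiv hij (hu.localize hG hζt) h1 h2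
  refine ⟨ζ, hζ, h3.transfer hs'0 hs'r hG.symm (fun x hx => by simp [hζ0 x hx]), ?_⟩
  exact hζ1 x₀ (Metric.mem_closedBall_self (by positivity))

/-- Instead of a partition of unity, the product of the factors `1 - ζ_x` over a finite cover is
used: it vanishes on `Ω`. The function `u - ∏ (1 - ζ_x) u` is in `H^k` by induction on the number of
factors. -/
theorem hasReg_of_local (hb : Bornology.IsBounded Ω) (hΩ : IsOpen Ω) {k : ℕ} {u : Euc n → 𝕜}
    (h : ∀ x₀ ∈ closure Ω, ∃ ζ : Euc n → ℝ, SmoothBdd ζ ∧ HasReg Ω k (fun x => ζ x • u x) ∧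
      ∀ᶠ x in 𝓝 x₀, ζ x = 1) : HasReg Ω k u := by
  classical
  choose! ζ hζ hr hone using h
  obtain ⟨t, ht, hcov⟩ := hb.isCompact_closure.elim_nhds_subcover (fun x => {y | ζ x y = 1})
    fun x hx => hone x hx
  have key : ∀ s ⊆ t, HasReg Ω k (fun y => u y - (∏ x ∈ s, (1 - ζ x y)) • u y) := by
    intro s
    induction s using Finset.induction_on with
    | empty =>
      intro _
      simpa using HasReg.zero (𝕜 := 𝕜) k
    | insert x s hx ih =>
      intro hs
      have h1 := ih fun y hy => hs (Finset.mem_insert_of_mem hy)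
      have hxc := ht x (hs (Finset.mem_insert_self x s))
      refine (h1.add ((hr x hxc).sub (h1.smul (hζ x hxc)))).congr
        (Eventually.of_forall fun y => ?_)
      simp only [Finset.prod_insert hx]
      module
  refine (key t subset_rfl).congr ?_
  filter_upwards [ae_restrict_mem hΩ.measurableSet] with y hy
  obtain ⟨x, hx, hxy⟩ := Set.mem_iUnion₂.1 (hcov (subset_closure hy))
  have : ∏ x ∈ t, (1 - ζ x y) = 0 := Finset.prod_eq_zero hx (by
    rw [(hxy : ζ x y = 1), sub_self])
  rw [this, zero_smul, sub_zero]

theorem hasReg_dim_two {Ω : Set (Euc 2)} (hΩ : IsOpen Ω) (hb : Bornology.IsBounded Ω)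
    (hs : HasSmoothBoundary Ω) {k : ℕ} {u f : Euc 2 → 𝕜} {g : Fin 2 → Euc 2 → 𝕜}
    (hu : ZeroTrace Ω u g) (hf : WeakDiv Ω g f) (rf : HasReg Ω k f) : HasReg Ω (k + 2) u := by
  induction k with
  | zero =>
    exact hasReg_of_local hb hΩ fun x₀ hx₀ =>
      exists_cutoff_regularity hΩ hs hu hf rf hu.memLp hu.memLp_grad hx₀
  | succ k ih =>
    -- Bootstrap: one order less on `f` already puts `u` and `∇u` in `H^{k+1}`, as the local step at
    -- order `k + 1` requires.
    have ru := ih rf.of_succ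
    exact hasReg_of_local hb hΩ fun x₀ hx₀ =>
      exists_cutoff_regularity hΩ hs hu hf rf ru.of_succ
        (fun l => HasReg.deriv hΩ ru (hu.weakPd l)) hx₀

/-- With a single coordinate, the divergence of the gradient is the second derivative, so `f` itself
is the missing entry. -/
theorem hasReg_dim_one {Ω : Set (Euc 1)} {k : ℕ} {u f : Euc 1 → 𝕜} {g : Fin 1 → Euc 1 → 𝕜}
    (hu : ZeroTrace Ω u g) (hf : WeakDiv Ω g f) (rf : HasReg Ω k f) : HasReg Ω (k + 2) u := by
  refine ⟨hu.memLp, fun i => ⟨g i, hu.weakPd i, hu.memLp_grad i, fun l => ⟨f, ?_, rf⟩⟩⟩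
  refine WeakDiv.congr hf (fun m => Eventually.of_forall fun x => ?_) (ae_eq_refl _)
  change g m x = if m = l then g i x else 0
  rw [if_pos (Subsingleton.elim m l), Subsingleton.elim m i]

/-- Elliptic regularity: if `u ∈ H¹₀(Ω)` and `Δu ∈ H^k(Ω)` then `u ∈ H^{k+2}(Ω)`. -/
theorem hasReg_dirichlet (hn : n = 1 ∨ n = 2) (hΩ : IsOpen Ω) (hb : Bornology.IsBounded Ω)
    (hs : HasSmoothBoundary Ω) {k : ℕ} {u f : Euc n → 𝕜} {g : Fin n → Euc n → 𝕜}
    (hu : ZeroTrace Ω u g) (hf : WeakDiv Ω g f) (rf : HasReg Ω k f) : HasReg Ω (k + 2) u := by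
  rcases hn with rfl | rfl
  · exact hasReg_dim_one hu hf rf
  · exact hasReg_dim_two hΩ hb hs hu hf rf

/-! ## Families of weak derivatives -/

theorem IsTest.pderiv {m : ℕ} {φ : Euc n → ℝ} (h : IsTest Ω φ) (w : Fin m → Fin n) :
    IsTest Ω (pderiv w φ) := by
  induction m with
  | zero => exact h
  | succ m ih =>
    rw [pderiv_succ h.contDiff]
    exact (ih (Fin.tail w)).fderiv_apply _

theorem pderiv_cons {m : ℕ} {φ : Euc n → ℝ} (h : ContDiff ℝ ∞ φ) (i : Fin n)
    (w : Fin m → Fin n) : pderiv (Fin.cons i w : Fin (m + 1) → Fin n) φ = pd i (pderiv w φ) := by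
  rw [pderiv_succ h]
  rfl

theorem pderiv_single {φ : Euc n → ℝ} (h : ContDiff ℝ ∞ φ) (i : Fin n) :
    pderiv (fun _ : Fin 1 => i) φ = pd i φ := by
  rw [pderiv_succ h]
  rfl

theorem isWeakDeriv_single_iff {i : Fin n} {u g : L2 𝕜 Ω} :
    IsWeakDeriv Ω (fun _ : Fin 1 => i) u g ↔ WeakPd Ω i u g := by
  rw [weakPd_iff]
  constructor
  · intro h
    refine ⟨Lp.memLp u, Lp.memLp g, fun ψ hψ => ?_⟩
    have := h ψ hψ
    rwa [pderiv_single hψ.contDiff, pow_one, neg_one_smul] at this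
  · rintro ⟨-, -, h⟩ φ hφ
    rw [pderiv_single hφ.contDiff, pow_one, neg_one_smul]
    exact h φ hφ

/-- The first letter of a word is the outermost derivative on the test function, so it is the one
integrated by parts first. This translates between words and the recursive `HasReg`. -/
theorem isWeakDeriv_cons_iff {m : ℕ} {i : Fin n} {w : Fin m → Fin n} {u v g : L2 𝕜 Ω}
    (hv : WeakPd Ω i u v) :
    IsWeakDeriv Ω (Fin.cons i w : Fin (m + 1) → Fin n) u g ↔ IsWeakDeriv Ω w v g := by
  refine forall₂_congr fun φ hφ => ?_
  rw [pderiv_cons hφ.contDiff, (weakPd_iff.1 hv).2.2 _ (hφ.pderiv w), pow_succ, mul_neg_one,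
    neg_smul, neg_inj]

theorem HasReg.exists_isWeakDeriv {k m : ℕ} (hm : m ≤ k) {u : L2 𝕜 Ω} (h : HasReg Ω k u)
    (w : Fin m → Fin n) : ∃ g : L2 𝕜 Ω, IsWeakDeriv Ω w u g := by
  induction m generalizing k u with
  | zero => exact ⟨u, fun φ _ => by simp [pderiv_zero]⟩
  | succ m ih =>
    obtain ⟨k, rfl⟩ : ∃ k', k = k' + 1 := ⟨k - 1, by omega⟩
    obtain ⟨v, hv, rv⟩ := h.2 (w 0)
    have e := hv.memLp_deriv.coeFn_toLp.symm
    obtain ⟨g, hg⟩ := ih (by omega) (rv.congr e) (Fin.tail w)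
    refine ⟨g, ?_⟩
    rw [← Fin.cons_self_tail w]
    exact (isWeakDeriv_cons_iff (hv.congr (ae_eq_refl _) e)).2 hg

theorem HasReg.of_isWeakDeriv {k : ℕ} {u : L2 𝕜 Ω}
    (h : ∀ m ≤ k, ∀ w : Fin m → Fin n, ∃ g : L2 𝕜 Ω, IsWeakDeriv Ω w u g) : HasReg Ω k u := by
  induction k generalizing u with
  | zero => exact Lp.memLp u
  | succ k ih =>
    refine ⟨Lp.memLp u, fun i => ?_⟩
    obtain ⟨v, hv⟩ := h 1 (by omega) fun _ => i
    rw [isWeakDeriv_single_iff] at hv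
    refine ⟨v, hv, ih fun m hm w => ?_⟩
    obtain ⟨g, hg⟩ := h (m + 1) (by omega) (Fin.cons i w)
    exact ⟨g, (isWeakDeriv_cons_iff hv).1 hg⟩

theorem exists_sobolev (hΩ : IsOpen Ω) {k : ℕ} {u : L2 𝕜 Ω} (h : HasReg Ω k u) :
    ∃ U ∈ Sobolev 𝕜 Ω k, Jet.val U = u := by
  choose g hg using fun w : Word n k =>
    h.exists_isWeakDeriv (Nat.lt_succ_iff.1 w.1.2) w.2
  -- The entry of the empty word was obtained by choice; uniqueness of weak derivatives identifies
  -- it with `u`.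
  have e : g (Word.nil n k) = u := by
    refine eq_of_isWeakDeriv hΩ (hg (Word.nil n k)) fun φ _ => ?_
    simp [Word.nil, pderiv_zero]
  refine ⟨WithLp.toLp 2 g, fun w => ?_, e⟩
  change IsWeakDeriv Ω w.2 (g (Word.nil n k)) (g w)
  rw [e]
  exact hg w

theorem hasReg_val {k : ℕ} {U : Jet 𝕜 Ω k} (hU : U ∈ Sobolev 𝕜 Ω k) : HasReg Ω k (Jet.val U) :=
  HasReg.of_isWeakDeriv fun m hm w => ⟨U ⟨⟨m, by omega⟩, w⟩, hU ⟨⟨m, by omega⟩, w⟩⟩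

theorem weakPd_partial {k : ℕ} (hk : 1 ≤ k) {U : Jet 𝕜 Ω k} (hU : U ∈ Sobolev 𝕜 Ω k) (i : Fin n) :
    WeakPd Ω i (Jet.val U) (Jet.partial hk i U) :=
  isWeakDeriv_single_iff.1 (hU (Word.one hk i))

theorem weakPd_partial_two {k : ℕ} (hk : 2 ≤ k) {U : Jet 𝕜 Ω k} (hU : U ∈ Sobolev 𝕜 Ω k)
    (i : Fin n) : WeakPd Ω i (Jet.partial (by omega) i U) (U (Word.two hk i)) := by
  refine isWeakDeriv_single_iff.1
    ((isWeakDeriv_cons_iff (weakPd_partial (by omega) hU i)).1 ?_)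
  have h := hU (Word.two hk i)
  have e : (Fin.cons i (fun _ : Fin 1 => i) : Fin 2 → Fin n) = fun _ => i := by
    funext a
    refine Fin.cases ?_ (fun _ => ?_) a <;> simp
  rw [e]
  exact h

theorem weakDiv_laplacian {k : ℕ} (hk : 2 ≤ k) {U : Jet 𝕜 Ω k} (hU : U ∈ Sobolev 𝕜 Ω k) :
    WeakDiv Ω (fun i => Jet.partial (by omega) i U) (Jet.laplacian hk U) := by
  refine (WeakDiv.of_weakPd (weakPd_partial_two hk hU)).congr (fun _ => ae_eq_refl _) ?_
  have e : Jet.laplacian hk U = ∑ i, U (Word.two hk i) := rfl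
  rw [e]
  filter_upwards [Lp.coeFn_finsetSum Finset.univ (fun i => U (Word.two hk i))] with x hx
  rw [hx, Finset.sum_apply]

/-! ## The space `H²_o` and the Dirichlet Laplacian -/

namespace H2o

theorem weakPd (U : H2o 𝕜 Ω) (i : Fin n) : WeakPd Ω i (H2o.toL2 U) (H2o.partial i U) :=
  weakPd_partial (by norm_num) U.2.1 i

theorem weakDiv (U : H2o 𝕜 Ω) : WeakDiv Ω (fun i => H2o.partial i U) (H2o.laplacian U) :=
  weakDiv_laplacian le_rfl U.2.1

theorem hasReg (U : H2o 𝕜 Ω) : HasReg Ω 2 (H2o.toL2 U) := hasReg_val U.2.1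

/-- Membership in `H¹₀` records only the function and provides some limiting gradient. By uniqueness
of weak derivatives that gradient is the one stored in the jet. -/
theorem mem_closure_testGraph_iff (hΩ : IsOpen Ω) {U : Jet 𝕜 Ω 2} (hU : U ∈ Sobolev 𝕜 Ω 2) :
    U ∈ H2o 𝕜 Ω ↔ ((Jet.val U, fun i => Jet.partial (by norm_num) i U) :
      L2 𝕜 Ω × (Fin n → L2 𝕜 Ω)) ∈ (testGraph 𝕜 Ω).topologicalClosure := by
  constructor
  · rintro ⟨-, q, hq, hq1⟩
    have hz : ZeroTrace Ω q.1 (fun i => q.2 i) := ⟨q, hq, ae_eq_refl _, fun _ => ae_eq_refl _⟩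
    change q.1 = Jet.val U at hq1
    have e : q = (Jet.val U, fun i => Jet.partial (by norm_num) i U) := by
      refine Prod.ext hq1 (funext fun i => Lp.ext ?_)
      have := hz.weakPd i
      rw [hq1] at this
      exact this.unique hΩ (weakPd_partial (by norm_num) hU i)
    rwa [← e]
  · intro h
    exact ⟨hU, _, h, rfl⟩

/-- The pair `(u, ∇u)`. -/
theorem mem_closure (hΩ : IsOpen Ω) (U : H2o 𝕜 Ω) :
    ((H2o.toL2 U, fun i => H2o.partial i U) : L2 𝕜 Ω × (Fin n → L2 𝕜 Ω)) ∈
      (testGraph 𝕜 Ω).topologicalClosure :=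
  (mem_closure_testGraph_iff hΩ U.2.1).1 U.2

theorem zeroTrace (hΩ : IsOpen Ω) (U : H2o 𝕜 Ω) :
    ZeroTrace Ω (H2o.toL2 U) (fun i => H2o.partial i U) :=
  ⟨_, mem_closure hΩ U, ae_eq_refl _, fun _ => ae_eq_refl _⟩

/-- Green's formula, using the trace of `U` only. Since both arguments range over `H²_o`, the
conjugate version also holds, and together they give the symmetry of `Δ`. -/
theorem sum_inner_partial (hΩ : IsOpen Ω) (U V : H2o 𝕜 Ω) :
    ∑ i, inner 𝕜 (H2o.partial i U) (H2o.partial i V) =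
      -inner 𝕜 (H2o.toL2 U) (H2o.laplacian V) :=
  (weakDiv V).inner_eq (mem_closure hΩ U)

theorem sum_inner_partial' (hΩ : IsOpen Ω) (U V : H2o 𝕜 Ω) :
    ∑ i, inner 𝕜 (H2o.partial i U) (H2o.partial i V) =
      -inner 𝕜 (H2o.laplacian U) (H2o.toL2 V) := by
  have h := congrArg (starRingEnd 𝕜) (sum_inner_partial hΩ V U)
  simpa only [map_sum, map_neg, inner_conj_symm] using h

theorem inner_laplacian (hΩ : IsOpen Ω) (U V : H2o 𝕜 Ω) :
    inner 𝕜 (H2o.laplacian U) (H2o.toL2 V) = inner 𝕜 (H2o.toL2 U) (H2o.laplacian V) :=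
  neg_injective ((sum_inner_partial' hΩ U V).symm.trans (sum_inner_partial hΩ U V))

/-- Moving the first order term onto `ΔV` leaves a single pairing with `ΔV`, the form in which the
duality argument for the domain is run. -/
theorem energyForm_eq (hΩ : IsOpen Ω) (U V : H2o 𝕜 Ω) :
    energyForm U V = inner 𝕜 (H2o.laplacian V) (H2o.laplacian U - H2o.toL2 U) := by
  rw [energyForm, sum_inner_partial' hΩ, inner_sub_right]
  ring

theorem exists_of_hasReg (hΩ : IsOpen Ω) {u : L2 𝕜 Ω} (h : HasReg Ω 2 u) (h0 : u ∈ H10 𝕜 Ω) :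
    ∃ U : H2o 𝕜 Ω, H2o.toL2 U = u := by
  obtain ⟨U, hU, rfl⟩ := exists_sobolev hΩ h
  exact ⟨⟨U, hU, h0⟩, rfl⟩

theorem toL2_mem (U : H2o 𝕜 Ω) : H2o.toL2 U ∈ H10 𝕜 Ω := U.2.2

end H2o

/-! ### Closedness of the Sobolev spaces, and weak solvability of the Dirichlet problem. -/

theorem isClosed_sobolev (k : ℕ) : IsClosed (Sobolev 𝕜 Ω k : Set (Jet 𝕜 Ω k)) := by
  have e : (Sobolev 𝕜 Ω k : Set (Jet 𝕜 Ω k)) = ⋂ w : Word n k, ⋂ φ : Euc n → ℝ, ⋂ _ : IsTest Ω φ,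
      {U | ∫ x in Ω, pderiv w.2 φ x • U (Word.nil n k) x =
        (-1 : ℝ) ^ w.1.1 • ∫ x in Ω, φ x • U w x} := by
    ext U
    simp only [Set.mem_iInter]
    exact Iff.rfl
  rw [e]
  refine isClosed_iInter fun w => isClosed_iInter fun φ => isClosed_iInter fun hφ => ?_
  obtain ⟨η, hη⟩ := exists_inner_eq_integral (𝕜 := 𝕜) hφ
  obtain ⟨η', hη'⟩ := exists_inner_eq_integral (𝕜 := 𝕜) (hφ.pderiv w.2)
  simp only [← hη, ← hη']
  exact isClosed_eq (continuous_const.inner (PiLp.continuous_apply 2 _ _))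
    ((continuous_const.inner (PiLp.continuous_apply 2 _ _)).const_smul _)

theorem isClosed_H2o (hΩ : IsOpen Ω) : IsClosed (H2o 𝕜 Ω : Set (Jet 𝕜 Ω 2)) := by
  have e : (H2o 𝕜 Ω : Set (Jet 𝕜 Ω 2)) = (Sobolev 𝕜 Ω 2 : Set (Jet 𝕜 Ω 2)) ∩
      (fun U : Jet 𝕜 Ω 2 => ((Jet.val U, fun i => Jet.partial (by norm_num) i U) :
        L2 𝕜 Ω × (Fin n → L2 𝕜 Ω))) ⁻¹' (testGraph 𝕜 Ω).topologicalClosure := by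
    ext U
    constructor
    · intro hU
      exact ⟨hU.1, (H2o.mem_closure_testGraph_iff hΩ hU.1).1 hU⟩
    · rintro ⟨h1, h2⟩
      exact (H2o.mem_closure_testGraph_iff hΩ h1).2 h2
  rw [e]
  refine (isClosed_sobolev 2).inter ((Submodule.isClosed_topologicalClosure _).preimage ?_)
  exact (PiLp.continuous_apply 2 _ _).prodMk (continuous_pi fun i => PiLp.continuous_apply 2 _ _)

/-- Existence of weak solutions of `u - Δu = f` with vanishing trace. -/
theorem exists_weak_solution (f : L2 𝕜 Ω) :
    ∃ p ∈ (testGraph 𝕜 Ω).topologicalClosure, WeakDiv Ω (fun i => p.2 i) (p.1 - f : L2 𝕜 Ω) := by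
  let e := hilbertEquiv 𝕜 n (L2 𝕜 Ω)
  let K : Submodule 𝕜 (WithLp 2 (L2 𝕜 Ω × PiLp 2 (fun _ : Fin n => L2 𝕜 Ω))) :=
    (testGraph 𝕜 Ω).topologicalClosure.comap e.toLinearEquiv.toLinearMap
  have hK : IsClosed (K : Set (WithLp 2 (L2 𝕜 Ω × PiLp 2 (fun _ : Fin n => L2 𝕜 Ω)))) :=
    (Submodule.isClosed_topologicalClosure _).preimage e.continuous
  have : CompleteSpace K := hK.completeSpace_coe
  -- The bilinear form of `u - Δu` is the inner product of pairs `(u, ∇u)`. Projecting `(f, 0)` onto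
  -- the closed graph of the gradient on `H¹₀` therefore solves the weak equation.
  set v : WithLp 2 (L2 𝕜 Ω × PiLp 2 (fun _ : Fin n => L2 𝕜 Ω)) := WithLp.toLp 2 (f, 0) with hv
  have hpK : K.starProjection v ∈ K := K.starProjection_apply_mem v
  set p := K.starProjection v with hp
  refine ⟨e p, hpK, fun i => Lp.memLp _, Lp.memLp _, fun ψ hψ => ?_⟩
  have hof : ContDiff ℝ ∞ (fun r : ℝ => (r : 𝕜)) :=
    ContinuousLinearMap.contDiff (RCLike.ofRealCLM (K := 𝕜))
  have hψ' : IsTest Ω (fun x => (ψ x : 𝕜)) :=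
    ⟨hof.comp hψ.contDiff, hψ.hasCompactSupport.comp_left (g := fun r : ℝ => (r : 𝕜)) (by simp),
      (tsupport_comp_subset (g := fun r : ℝ => (r : 𝕜)) (by simp) ψ).trans hψ.tsupport_subset⟩
  obtain ⟨q, hq⟩ := e.surjective (hψ'.memLp.toLp _, fun i => (hψ'.pd i).memLp.toLp _)
  have hqK : q ∈ K := by
    change e q ∈ (testGraph 𝕜 Ω).topologicalClosure
    rw [hq]
    exact Submodule.le_topologicalClosure _ hψ'.mem_testGraph
  -- Orthogonality of the residual to `(ψ, ∇ψ)` is the weak equation tested with `ψ`.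
  have h0 := (Submodule.mem_orthogonal K _).1 (K.sub_starProjection_mem_orthogonal v) q hqK
  rw [← hp, inner_sub_right, sub_eq_zero] at h0
  simp only [WithLp.prod_inner_apply, PiLp.inner_apply] at h0
  have hq1 : q.fst = hψ'.memLp.toLp _ := congrArg Prod.fst hq
  have hq2 : ∀ i, q.snd i = (hψ'.pd i).memLp.toLp _ := fun i =>
    congrFun (congrArg Prod.snd hq) i
  have hp1 : (e p).1 = p.fst := rfl
  have hp2 : ∀ i, (e p).2 i = p.snd i := fun i => rfl
  have hre : ∀ (η : Euc n → ℝ) (u : L2 𝕜 Ω) (a : L2 𝕜 Ω),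
      a =ᵐ[volume.restrict Ω] (fun x => (η x : 𝕜)) → inner 𝕜 a u = ∫ x in Ω, η x • u x := by
    intro η u a ha
    rw [L2.inner_def]
    refine integral_congr_ae (ha.mono fun x hx => ?_)
    simp only [hx]
    rw [RCLike.inner_apply, RCLike.conj_ofReal, RCLike.real_smul_eq_coe_mul, mul_comm]
  have a1 := fun u : L2 𝕜 Ω => hre ψ u q.fst (by rw [hq1]; exact hψ'.memLp.coeFn_toLp)
  have a2 := fun (i : Fin n) (u : L2 𝕜 Ω) => hre (pd i ψ) u (q.snd i) (by
    rw [hq2]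
    refine (hψ'.pd i).memLp.coeFn_toLp.trans (Eventually.of_forall fun x => ?_)
    exact pd_clm_comp (RCLike.ofRealCLM (K := 𝕜)) hψ.contDiff i x)
  rw [← a1, Finset.sum_congr rfl fun i _ => (a2 i _).symm, inner_sub_right]
  have b1 : inner 𝕜 q.fst v.fst + ∑ i, inner 𝕜 (q.snd i) (v.snd i) = inner 𝕜 q.fst f := by
    simp [hv]
  have h0' : inner 𝕜 q.fst v.fst + ∑ i, inner 𝕜 (q.snd i) (v.snd i) =
    inner 𝕜 q.fst p.fst + ∑ i, inner 𝕜 (q.snd i) (p.snd i) := h0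
  rw [b1] at h0'
  rw [hp1, h0']
  simp only [hp2]
  ring

/-- The operator `1 - Δ` maps `H²_o(Ω)` onto `L²(Ω)`. -/
theorem H2o.exists_sub_laplacian_eq (hn : n = 1 ∨ n = 2) (hΩ : IsOpen Ω)
    (hb : Bornology.IsBounded Ω) (hs : HasSmoothBoundary Ω) (f : L2 𝕜 Ω) :
    ∃ U : H2o 𝕜 Ω, H2o.toL2 U - H2o.laplacian U = f := by
  obtain ⟨p, hp, hdiv⟩ := exists_weak_solution f
  have hz : ZeroTrace Ω p.1 (fun i => p.2 i) := ⟨p, hp, ae_eq_refl _, fun _ => ae_eq_refl _⟩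
  have hr : HasReg Ω 2 p.1 := hasReg_dirichlet hn hΩ hb hs (k := 0) hz hdiv (Lp.memLp _)
  obtain ⟨U, hU⟩ := H2o.exists_of_hasReg hΩ hr ⟨p, hp, rfl⟩
  refine ⟨U, ?_⟩
  have e : H2o.laplacian U = p.1 - f := by
    refine Lp.ext ((H2o.weakDiv U).unique hΩ (hdiv.congr (fun i => ?_) (ae_eq_refl _)))
    have := H2o.weakPd U i
    rw [hU] at this
    exact (hz.weakPd i).unique hΩ this
  rw [e, hU]
  abel

/-! ## The domain of the pinned plate operator -/

theorem laplacian_eq_of_val_eq (hΩ : IsOpen Ω) {k : ℕ} (hk : 2 ≤ k) {U : Jet 𝕜 Ω k}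
    (hU : U ∈ Sobolev 𝕜 Ω k) (V : H2o 𝕜 Ω) (h : Jet.val U = H2o.toL2 V) :
    Jet.laplacian hk U = H2o.laplacian V := by
  refine Lp.ext ((weakDiv_laplacian hk hU).unique hΩ
    ((H2o.weakDiv V).congr (fun i => ?_) (ae_eq_refl _)))
  have h1 := weakPd_partial (by omega) hU i
  rw [h] at h1
  exact (H2o.weakPd V i).unique hΩ h1

theorem hasReg_laplacian (hΩ : IsOpen Ω) {k : ℕ} {U : Jet 𝕜 Ω (k + 2)}
    (hU : U ∈ Sobolev 𝕜 Ω (k + 2)) : HasReg Ω k (Jet.laplacian (by omega) U) := by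
  have h : ∀ i, HasReg Ω k (U (Word.two (by omega) i)) := fun i =>
    ((hasReg_val hU).deriv hΩ (weakPd_partial (by omega) hU i)).deriv hΩ
      (weakPd_partial_two (by omega) hU i)
  refine (HasReg.sum Finset.univ h).congr ?_
  have e : Jet.laplacian (by omega) U = ∑ i, U (Word.two (by omega) i) := rfl
  rw [e]
  filter_upwards [Lp.coeFn_finsetSum Finset.univ (fun i => U (Word.two (by omega) i))] with x hx
  rw [hx, Finset.sum_apply]

/-- The plate operator factors as `ΔW - Δ(ΔW)` with `ΔW ∈ H²_o`. The point is that `ΔW`, a priori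
only in `L²`, inherits regularity and the boundary condition by duality. -/
theorem mem_plateGraph_iff (hΩ : IsOpen Ω)
    (hB : ∀ f : L2 𝕜 Ω, ∃ U : H2o 𝕜 Ω, H2o.toL2 U - H2o.laplacian U = f)
    {W : H2o 𝕜 Ω} {z : L2 𝕜 Ω} : (W, z) ∈ plateGraph 𝕜 Ω ↔
      ∃ L : H2o 𝕜 Ω, H2o.toL2 L = H2o.laplacian W ∧ z = H2o.laplacian W - H2o.laplacian L := by
  constructor
  · rintro ⟨f, hf, hψ⟩
    obtain ⟨G, hG⟩ := hB (H2o.laplacian W - H2o.toL2 W - f)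
    -- The candidate `G` solves `G - ΔG = ΔW - W - f`. By symmetry `ΔW - W - G` is orthogonal to
    -- every `ψ - Δψ`; choosing `ψ` so that `ψ - Δψ` equals this difference shows that it vanishes.
    have key : H2o.laplacian W - H2o.toL2 W = H2o.toL2 G := by
      rw [← sub_eq_zero]
      obtain ⟨ψ, hψ'⟩ := hB (H2o.laplacian W - H2o.toL2 W - H2o.toL2 G)
      rw [← inner_self_eq_zero (𝕜 := 𝕜)]
      nth_rewrite 1 [← hψ']
      have e1 := hψ ψ
      simp only [H2o.energyForm_eq hΩ] at e1
      have e2 := congrArg (inner 𝕜 (H2o.toL2 ψ)) hG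
      rw [inner_sub_right, ← H2o.inner_laplacian hΩ, inner_sub_right _ _ f, ← e1] at e2
      rw [inner_sub_left, inner_sub_right, inner_sub_right (H2o.laplacian ψ)]
      linear_combination -e2
    refine ⟨W + G, by rw [map_add, ← key]; abel, ?_⟩
    rw [key] at hG
    have e3 : f = H2o.laplacian G := (sub_right_injective hG).symm
    change z = -f at hf
    rw [hf, e3, map_add]
    abel
  · rintro ⟨L, hL, rfl⟩
    refine ⟨H2o.laplacian (L - W), by rw [map_sub, neg_sub], fun ψ => ?_⟩
    rw [H2o.energyForm_eq hΩ, ← H2o.inner_laplacian hΩ, map_sub, hL]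

theorem exists_mem_plateGraph_iff (hn : n = 1 ∨ n = 2) (hΩ : IsOpen Ω)
    (hb : Bornology.IsBounded Ω) (hs : HasSmoothBoundary Ω) {W : H2o 𝕜 Ω} :
    (∃ z, (W, z) ∈ plateGraph 𝕜 Ω) ↔ ∃ w ∈ H4o 𝕜 Ω, Jet.val w = H2o.toL2 W := by
  have hB := H2o.exists_sub_laplacian_eq (𝕜 := 𝕜) hn hΩ hb hs
  simp only [mem_plateGraph_iff hΩ hB]
  constructor
  · rintro ⟨-, L, hL, -⟩
    have hr : HasReg Ω 2 (H2o.laplacian W) := by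
      rw [← hL]
      exact H2o.hasReg L
    obtain ⟨w, hw, hwW⟩ := exists_sobolev hΩ
      (hasReg_dirichlet hn hΩ hb hs (H2o.zeroTrace hΩ W) (H2o.weakDiv W) hr)
    refine ⟨w, ⟨⟨hw, ?_⟩, ?_⟩, hwW⟩
    · change Jet.val w ∈ H10 𝕜 Ω
      rw [hwW]
      exact H2o.toL2_mem W
    · change Jet.laplacian _ w ∈ H10 𝕜 Ω
      rw [laplacian_eq_of_val_eq hΩ _ hw W hwW, ← hL]
      exact H2o.toL2_mem L
  · rintro ⟨w, ⟨⟨hw, -⟩, hw0⟩, hwW⟩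
    obtain ⟨L, hL⟩ := H2o.exists_of_hasReg hΩ (hasReg_laplacian hΩ hw) hw0
    rw [laplacian_eq_of_val_eq hΩ _ hw W hwW] at hL
    exact ⟨_, L, hL, rfl⟩

theorem mem_domain_waveOp_iff (hn : n = 1 ∨ n = 2) (hΩ : IsOpen Ω) (hb : Bornology.IsBounded Ω)
    (hs : HasSmoothBoundary Ω) (x : StateSpace 𝕜 Ω) : x ∈ (waveOp 𝕜 Ω).domain ↔
      (∃ v ∈ H2o 𝕜 Ω, Jet.val v = x.fst) ∧ ∃ w ∈ H4o 𝕜 Ω, Jet.val w = H2o.toL2 x.snd := by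
  rw [← exists_mem_plateGraph_iff hn hΩ hb hs, LinearPMap.mem_domain_iff, waveOp_graph hΩ,
    ← plateOp_graph hΩ]
  constructor
  · rintro ⟨y, h1, h2⟩
    exact ⟨⟨y.snd, y.snd.2, h1.symm⟩, y.fst, h2⟩
  · rintro ⟨⟨v, hv, h1⟩, z, h2⟩
    exact ⟨WithLp.toLp 2 (z, ⟨v, hv⟩), h1.symm, h2⟩

/-! ## Equivalence of norms on `H²_o` -/

namespace H2o

variable (𝕜 Ω) in
/-- The inclusion `H²_o(Ω) → L²(Ω)` as a bounded operator. -/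
def toL2CLM : H2o 𝕜 Ω →L[𝕜] L2 𝕜 Ω :=
  ⟨H2o.toL2, (PiLp.continuous_apply 2 _ _).comp continuous_subtype_val⟩

variable (𝕜 Ω) in
/-- The Laplacian `H²_o(Ω) → L²(Ω)` as a bounded operator. -/
def laplacianCLM : H2o 𝕜 Ω →L[𝕜] L2 𝕜 Ω :=
  ⟨H2o.laplacian, continuous_finsetSum Finset.univ fun i _ =>
    (PiLp.continuous_apply 2 _ (Word.two le_rfl i)).comp continuous_subtype_val⟩

variable (𝕜 Ω) in
/-- The partial derivative `H²_o(Ω) → L²(Ω)` as a bounded operator. -/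
def partialCLM (i : Fin n) : H2o 𝕜 Ω →L[𝕜] L2 𝕜 Ω :=
  ⟨H2o.partial i, (PiLp.continuous_apply 2 _ _).comp continuous_subtype_val⟩

theorem sub_laplacian_injective (hΩ : IsOpen Ω) {U : H2o 𝕜 Ω}
    (h : H2o.toL2 U - H2o.laplacian U = 0) : U = 0 := by
  have e1 := sum_inner_partial hΩ U U
  rw [← sub_eq_zero.1 h] at e1
  have e2 := congrArg RCLike.re e1
  simp only [map_sum, map_neg, inner_self_eq_norm_sq] at e2
  have e3 : 0 ≤ ∑ i, ‖H2o.partial i U‖ ^ 2 := Finset.sum_nonneg fun _ _ => by positivity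
  have e4 : ‖H2o.toL2 U‖ ^ 2 = 0 := le_antisymm (by linarith) (by positivity)
  refine toL2_injective hΩ ?_
  rw [map_zero]
  exact norm_eq_zero.1 (pow_eq_zero_iff (two_ne_zero)|>.1 e4)

theorem completeSpace (hΩ : IsOpen Ω) : CompleteSpace (H2o 𝕜 Ω) :=
  (isClosed_H2o hΩ).completeSpace_coe

/-- The bounded operator `1 - Δ` is a bijection between Banach spaces, so its inverse is bounded by
the open mapping theorem. -/
theorem exists_norm_le (hΩ : IsOpen Ω)
    (hB : ∀ f : L2 𝕜 Ω, ∃ U : H2o 𝕜 Ω, H2o.toL2 U - H2o.laplacian U = f) :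
    ∃ C : ℝ, 0 < C ∧ ∀ U : H2o 𝕜 Ω, ‖U‖ ≤ C * (‖H2o.toL2 U‖ + ‖H2o.laplacian U‖) := by
  have := completeSpace (𝕜 := 𝕜) hΩ
  let B : H2o 𝕜 Ω →L[𝕜] L2 𝕜 Ω := toL2CLM 𝕜 Ω - laplacianCLM 𝕜 Ω
  have hker : B.ker = ⊥ := by
    refine LinearMap.ker_eq_bot'.2 fun U hU => sub_laplacian_injective hΩ hU
  have hran : B.range = ⊤ := LinearMap.range_eq_top.2 hB
  let e := ContinuousLinearEquiv.ofBijective B hker hran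
  refine ⟨‖(e.symm : L2 𝕜 Ω →L[𝕜] H2o 𝕜 Ω)‖ + 1, by positivity, fun U => ?_⟩
  have h1 : e.symm (B U) = U := e.symm_apply_apply U
  have h2 := (e.symm : L2 𝕜 Ω →L[𝕜] H2o 𝕜 Ω).le_opNorm (B U)
  have h3 : ‖B U‖ ≤ ‖H2o.toL2 U‖ + ‖H2o.laplacian U‖ := norm_sub_le _ _
  rw [ContinuousLinearEquiv.coe_coe, h1] at h2
  refine h2.trans (mul_le_mul ?_ h3 (norm_nonneg _) (by positivity))
  linarith

end H2o

/-! ## Exponentials of bounded operators -/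

variable {X : Type*} [NormedAddCommGroup X] [NormedSpace 𝕜 X]

/-- Exponentials are differentiated in a variable of `𝕜`; the mean value inequality is applied on
the image of `[0, t]`, a convex subset of `𝕜`. -/
theorem norm_sub_le_of_hasDerivAt {f f' : 𝕜 → X} {t C : ℝ} (ht : 0 ≤ t)
    (hf : ∀ z, HasDerivAt f (f' z) z) (hC : ∀ s : ℝ, 0 ≤ s → s ≤ t → ‖f' (s : 𝕜)‖ ≤ C) :
    ‖f (t : 𝕜) - f 0‖ ≤ C * t := by
  have hconv : Convex ℝ ((fun s : ℝ => (s : 𝕜)) '' Set.Icc 0 t) :=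
    (convex_Icc 0 t).linear_image (RCLike.ofRealCLM (K := 𝕜)).toLinearMap
  have h := hconv.norm_image_sub_le_of_norm_hasDerivWithin_le (C := C) (x := 0) (y := (t : 𝕜))
    (fun z _ => (hf z).hasDerivWithinAt) (by rintro _ ⟨s, hs, rfl⟩; exact hC s hs.1 hs.2)
    ⟨0, ⟨le_rfl, ht⟩, by simp⟩ ⟨t, ⟨ht, le_rfl⟩, rfl⟩
  rwa [sub_zero, RCLike.norm_ofReal, abs_of_nonneg ht] at h

/-- The exponential of `t • A`. -/
def expOp (A : X →L[𝕜] X) (t : ℝ) : X →L[𝕜] X := NormedSpace.exp ((t : 𝕜) • A)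

theorem expOp_zero (A : X →L[𝕜] X) : expOp A 0 = 1 := by
  simp [expOp, NormedSpace.exp_zero]

section Complete

variable [CompleteSpace X]

theorem exp_add_of_commute_clm {S T : X →L[𝕜] X} (h : Commute S T) :
    NormedSpace.exp (S + T) = NormedSpace.exp S * NormedSpace.exp T :=
  NormedSpace.exp_add_of_commute_of_mem_ball (𝕂 := 𝕜) h
    ((NormedSpace.expSeries_radius_eq_top 𝕜 (X →L[𝕜] X)).symm ▸ edist_lt_top _ _)
    ((NormedSpace.expSeries_radius_eq_top 𝕜 (X →L[𝕜] X)).symm ▸ edist_lt_top _ _)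

theorem expOp_add (A : X →L[𝕜] X) (s t : ℝ) : expOp A (s + t) = expOp A s * expOp A t := by
  rw [expOp, RCLike.ofReal_add, add_smul]
  exact exp_add_of_commute_clm (((Commute.refl A).smul_left _).smul_right _)

/-- The exponential splits as `e^{-ta} exp(taS)`. Power boundedness of `S` bounds the series of the
second factor by `M e^{ta}`, and the exponentials cancel. -/
theorem norm_expOp_smul_sub_one_le {S : X →L[𝕜] X} {M a t : ℝ} (ha : 0 ≤ a) (ht : 0 ≤ t)
    (hS : ∀ m, ‖S ^ m‖ ≤ M) : ‖expOp ((a : 𝕜) • (S - 1)) t‖ ≤ M := by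
  have hM : 0 ≤ M := (norm_nonneg _).trans (hS 0)
  obtain ⟨c, hc, hc0⟩ : ∃ c : ℝ, c = t * a ∧ 0 ≤ c := ⟨_, rfl, mul_nonneg ht ha⟩
  have e : (t : 𝕜) • (a : 𝕜) • (S - 1) = (c : 𝕜) • S + algebraMap 𝕜 (X →L[𝕜] X) ((-c : ℝ) : 𝕜) := by
    rw [Algebra.algebraMap_eq_smul_one, smul_smul, hc]
    push_cast
    module
  rw [expOp, e, exp_add_of_commute_clm (Algebra.commute_algebraMap_right _ _),
    ← NormedSpace.algebraMap_exp_comm, Algebra.algebraMap_eq_smul_one, mul_smul_one, norm_smul]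
  have h1 : ‖NormedSpace.exp ((-c : ℝ) : 𝕜)‖ = Real.exp (-c) := by
    have := NormedSpace.algebraMap_exp_comm (𝕂 := ℝ) (𝔸 := 𝕜) (-c)
    rw [← Real.exp_eq_exp_ℝ] at this
    refine (congrArg norm this).symm.trans ?_
    exact (RCLike.norm_ofReal _).trans (abs_of_pos (Real.exp_pos _))
  have h2 : ‖NormedSpace.exp ((c : 𝕜) • S)‖ ≤ Real.exp c * M := by
    have hs := NormedSpace.exp_series_hasSum_exp' (𝕂 := 𝕜) ((c : 𝕜) • S)
    have hr := NormedSpace.exp_series_hasSum_exp' (𝕂 := ℝ) c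
    rw [← Real.exp_eq_exp_ℝ] at hr
    rw [← hs.tsum_eq]
    refine tsum_of_norm_bounded (hr.mul_right M) fun m => ?_
    rw [smul_pow, norm_smul, norm_smul, norm_inv, norm_pow, RCLike.norm_ofReal, abs_of_nonneg hc0,
      RCLike.norm_natCast, smul_eq_mul, mul_assoc]
    have := hS m
    gcongr
  rw [h1]
  calc Real.exp (-c) * ‖NormedSpace.exp ((c : 𝕜) • S)‖ ≤ Real.exp (-c) * (Real.exp c * M) := by
        gcongr
    _ = M := by rw [← mul_assoc, ← Real.exp_add]; simp

theorem norm_expOp_sub_le {A : X →L[𝕜] X} {C t : ℝ} (ht : 0 ≤ t)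
    {x : X} (h : ∀ s, 0 ≤ s → s ≤ t → ‖expOp A s (A x)‖ ≤ C) : ‖expOp A t x - x‖ ≤ C * t := by
  have hd : ∀ z : 𝕜, HasDerivAt (fun z : 𝕜 => NormedSpace.exp (z • A) x)
      (NormedSpace.exp (z • A) (A x)) z := fun z => by
    simpa using (hasDerivAt_exp_smul_const A z).clm_apply (hasDerivAt_const z x)
  have := norm_sub_le_of_hasDerivAt ht hd h
  simpa [expOp] using this

theorem norm_expOp_sub_sub_le {A : X →L[𝕜] X} {C t : ℝ} (ht : 0 ≤ t) {x : X}
    (h : ∀ s, 0 ≤ s → s ≤ t → ‖expOp A s (A x) - A x‖ ≤ C) :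
    ‖expOp A t x - x - (t : 𝕜) • A x‖ ≤ C * t := by
  have hd : ∀ z : 𝕜, HasDerivAt (fun z : 𝕜 => NormedSpace.exp (z • A) x - z • A x)
      (NormedSpace.exp (z • A) (A x) - A x) z := fun z => by
    have h1 : HasDerivAt (fun z : 𝕜 => NormedSpace.exp (z • A) x)
        (NormedSpace.exp (z • A) (A x)) z := by
      simpa using (hasDerivAt_exp_smul_const A z).clm_apply (hasDerivAt_const z x)
    simpa [Pi.sub_def] using h1.sub ((hasDerivAt_id z).smul_const (A x))
  have := norm_sub_le_of_hasDerivAt ht hd h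
  simpa [expOp, sub_right_comm] using this

/-- The path `s ↦ e^{sA} e^{(t-s)B} x` joins the two sides; because `A` and `B` commute, its
derivative is `e^{sA} e^{(t-s)B} (Ax - Bx)`. -/
theorem norm_expOp_sub_expOp_le {A B : X →L[𝕜] X} (hAB : Commute A B) {M t : ℝ} (ht : 0 ≤ t)
    (hA : ∀ s, 0 ≤ s → ‖expOp A s‖ ≤ M) (hB : ∀ s, 0 ≤ s → ‖expOp B s‖ ≤ M) (x : X) :
    ‖expOp A t x - expOp B t x‖ ≤ M * (M * ‖A x - B x‖) * t := by
  have hM : 0 ≤ M := (norm_nonneg _).trans (hA 0 le_rfl)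
  have hd : ∀ z : 𝕜, HasDerivAt
      (fun z : 𝕜 => (NormedSpace.exp (z • A) * NormedSpace.exp (((t : 𝕜) - z) • B)) x)
      (NormedSpace.exp (z • A) (NormedSpace.exp (((t : 𝕜) - z) • B) (A x - B x))) z := fun z => by
    have h1 := (hasDerivAt_exp_smul_const A z).mul
      ((hasDerivAt_exp_smul_const B ((t : 𝕜) - z)).comp_const_sub (t : 𝕜) z)
    have h2 := h1.clm_apply (hasDerivAt_const z x)
    have hc : Commute A (NormedSpace.exp (((t : 𝕜) - z) • B)) := (hAB.smul_right _).exp_right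
    rw [mul_assoc _ A, hc.eq] at h2
    simpa [sub_eq_add_neg] using h2
  have := norm_sub_le_of_hasDerivAt (C := M * (M * ‖A x - B x‖)) ht hd fun s hs hst => by
    have e : ((t : 𝕜) - (s : 𝕜)) = ((t - s : ℝ) : 𝕜) := by push_cast; ring
    rw [e]
    refine ((expOp A s).le_opNorm _).trans (mul_le_mul (hA s hs) ?_ (norm_nonneg _) hM)
    exact ((expOp B (t - s)).le_opNorm _).trans
      (mul_le_mul_of_nonneg_right (hB _ (by linarith)) (norm_nonneg _))
  simpa [expOp] using this

end Complete

/-! ## Convergence of exponentials of bounded operators to a semigroup -/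

section Approximation

variable {X : Type*} [NormedAddCommGroup X] [NormedSpace 𝕜 X]

theorem norm_apply_sub_le {S T : X →L[𝕜] X} {M : ℝ} (hS : ‖S‖ ≤ M) (hT : ‖T‖ ≤ M) (x y : X) :
    ‖S x - T x‖ ≤ ‖S y - T y‖ + 2 * M * ‖x - y‖ := by
  have e : S x - T x = (S y - T y) + (S (x - y) - T (x - y)) := by
    simp only [map_sub]
    abel
  have h1 := (S.le_opNorm (x - y)).trans (mul_le_mul_of_nonneg_right hS (norm_nonneg _))
  have h2 := (T.le_opNorm (x - y)).trans (mul_le_mul_of_nonneg_right hT (norm_nonneg _))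
  have h3 := norm_add_le (S y - T y) (S (x - y) - T (x - y))
  have h4 := norm_sub_le (S (x - y)) (T (x - y))
  rw [e]
  linarith

theorem exists_mem_mul_norm_sub_lt {D : Set X} (hD : Dense D) {M ε : ℝ} (hM : 0 ≤ M) (hε : 0 < ε)
    (x : X) : ∃ y ∈ D, M * ‖x - y‖ < ε := by
  obtain ⟨y, hxy, hy⟩ := Metric.dense_iff.1 hD x (ε / (M + 1)) (by positivity)
  refine ⟨y, hy, ?_⟩
  rw [Metric.mem_ball, dist_comm, dist_eq_norm, lt_div_iff₀ (by positivity)] at hxy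
  nlinarith [norm_nonneg (x - y)]

theorem cauchySeq_apply_of_dense {S : ℕ → X →L[𝕜] X} {M : ℝ} (hM : ∀ i, ‖S i‖ ≤ M) {D : Set X}
    (hD : Dense D) (h : ∀ x ∈ D, CauchySeq fun i => S i x) (x : X) : CauchySeq fun i => S i x := by
  have hM0 : 0 ≤ M := (norm_nonneg _).trans (hM 0)
  rw [Metric.cauchySeq_iff']
  intro ε hε
  obtain ⟨y, hy, hxy⟩ := exists_mem_mul_norm_sub_lt hD (M := 2 * M) (by positivity) (half_pos hε) x
  obtain ⟨N, hN⟩ := Metric.cauchySeq_iff'.1 (h y hy) (ε / 2) (by positivity)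
  refine ⟨N, fun i hi => ?_⟩
  have h1 := hN i hi
  rw [dist_eq_norm] at h1 ⊢
  linarith [norm_apply_sub_le (hM i) (hM N) x y]

theorem norm_expOp_apply_sub_le [CompleteSpace X] {A : X →L[𝕜] X} {M s h : ℝ} (hs : 0 ≤ s)
    (hsh : s ≤ h) (hM : ∀ s, 0 ≤ s → ‖expOp A s‖ ≤ M) (u x : X) :
    ‖expOp A s u - u‖ ≤ (M + 1) * ‖u - x‖ + M * ‖A x‖ * h := by
  have hM0 : 0 ≤ M := (norm_nonneg _).trans (hM 0 le_rfl)
  have h1 : ‖expOp A s x - x‖ ≤ M * ‖A x‖ * s := norm_expOp_sub_le hs fun r hr _ =>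
    ((expOp A r).le_opNorm _).trans (mul_le_mul_of_nonneg_right (hM r hr) (norm_nonneg _))
  have h2 : M * ‖A x‖ * s ≤ M * ‖A x‖ * h := by gcongr
  have h3 := ((expOp A s).le_opNorm (u - x)).trans
    (mul_le_mul_of_nonneg_right (hM s hs) (norm_nonneg _))
  have e : expOp A s u - u = expOp A s (u - x) - (u - x) + (expOp A s x - x) := by
    rw [map_sub]
    abel
  have h4 := norm_add_le (expOp A s (u - x) - (u - x)) (expOp A s x - x)
  have h5 := norm_sub_le (expOp A s (u - x)) (u - x)
  rw [e]
  linarith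

/-- On the dense set of first components the exponentials are Cauchy because the generators converge
there; uniform boundedness extends this to all of `X`. Estimates for the approximations, uniform in
the index, pass to the limit and give continuity and the derivative at `0`. -/
theorem exists_semigroup_of_tendsto [CompleteSpace X] {A : ℕ → X →L[𝕜] X} {M : ℝ}
    (hcomm : ∀ i j, Commute (A i) (A j)) (hM : ∀ i t, 0 ≤ t → ‖expOp (A i) t‖ ≤ M)
    {Γ : Set (X × X)} (hΓ : ∀ p ∈ Γ, Tendsto (fun i => A i p.1) atTop (𝓝 p.2))
    (hD : Dense (Prod.fst '' Γ)) :
    ∃ T : C0Semigroup 𝕜 X,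
      (∀ (t : ℝ≥0) x, Tendsto (fun i => expOp (A i) t x) atTop (𝓝 (T.op t x))) ∧
      ∀ p ∈ Γ, Tendsto (fun h : ℝ≥0 => ((h : ℝ) : 𝕜)⁻¹ • (T.op h p.1 - p.1)) (𝓝[>] 0) (𝓝 p.2) := by
  have hM0 : 0 ≤ M := (norm_nonneg _).trans (hM 0 0 le_rfl)
  have hcau : ∀ (t : ℝ≥0) x, CauchySeq fun i => expOp (A i) t x := by
    intro t
    refine cauchySeq_apply_of_dense (fun i => hM i t t.2) hD ?_
    rintro _ ⟨p, hp, rfl⟩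
    rw [Metric.cauchySeq_iff]
    intro ε hε
    obtain ⟨N, hN⟩ := Metric.cauchySeq_iff.1 (hΓ p hp).cauchySeq
      (ε / (M * M * t + 1)) (by positivity)
    refine ⟨N, fun i hi j hj => ?_⟩
    have h1 := hN i hi j hj
    rw [dist_eq_norm, lt_div_iff₀ (by positivity)] at h1
    have h2 := norm_expOp_sub_expOp_le (hcomm i j) t.2 (hM i) (hM j) p.1
    rw [dist_eq_norm]
    change _ ≤ M * (M * _) * (t : ℝ) at h2
    change ‖expOp (A i) (t : ℝ) p.1 - expOp (A j) (t : ℝ) p.1‖ ≤ _ at h2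
    nlinarith [norm_nonneg (A i p.1 - A j p.1)]
  choose L hL using fun t x => cauchySeq_tendsto_of_complete (hcau t x)
  let T : ℝ≥0 → X →L[𝕜] X := fun t =>
    continuousLinearMapOfTendsto (fun i => expOp (A i) t) (tendsto_pi_nhds.2 (hL t))
  have hT : ∀ (t : ℝ≥0) x, Tendsto (fun i => expOp (A i) t x) atTop (𝓝 (T t x)) := hL
  have hTM : ∀ (t : ℝ≥0) x, ‖T t x‖ ≤ M * ‖x‖ := fun t x =>
    le_of_tendsto (hT t x).norm (Eventually.of_forall fun i =>
      ((expOp (A i) t).le_opNorm x).trans (mul_le_mul_of_nonneg_right (hM i t t.2) (norm_nonneg _)))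
  have hT0 : T 0 = ContinuousLinearMap.id 𝕜 X := by
    ext x
    refine tendsto_nhds_unique (hT 0 x) ?_
    simp [expOp_zero]
  have hTadd : ∀ s t : ℝ≥0, T (s + t) = (T s).comp (T t) := by
    intro s t
    ext x
    refine tendsto_nhds_unique (hT (s + t) x) ?_
    have h1 : Tendsto (fun i => expOp (A i) s (expOp (A i) t x - T t x)) atTop (𝓝 0) := by
      refine squeeze_zero_norm (a := fun i => M * ‖expOp (A i) t x - T t x‖) (fun i =>
        ((expOp (A i) s).le_opNorm _).trans
          (mul_le_mul_of_nonneg_right (hM i s s.2) (norm_nonneg _))) ?_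
      simpa using ((hT t x).sub_const (T t x)).norm.const_mul M
    have h2 := h1.add (hT s (T t x))
    rw [zero_add] at h2
    refine h2.congr fun i => ?_
    rw [NNReal.coe_add, expOp_add, map_sub]
    simp
  have hTD : ∀ p ∈ Γ, ∀ t : ℝ≥0, ‖T t p.1 - p.1‖ ≤ M * ‖p.2‖ * t := fun p hp t =>
    le_of_tendsto_of_tendsto' ((hT t p.1).sub_const p.1).norm
      (((hΓ p hp).norm.const_mul M).mul_const (t : ℝ)) fun i =>
      norm_expOp_sub_le t.2 fun r hr _ =>
        ((expOp (A i) r).le_opNorm _).trans (mul_le_mul_of_nonneg_right (hM i r hr) (norm_nonneg _))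
  -- The vector `p.2` need not lie in the dense domain. It is compared with a domain vector `q.1`,
  -- on which the exponentials move at rate at most `M ‖q.2‖` in the limit.
  have hTG : ∀ p ∈ Γ, ∀ q ∈ Γ, ∀ h : ℝ≥0, ‖T h p.1 - p.1 - ((h : ℝ) : 𝕜) • p.2‖ ≤
      ((M + 1) * ‖p.2 - q.1‖ + M * ‖q.2‖ * h) * h := fun p hp q hq h =>
    le_of_tendsto_of_tendsto'
      (((hT h p.1).sub_const p.1).sub ((hΓ p hp).const_smul ((h : ℝ) : 𝕜))).norm
      ((((((hΓ p hp).sub_const q.1).norm.const_mul (M + 1)).add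
        (((hΓ q hq).norm.const_mul M).mul_const (h : ℝ)))).mul_const (h : ℝ)) fun i =>
      norm_expOp_sub_sub_le h.2 fun s hs hsh => norm_expOp_apply_sub_le hs hsh (hM i) _ _
  have hcontD : ∀ p ∈ Γ, Continuous fun t : ℝ≥0 => T t p.1 := by
    intro p hp
    have key : ∀ s r : ℝ≥0, ‖T (s + r) p.1 - T s p.1‖ ≤ M * (M * ‖p.2‖) * r := fun s r => by
      rw [hTadd, ContinuousLinearMap.comp_apply, ← map_sub]
      refine (hTM s _).trans ?_
      rw [mul_assoc]
      exact mul_le_mul_of_nonneg_left (hTD p hp r) hM0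
    refine (LipschitzWith.of_dist_le_mul (K := NNReal.mk (M * (M * ‖p.2‖)) (by positivity))
      fun s t => ?_).continuous
    rw [dist_eq_norm, NNReal.dist_eq, NNReal.coe_mk]
    rcases le_total s t with h | h
    · obtain ⟨r, rfl⟩ := exists_add_of_le h
      rw [norm_sub_rev]
      refine (key s r).trans (le_of_eq ?_)
      congr 1
      rw [NNReal.coe_add, sub_add_cancel_left, abs_neg, NNReal.abs_eq]
    · obtain ⟨r, rfl⟩ := exists_add_of_le h
      refine (key t r).trans (le_of_eq ?_)
      congr 1
      rw [NNReal.coe_add, add_sub_cancel_left, NNReal.abs_eq]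
  have hcont : ∀ x, Continuous fun t : ℝ≥0 => T t x := by
    intro x
    -- Orbits of domain vectors are Lipschitz, and a general orbit is their limit uniformly in time.
    refine continuous_of_uniform_approx_of_continuous fun u hu => ?_
    obtain ⟨ε, hε, hu⟩ := Metric.mem_uniformity_dist.1 hu
    obtain ⟨_, ⟨p, hp, rfl⟩, hxy⟩ := exists_mem_mul_norm_sub_lt hD hM0 hε x
    refine ⟨_, hcontD p hp, fun t => hu ?_⟩
    rw [dist_eq_norm, ← map_sub]
    exact (hTM t _).trans_lt hxy
  refine ⟨⟨T, hT0, hTadd, hcont⟩, hT, fun p hp => ?_⟩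
  rw [Metric.tendsto_nhdsWithin_nhds]
  intro ε hε
  obtain ⟨_, ⟨q, hq, rfl⟩, hpq⟩ := exists_mem_mul_norm_sub_lt hD (M := M + 1) (by positivity)
    (half_pos hε) p.2
  -- The approximation of `p.2` by `q.1` costs `ε/2`; this bound on `h` makes the remaining term `M
  -- ‖q.2‖ h` smaller than `ε/2`.
  refine ⟨ε / (2 * (M * ‖q.2‖ + 1)), by positivity, fun {h} hh hd => ?_⟩
  have hh0 : (0 : ℝ) < h := hh
  rw [NNReal.dist_eq, NNReal.coe_zero, sub_zero, abs_of_pos hh0, lt_div_iff₀ (by positivity)] at hd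
  have hne : ((h : ℝ) : 𝕜) ≠ 0 := by exact_mod_cast hh0.ne'
  have e : ((h : ℝ) : 𝕜)⁻¹ • (T h p.1 - p.1) - p.2 =
      ((h : ℝ) : 𝕜)⁻¹ • (T h p.1 - p.1 - ((h : ℝ) : 𝕜) • p.2) := by
    rw [smul_sub _ (T h p.1 - p.1), inv_smul_smul₀ hne]
  change dist (((h : ℝ) : 𝕜)⁻¹ • (T h p.1 - p.1)) p.2 < ε
  rw [dist_eq_norm, e, norm_smul, norm_inv, RCLike.norm_ofReal, abs_of_pos hh0,
    inv_mul_lt_iff₀ hh0]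
  refine (hTG p hp q hq h).trans_lt ?_
  rw [mul_comm]
  refine mul_lt_mul_of_pos_left ?_ hh0
  have : 0 ≤ M * ‖q.2‖ := by positivity
  nlinarith

end Approximation

/-! ## Generation of semigroups from resolvent estimates -/

section HilleYosida

variable {X : Type*} [NormedAddCommGroup X] [NormedSpace 𝕜 X]

theorem tendsto_apply_of_dense {S : ℕ → X →L[𝕜] X} {M : ℝ} (hM : ∀ i, ‖S i‖ ≤ M) {D : Set X}
    (hD : Dense D) (h : ∀ x ∈ D, Tendsto (fun i => S i x) atTop (𝓝 x)) (x : X) :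
    Tendsto (fun i => S i x) atTop (𝓝 x) := by
  rw [Metric.tendsto_atTop]
  intro ε hε
  obtain ⟨y, hy, hxy⟩ := exists_mem_mul_norm_sub_lt hD (M := 2 * max M 1)
    (by positivity) (half_pos hε) x
  obtain ⟨N, hN⟩ := Metric.tendsto_atTop.1 (h y hy) (ε / 2) (by positivity)
  refine ⟨N, fun i hi => ?_⟩
  have h1 := hN i hi
  have h2 := norm_apply_sub_le (T := ContinuousLinearMap.id 𝕜 X) ((hM i).trans (le_max_left M 1))
    (ContinuousLinearMap.norm_id_le.trans (le_max_right M 1)) x y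
  simp only [ContinuousLinearMap.id_apply] at h2
  rw [dist_eq_norm] at h1 ⊢
  linarith

/-- The Hille–Yosida theorem for an operator with graph `Γ` and resolvents `R n` at `n + 1`. -/
theorem exists_semigroup_of_resolvents [CompleteSpace X] (Γ : Submodule 𝕜 (X × X))
    (R : ℕ → X →L[𝕜] X) {M : ℝ}
    (h1 : ∀ n y, (R n y, ((n + 1 : ℝ) : 𝕜) • R n y - y) ∈ Γ)
    (h2 : ∀ n x y, (x, y) ∈ Γ → R n (((n + 1 : ℝ) : 𝕜) • x - y) = x)
    (hM : ∀ (n : ℕ) (m : ℕ), ‖(((n + 1 : ℝ) : 𝕜) • R n) ^ m‖ ≤ M)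
    (hD : Dense (Prod.fst '' (Γ : Set (X × X)))) :
    ∃ T : C0Semigroup 𝕜 X, ∀ x y, (x, y) ∈ Γ ↔
      Tendsto (fun h : ℝ≥0 => ((h : ℝ) : 𝕜)⁻¹ • (T.op h x - x)) (𝓝[>] 0) (𝓝 y) := by
  have hM0 : 0 ≤ M := (norm_nonneg _).trans (hM 0 0)
  set a : ℕ → 𝕜 := fun n => ((n + 1 : ℝ) : 𝕜) with ha
  -- The resolvent identity. It makes the resolvents commute; when two parameters coincide, it shows
  -- that the resolvents are equal.
  have hR : ∀ i j y, R j y - R i y = (a i - a j) • R i (R j y) := by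
    intro i j y
    have := h2 i _ _ (h1 j y)
    rw [← sub_add, ← sub_smul, map_add, map_smul] at this
    exact sub_eq_of_eq_add this.symm
  have hcomm : ∀ i j, Commute (R i) (R j) := by
    intro i j
    rcases eq_or_ne (a i) (a j) with h | h
    · have e : R j = R i := by
        ext y
        rw [← sub_eq_zero, hR i j, h, sub_self, zero_smul]
      rw [e]
    · refine ContinuousLinearMap.ext fun y => ?_
      refine smul_right_injective X (sub_ne_zero.2 h) ?_
      change (a i - a j) • R i (R j y) = (a i - a j) • R j (R i y)
      rw [← hR i j, ← neg_sub (a j), neg_smul, ← hR j i, neg_sub]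
  -- Yosida approximations. On the domain they equal `a_n R_n` applied to the value of the operator,
  -- hence converge to that value.
  let A : ℕ → X →L[𝕜] X := fun n => a n • (a n • R n - 1)
  have hRA : ∀ i j, Commute (R i) (A j) := fun i j =>
    (((hcomm i j).smul_right _).sub_right (Commute.one_right _)).smul_right _
  have hAA : ∀ i j, Commute (A i) (A j) := fun i j =>
    (((hRA i j).smul_left _).sub_left (Commute.one_left _)).smul_left _
  have hE : ∀ i t, 0 ≤ t → ‖expOp (A i) t‖ ≤ M := fun i t ht =>
    norm_expOp_smul_sub_one_le (by positivity) ht (hM i)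
  have hS : ∀ i, ‖a i • R i‖ ≤ M := fun i => (congrArg norm (pow_one _)).symm.trans_le (hM i 1)
  have hdom : ∀ i, ∀ p ∈ Γ, a i • R i p.1 - p.1 = R i p.2 := by
    intro i p hp
    have := h2 i p.1 p.2 hp
    rw [map_sub, map_smul] at this
    rw [sub_eq_iff_eq_add', ← sub_eq_iff_eq_add]
    exact this
  have hlim : ∀ x, Tendsto (fun i => (a i • R i) x) atTop (𝓝 x) := by
    refine tendsto_apply_of_dense hS hD ?_
    rintro _ ⟨p, hp, rfl⟩
    rw [tendsto_iff_norm_sub_tendsto_zero]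
    refine squeeze_zero (fun _ => norm_nonneg _) (g := fun i : ℕ => M * ‖p.2‖ / ((i + 1 : ℕ) : ℝ))
      (fun i => ?_)
      ((tendsto_const_div_atTop_nhds_zero_nat (M * ‖p.2‖)).comp (tendsto_add_atTop_nat 1))
    rw [smul_apply, hdom i p hp]
    have e := ((a i • R i).le_opNorm p.2).trans
      (mul_le_mul_of_nonneg_right (hS i) (norm_nonneg _))
    rw [smul_apply, norm_smul, RCLike.norm_ofReal,
      abs_of_nonneg (by positivity)] at e
    rw [le_div_iff₀ (by positivity), mul_comm]
    exact_mod_cast e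
  have hAlim : ∀ p ∈ (Γ : Set (X × X)), Tendsto (fun i => A i p.1) atTop (𝓝 p.2) := by
    intro p hp
    refine (hlim p.2).congr fun i => ?_
    change a i • R i p.2 = a i • (a i • R i p.1 - p.1)
    rw [hdom i p hp]
  obtain ⟨T, hT, hG⟩ := exists_semigroup_of_tendsto hAA hE hAlim hD
  refine ⟨T, fun x y => ⟨fun h => hG _ h, fun h => ?_⟩⟩
  -- The semigroup commutes with the resolvent at `1`. Differentiating `T(t) R x` at `0` in two ways
  -- gives `R x - x = R y`, so `x = R (x - y)` lies in the domain with value `y`: the generator is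
  -- not larger than `Γ`.
  have hTR : ∀ t z, T.op t (R 0 z) = R 0 (T.op t z) := by
    intro t z
    refine tendsto_nhds_unique (hT t _) ?_
    refine (((R 0).continuous.tendsto _).comp (hT t z)).congr fun i => ?_
    have hc : Commute (R 0) (expOp (A i) t) := ((hRA 0 i).smul_right _).exp_right
    exact congrArg (fun S : X →L[𝕜] X => S z) hc.eq
  have ha0 : (((0 : ℕ) + 1 : ℝ) : 𝕜) = 1 := by simp
  have e1 := hG _ (h1 0 x)
  have e2 : Tendsto (fun h : ℝ≥0 => ((h : ℝ) : 𝕜)⁻¹ • (T.op h (R 0 x) - R 0 x)) (𝓝[>] 0)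
      (𝓝 (R 0 y)) := by
    refine (((R 0).continuous.tendsto _).comp h).congr fun i => ?_
    simp [hTR]
  have e3 := tendsto_nhds_unique e1 e2
  rw [ha0, one_smul] at e3
  have e4 := h1 0 (x - y)
  rw [ha0, one_smul, map_sub, ← e3, sub_sub_cancel, sub_sub_cancel] at e4
  exact e4

/-- If `T` is generated by `A - κ`, then `e^{κt} T(t)` is generated by `A`, by the product rule for
the difference quotients. -/
theorem exists_generates_of_shift {A : X →ₗ.[𝕜] X} (κ : ℝ) (T : C0Semigroup 𝕜 X)
    (h : ∀ x y, (x, y + (κ : 𝕜) • x) ∈ A.graph ↔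
      Tendsto (fun h : ℝ≥0 => ((h : ℝ) : 𝕜)⁻¹ • (T.op h x - x)) (𝓝[>] 0) (𝓝 y)) :
    ∃ S : C0Semigroup 𝕜 X, Generates A S := by
  have hof : Continuous fun t : ℝ≥0 => ((Real.exp (κ * t) : ℝ) : 𝕜) :=
    RCLike.continuous_ofReal.comp (by fun_prop)
  let S : C0Semigroup 𝕜 X :=
    { op := fun t => ((Real.exp (κ * t) : ℝ) : 𝕜) • T.op t
      op_zero := by simp [T.op_zero]
      op_add := fun s t => by
        ext x
        simp only [smul_apply, ContinuousLinearMap.comp_apply, T.op_add,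
          map_smul, smul_smul, NNReal.coe_add, mul_add, Real.exp_add, RCLike.ofReal_mul]
        rw [mul_comm]
      continuous_orbit := fun x => hof.smul (T.continuous_orbit x) }
  refine ⟨S, fun x y => ?_⟩
  have hd : Tendsto (fun h : ℝ≥0 => ((h : ℝ) : 𝕜)⁻¹ • (((Real.exp (κ * h) : ℝ) : 𝕜) • x - x))
      (𝓝[>] 0) (𝓝 ((κ : 𝕜) • x)) := by
    have h1 : HasDerivAt (fun t : ℝ => Real.exp (κ * t)) κ 0 := by
      simpa using ((hasDerivAt_id (0 : ℝ)).const_mul κ).exp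
    have h2 := hasDerivAt_iff_tendsto_slope_zero.1 h1
    have h3 : Tendsto (fun h : ℝ≥0 => (h : ℝ)) (𝓝[>] 0) (𝓝[≠] 0) := by
      refine tendsto_nhdsWithin_iff.2 ⟨(NNReal.continuous_coe.tendsto' 0 0 rfl).mono_left
        nhdsWithin_le_nhds, ?_⟩
      filter_upwards [self_mem_nhdsWithin] with t ht
      exact (NNReal.coe_pos.2 ht).ne'
    have h4 := ((RCLike.continuous_ofReal (K := 𝕜)).tendsto _).comp (h2.comp h3)
    refine (h4.smul_const x).congr fun t => ?_
    simp only [Function.comp_apply, zero_add, mul_zero, Real.exp_zero, smul_eq_mul]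
    push_cast
    rw [mul_smul, sub_smul, one_smul]
  have he : Tendsto (fun h : ℝ≥0 => ((Real.exp (κ * h) : ℝ) : 𝕜)) (𝓝[>] 0) (𝓝 1) :=
    (hof.tendsto' 0 1 (by simp)).mono_left nhdsWithin_le_nhds
  have he' : Tendsto (fun h : ℝ≥0 => ((Real.exp (κ * h) : ℝ) : 𝕜)⁻¹) (𝓝[>] 0) (𝓝 1) := by
    simpa using he.inv₀ one_ne_zero
  have hne : ∀ t : ℝ≥0, ((Real.exp (κ * t) : ℝ) : 𝕜) ≠ 0 := fun t => by
    exact_mod_cast (Real.exp_pos _).ne'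
  have e := h x (y - (κ : 𝕜) • x)
  rw [sub_add_cancel] at e
  rw [e]
  constructor
  · intro hT
    have := (he.smul hT).add hd
    rw [one_smul, sub_add_cancel] at this
    refine this.congr fun t => ?_
    simp only [S, smul_apply]
    module
  · intro hT
    have := he'.smul (hT.sub hd)
    rw [one_smul] at this
    refine this.congr fun t => ?_
    simp only [S, smul_apply]
    rw [← smul_sub, sub_sub_sub_cancel_right, ← smul_sub, smul_comm, inv_smul_smul₀ (hne t)]

end HilleYosida

/-! ## Quasi-dissipative operators -/

section Dissipative

variable {X : Type*} [NormedAddCommGroup X] [NormedSpace 𝕜 X]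
  {K : Type*} [NormedAddCommGroup K] [InnerProductSpace 𝕜 K]

/-- A contraction in the equivalent norm `‖J x‖` has contractive powers there, so passing between
the norms costs the same factor for every power. This is the power bound that Hille–Yosida requires
in the original norm. -/
theorem norm_pow_le_of_norm_apply_le {S : X →L[𝕜] X} {J : X →L[𝕜] K} {C : ℝ} (hC0 : 0 ≤ C)
    (hC : ∀ x, ‖x‖ ≤ C * ‖J x‖) (hS : ∀ x, ‖J (S x)‖ ≤ ‖J x‖) (m : ℕ) : ‖S ^ m‖ ≤ C * ‖J‖ := by
  refine ContinuousLinearMap.opNorm_le_bound _ (by positivity) fun x => ?_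
  have h : ∀ m : ℕ, ‖J ((S ^ m) x)‖ ≤ ‖J x‖ := by
    intro m
    induction m with
    | zero => simp
    | succ m ih =>
      rw [pow_succ']
      exact (hS _).trans ih
  calc ‖(S ^ m) x‖ ≤ C * ‖J x‖ := (hC _).trans (mul_le_mul_of_nonneg_left (h m) hC0)
    _ ≤ C * (‖J‖ * ‖x‖) := mul_le_mul_of_nonneg_left (J.le_opNorm x) hC0
    _ = C * ‖J‖ * ‖x‖ := (mul_assoc _ _ _).symm

variable {A : X →ₗ.[𝕜] X} {J : X →L[𝕜] K} {C : ℝ≥0}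

theorem mul_sq_norm_le_re_inner
    (hA : ∀ x y, (x, y) ∈ A.graph → RCLike.re (inner 𝕜 (J x) (J y)) ≤ ‖J x‖ ^ 2) {a : ℝ} {x z : X}
    (h : (x, (a : 𝕜) • x - z) ∈ A.graph) :
    (a - 1) * ‖J x‖ ^ 2 ≤ RCLike.re (inner 𝕜 (J x) (J z)) := by
  have h1 := hA _ _ h
  rw [map_sub, map_smul, inner_sub_right, inner_smul_right, map_sub, RCLike.re_ofReal_mul,
    inner_self_eq_norm_sq] at h1
  linarith

theorem sub_one_mul_norm_le
    (hA : ∀ x y, (x, y) ∈ A.graph → RCLike.re (inner 𝕜 (J x) (J y)) ≤ ‖J x‖ ^ 2) {a : ℝ} {x z : X}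
    (h : (x, (a : 𝕜) • x - z) ∈ A.graph) : (a - 1) * ‖J x‖ ≤ ‖J z‖ := by
  have h1 := (mul_sq_norm_le_re_inner hA h).trans (re_inner_le_norm _ _)
  rcases (norm_nonneg (J x)).eq_or_lt with h0 | h0
  · rw [← h0, mul_zero]
    exact norm_nonneg _
  · refine le_of_mul_le_mul_left ?_ h0
    linarith

/-- If `J z` is orthogonal to the image of the domain, solving `2 x₀ - A x₀ = z` and using
dissipativity gives `‖J x₀‖² ≤ 0`, so `x₀ = 0` and `z = 0`. The range of `J` is closed, so the
projection of `J x` onto the closed image of the domain is again of the form `J y`. -/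
theorem dense_domain [CompleteSpace X] [CompleteSpace K] (hJ : ∀ x, ‖x‖ ≤ C * ‖J x‖)
    (hA : ∀ x y, (x, y) ∈ A.graph → RCLike.re (inner 𝕜 (J x) (J y)) ≤ ‖J x‖ ^ 2)
    (hrange : ∀ r : ℝ, 1 < r → ∀ z, ∃ x, (x, (r : 𝕜) • x - z) ∈ A.graph) :
    Dense (A.domain : Set X) := by
  have hJa : AntilipschitzWith C J := J.antilipschitz_of_bound hJ
  have hJe := hJa.isClosedEmbedding J.uniformContinuous
  let P : Submodule 𝕜 K := (A.domain.map J.toLinearMap).topologicalClosure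
  have : CompleteSpace P := (Submodule.isClosed_topologicalClosure _).completeSpace_coe
  intro x
  have hp : P.starProjection (J x) ∈ P := P.starProjection_apply_mem _
  have hPr : (P : Set K) ⊆ Set.range J :=
    closure_minimal (by rintro _ ⟨y, -, rfl⟩; exact ⟨y, rfl⟩) hJe.isClosed_range
  obtain ⟨y, hy⟩ := hPr hp
  have hz : x - y = 0 := by
    obtain ⟨x₀, hx₀⟩ := hrange 2 (by norm_num) (x - y)
    have h1 : J x₀ ∈ P := Submodule.le_topologicalClosure _
      ⟨x₀, LinearPMap.mem_domain_iff.2 ⟨_, hx₀⟩, rfl⟩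
    have h2 : inner 𝕜 (J x₀) (J (x - y)) = 0 := by
      rw [map_sub, hy]
      exact (Submodule.mem_orthogonal P _).1 (P.sub_starProjection_mem_orthogonal _) _ h1
    have h3 := mul_sq_norm_le_re_inner hA hx₀
    rw [h2, map_zero] at h3
    have h4 : ‖J x₀‖ = 0 := pow_eq_zero_iff two_ne_zero |>.1 (by nlinarith [sq_nonneg ‖J x₀‖])
    have h5 : x₀ = 0 := by
      have := hJ x₀
      rw [h4, mul_zero] at this
      exact norm_le_zero_iff.1 this
    have h6 := A.graph_fst_eq_zero_snd hx₀ h5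
    rw [h5, smul_zero, zero_sub, neg_eq_zero] at h6
    exact h6
  rw [← sub_eq_zero.1 hz] at hy
  rw [hJe.isInducing.closure_eq_preimage_closure_image, Set.mem_preimage, hy]
  exact hp

/-- The Lumer–Phillips theorem for the inner product `⟪J x, J y⟫`. -/
theorem exists_generates_of_dissipative [CompleteSpace X] [CompleteSpace K]
    (hJ : ∀ x, ‖x‖ ≤ C * ‖J x‖)
    (hA : ∀ x y, (x, y) ∈ A.graph → RCLike.re (inner 𝕜 (J x) (J y)) ≤ ‖J x‖ ^ 2)
    (hrange : ∀ r : ℝ, 1 < r → ∀ z, ∃ x, (x, (r : 𝕜) • x - z) ∈ A.graph) :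
    ∃ T : C0Semigroup 𝕜 X, Generates A T := by
  -- The graph of `A - 1`, which is dissipative; its resolvent at `n + 1` is that of `A` at `n + 2 >
  -- 1`.
  let Γ : Submodule 𝕜 (X × X) := A.graph.comap
    ((LinearMap.fst 𝕜 X X).prod (LinearMap.snd 𝕜 X X + LinearMap.fst 𝕜 X X))
  have hΓ : ∀ x y, (x, y) ∈ Γ ↔ (x, y + x) ∈ A.graph := fun _ _ => Iff.rfl
  have hshift : ∀ (a : ℝ) (x z : X), (x, (a : 𝕜) • x - z) ∈ Γ ↔
      (x, ((a + 1 : ℝ) : 𝕜) • x - z) ∈ A.graph := by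
    intro a x z
    rw [hΓ]
    have e : (a : 𝕜) • x - z + x = ((a + 1 : ℝ) : 𝕜) • x - z := by
      push_cast
      module
    rw [e]
  have hest : ∀ (n : ℕ) (x z : X), (x, ((n + 1 : ℝ) : 𝕜) • x - z) ∈ Γ →
      (n + 1) * ‖J x‖ ≤ ‖J z‖ := by
    intro n x z h
    have := sub_one_mul_norm_le hA ((hshift _ _ _).1 h)
    rwa [add_sub_cancel_right] at this
  have huniq : ∀ (n : ℕ) (x x' z : X), (x, ((n + 1 : ℝ) : 𝕜) • x - z) ∈ Γ →
      (x', ((n + 1 : ℝ) : 𝕜) • x' - z) ∈ Γ → x = x' := by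
    intro n x x' z h h'
    have h1 := Γ.sub_mem h h'
    have h2 := hest n (x - x') 0 (by convert h1 using 1; ext <;> simp [smul_sub])
    rw [map_zero, norm_zero] at h2
    have h3 : ‖J (x - x')‖ ≤ 0 := by
      by_contra! h4
      have : (0 : ℝ) < (n + 1) * ‖J (x - x')‖ := by positivity
      linarith
    have h4 := hJ (x - x')
    rw [le_antisymm h3 (norm_nonneg _), mul_zero] at h4
    exact sub_eq_zero.1 (norm_le_zero_iff.1 h4)
  have hex : ∀ (n : ℕ) (z : X), ∃ x, (x, ((n + 1 : ℝ) : 𝕜) • x - z) ∈ Γ := fun n z => by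
    obtain ⟨x, hx⟩ := hrange (n + 1 + 1) (by linarith [n.cast_nonneg (α := ℝ)]) z
    exact ⟨x, (hshift _ _ _).2 hx⟩
  choose r hr using hex
  have hrJ : ∀ n z, ‖J (r n z)‖ ≤ ‖J z‖ := fun n z => by
    have := hest n _ _ (hr n z)
    nlinarith [norm_nonneg (J (r n z)), n.cast_nonneg (α := ℝ)]
  let R : ℕ → X →L[𝕜] X := fun n => LinearMap.mkContinuous
    { toFun := r n
      map_add' := fun z z' => huniq n _ _ (z + z') (hr n _) (by
        convert Γ.add_mem (hr n z) (hr n z') using 1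
        ext <;> simp [smul_add]
        abel)
      map_smul' := fun c z => huniq n _ _ (c • z) (hr n _) (by
        convert Γ.smul_mem c (hr n z) using 1
        ext <;> simp [smul_sub, smul_comm c]) }
    (C * ‖J‖) fun z => by
      refine (hJ _).trans ?_
      rw [mul_assoc]
      exact mul_le_mul_of_nonneg_left ((hrJ n z).trans (J.le_opNorm z)) C.2
  have hR : ∀ n z, R n z = r n z := fun _ _ => rfl
  have hD : Dense (Prod.fst '' (Γ : Set (X × X))) := by
    refine (dense_domain hJ hA hrange).mono fun x hx => ?_
    obtain ⟨y, hy⟩ := LinearPMap.mem_domain_iff.1 hx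
    exact ⟨(x, y - x), (hΓ _ _).2 (by rwa [sub_add_cancel]), rfl⟩
  obtain ⟨T, hT⟩ := exists_semigroup_of_resolvents Γ R (M := C * ‖J‖) hr
    (fun n x y h => huniq n _ _ _ (hr n _) (by rwa [sub_sub_cancel]))
    (fun n => norm_pow_le_of_norm_apply_le C.2 hJ fun z => by
      rw [smul_apply, map_smul, norm_smul, RCLike.norm_ofReal, abs_of_nonneg (by positivity)]
      exact hest n _ _ (hr n z)) hD
  refine exists_generates_of_shift 1 T fun x y => ?_
  rw [RCLike.ofReal_one, one_smul]
  exact hT x y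

end Dissipative

/-! ## Generation by the plate operator -/

/-- The components `v, w, Δw, ∂_i w` of the energy of a state `(v, w)`. -/
def energyComponent (𝕜 : Type*) [RCLike 𝕜] (Ω : Set (Euc n)) :
    Option (Option (Option (Fin n))) → StateSpace 𝕜 Ω →L[𝕜] L2 𝕜 Ω
  | none => WithLp.fstL 2 𝕜 (L2 𝕜 Ω) (H2o 𝕜 Ω)
  | some none => (H2o.toL2CLM 𝕜 Ω).comp (WithLp.sndL 2 𝕜 (L2 𝕜 Ω) (H2o 𝕜 Ω))
  | some (some none) => (H2o.laplacianCLM 𝕜 Ω).comp (WithLp.sndL 2 𝕜 (L2 𝕜 Ω) (H2o 𝕜 Ω))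
  | some (some (some i)) => (H2o.partialCLM 𝕜 Ω i).comp (WithLp.sndL 2 𝕜 (L2 𝕜 Ω) (H2o 𝕜 Ω))

/-- The map `(v, w) ↦ (v, w, Δw, ∇w)`, which defines the energy inner product. -/
def energyMap (𝕜 : Type*) [RCLike 𝕜] (Ω : Set (Euc n)) : StateSpace 𝕜 Ω →L[𝕜]
    PiLp 2 (fun _ : Option (Option (Option (Fin n))) => L2 𝕜 Ω) :=
  ((PiLp.continuousLinearEquiv 2 𝕜
    (fun _ : Option (Option (Option (Fin n))) => L2 𝕜 Ω)).symm : _ →L[𝕜] _).comp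
    (ContinuousLinearMap.pi (energyComponent 𝕜 Ω))

theorem inner_energyMap (x y : StateSpace 𝕜 Ω) :
    inner 𝕜 (energyMap 𝕜 Ω x) (energyMap 𝕜 Ω y) = inner 𝕜 x.fst y.fst +
      (inner 𝕜 (H2o.toL2 x.snd) (H2o.toL2 y.snd) + energyForm y.snd x.snd) := by
  rw [PiLp.inner_apply, Fintype.sum_option, Fintype.sum_option, Fintype.sum_option, energyForm,
    add_comm (∑ i, _)]
  rfl

theorem exists_norm_le_energyMap (hΩ : IsOpen Ω)
    (hB : ∀ f : L2 𝕜 Ω, ∃ U : H2o 𝕜 Ω, H2o.toL2 U - H2o.laplacian U = f) :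
    ∃ C : ℝ≥0, ∀ x, ‖x‖ ≤ C * ‖energyMap 𝕜 Ω x‖ := by
  obtain ⟨C, hC0, hC⟩ := H2o.exists_norm_le hΩ hB
  refine ⟨NNReal.mk (1 + C * 2) (by positivity), fun x => ?_⟩
  have h1 : ‖x.fst‖ ≤ ‖energyMap 𝕜 Ω x‖ := PiLp.norm_apply_le (energyMap 𝕜 Ω x) none
  have h2 : ‖H2o.toL2 x.snd‖ ≤ ‖energyMap 𝕜 Ω x‖ :=
    PiLp.norm_apply_le (energyMap 𝕜 Ω x) (some none)
  have h3 : ‖H2o.laplacian x.snd‖ ≤ ‖energyMap 𝕜 Ω x‖ :=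
    PiLp.norm_apply_le (energyMap 𝕜 Ω x) (some (some none))
  have h4 : ‖x‖ ≤ ‖x.fst‖ + ‖x.snd‖ := by
    refine abs_le_of_sq_le_sq' ?_ (by positivity) |>.2
    rw [WithLp.prod_norm_sq_eq_of_L2]
    nlinarith [norm_nonneg x.fst, norm_nonneg x.snd]
  have h5 := hC x.snd
  change ‖x‖ ≤ (1 + C * 2) * ‖energyMap 𝕜 Ω x‖
  nlinarith

/-- The weak formulation of the graph: the generation argument never uses the explicit description
of the domain. -/
theorem mem_waveOp_graph_iff (hΩ : IsOpen Ω) {x y : StateSpace 𝕜 Ω} :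
    (x, y) ∈ (waveOp 𝕜 Ω).graph ↔ x.fst = H2o.toL2 y.snd ∧
      ∀ ψ : H2o 𝕜 Ω, energyForm x.snd ψ = -inner 𝕜 (H2o.toL2 ψ) y.fst := by
  rw [waveOp_graph hΩ]
  change (x.fst = H2o.toL2 y.snd ∧ (x.snd, y.fst) ∈ (plateOp 𝕜 Ω).graph) ↔ _
  rw [plateOp_graph hΩ]
  refine and_congr_right fun _ => ⟨?_, fun h => ⟨-y.fst, (neg_neg _).symm, fun ψ => ?_⟩⟩
  · rintro ⟨f, hf, h⟩ ψ
    change y.fst = -f at hf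
    rw [hf, inner_neg_right, neg_neg]
    exact h ψ
  · rw [inner_neg_right]
    exact h ψ

theorem conj_energyForm (U V : H2o 𝕜 Ω) :
    (starRingEnd 𝕜) (energyForm U V) = energyForm V U := by
  simp only [energyForm, map_add, map_sum, inner_conj_symm]

/-- Testing the weak equation with `v` itself shows that `⟨v, 𝔸w⟩` and the form of `w` and `v`
cancel in the real part. Only `Re ⟨w, v⟩` is left, caused by the term `‖w‖²` that the energy
includes, and Cauchy–Schwarz bounds it. -/
theorem re_inner_energyMap_le (hΩ : IsOpen Ω) {x y : StateSpace 𝕜 Ω}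
    (h : (x, y) ∈ (waveOp 𝕜 Ω).graph) :
    RCLike.re (inner 𝕜 (energyMap 𝕜 Ω x) (energyMap 𝕜 Ω y)) ≤ ‖energyMap 𝕜 Ω x‖ ^ 2 := by
  obtain ⟨h1, h2⟩ := (mem_waveOp_graph_iff hΩ).1 h
  have h3 := h2 y.snd
  rw [← h1] at h3
  have h4 : ‖x.fst‖ ≤ ‖energyMap 𝕜 Ω x‖ := PiLp.norm_apply_le (energyMap 𝕜 Ω x) none
  have h5 : ‖H2o.toL2 x.snd‖ ≤ ‖energyMap 𝕜 Ω x‖ :=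
    PiLp.norm_apply_le (energyMap 𝕜 Ω x) (some none)
  rw [inner_energyMap, ← h1, ← conj_energyForm, h3, map_add, map_add, RCLike.conj_re, map_neg,
    add_neg_cancel_comm_assoc]
  refine (re_inner_le_norm _ _).trans ?_
  rw [sq]
  exact mul_le_mul h5 h4 (norm_nonneg _) (norm_nonneg _)

/-- Solvability of `r² w - 𝔸 w = h` in the weak sense. -/
theorem exists_energyForm_add_eq (hΩ : IsOpen Ω)
    (hB : ∀ f : L2 𝕜 Ω, ∃ U : H2o 𝕜 Ω, H2o.toL2 U - H2o.laplacian U = f) {r : ℝ} (hr : 1 ≤ r)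
    (h : L2 𝕜 Ω) : ∃ w : H2o 𝕜 Ω, ∀ ψ : H2o 𝕜 Ω,
      (r : 𝕜) * inner 𝕜 (H2o.toL2 ψ) (H2o.toL2 w) + energyForm w ψ = inner 𝕜 (H2o.toL2 ψ) h := by
  have := H2o.completeSpace (𝕜 := 𝕜) hΩ
  obtain ⟨C, hC0, hC⟩ := H2o.exists_norm_le hΩ hB
  let ι := H2o.toL2CLM 𝕜 Ω
  let Λ := H2o.laplacianCLM 𝕜 Ω
  let D := H2o.partialCLM 𝕜 Ω
  -- The operator representing the form in the inner product of `H²_o`; the form is coercive, so `S`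
  -- is invertible as in Lax–Milgram.
  let S : H2o 𝕜 Ω →L[𝕜] H2o 𝕜 Ω := ι.adjoint.comp ((r : 𝕜) • ι) +
    (∑ i, (D i).adjoint.comp (D i) + Λ.adjoint.comp Λ)
  have hS : ∀ w ψ, inner 𝕜 ψ (S w) =
      (r : 𝕜) * inner 𝕜 (H2o.toL2 ψ) (H2o.toL2 w) + energyForm w ψ := by
    intro w ψ
    simp only [S, add_apply, smul_apply, sum_apply, ContinuousLinearMap.comp_apply,
      inner_add_right, inner_sum, ContinuousLinearMap.adjoint_inner_right, inner_smul_right]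
    rfl
  -- With `a = ‖w‖` and `b = ‖Δw‖` in `L²`, the `H²` norm is at most `C (a + b)`, and `C² (a + b)² ≤
  -- 2 C² (a² + b²)` gives the coercivity constant `1 / (2 C²)`; here `1 ≤ r` is used.
  have hunit : IsUnit S := by
    refine ContinuousLinearMap.isUnit_of_forall_le_norm_inner_map S
      (c := NNReal.mk (1 / (2 * C ^ 2)) (by positivity)) (NNReal.coe_pos.1 (by
        change 0 < 1 / (2 * C ^ 2); positivity)) fun w => ?_
    change ‖w‖ ^ 2 * (1 / (2 * C ^ 2)) ≤ _
    rw [norm_inner_symm]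
    refine le_trans ?_ (RCLike.re_le_norm _)
    rw [hS, energyForm, map_add, map_add, map_sum, RCLike.re_ofReal_mul]
    simp only [inner_self_eq_norm_sq]
    have e1 : 0 ≤ ∑ i, ‖H2o.partial i w‖ ^ 2 := Finset.sum_nonneg fun _ _ => by positivity
    have e2 : ‖w‖ ^ 2 ≤ (C * (‖H2o.toL2 w‖ + ‖H2o.laplacian w‖)) ^ 2 :=
      pow_le_pow_left₀ (norm_nonneg _) (hC w) 2
    have e3 : ‖w‖ ^ 2 ≤ (‖H2o.toL2 w‖ ^ 2 + ‖H2o.laplacian w‖ ^ 2) * (2 * C ^ 2) := by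
      nlinarith [mul_nonneg (sq_nonneg C) (sq_nonneg (‖H2o.toL2 w‖ - ‖H2o.laplacian w‖))]
    rw [mul_one_div, div_le_iff₀ (by positivity)]
    refine e3.trans (mul_le_mul_of_nonneg_right ?_ (by positivity))
    nlinarith [sq_nonneg ‖H2o.toL2 w‖]
  obtain ⟨w, hw⟩ := (ContinuousLinearMap.isUnit_iff_bijective.1 hunit).2 (ι.adjoint h)
  refine ⟨w, fun ψ => ?_⟩
  rw [← hS, hw, ContinuousLinearMap.adjoint_inner_right]
  rfl

theorem exists_sub_mem_waveOp_graph (hΩ : IsOpen Ω)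
    (hB : ∀ f : L2 𝕜 Ω, ∃ U : H2o 𝕜 Ω, H2o.toL2 U - H2o.laplacian U = f) {r : ℝ} (hr : 1 < r)
    (z : StateSpace 𝕜 Ω) : ∃ x, (x, (r : 𝕜) • x - z) ∈ (waveOp 𝕜 Ω).graph := by
  -- The second row of the resolvent equation gives `v = r w - z₂`; inserted into the first row it
  -- becomes `r² w - 𝔸w = z₁ + r z₂`.
  obtain ⟨w, hw⟩ := exists_energyForm_add_eq hΩ hB (r := r ^ 2) (by nlinarith)
    (z.fst + (r : 𝕜) • H2o.toL2 z.snd)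
  refine ⟨WithLp.toLp 2 ((r : 𝕜) • H2o.toL2 w - H2o.toL2 z.snd, w), ?_⟩
  rw [mem_waveOp_graph_iff hΩ]
  refine ⟨?_, fun ψ => ?_⟩
  · change (r : 𝕜) • H2o.toL2 w - H2o.toL2 z.snd = H2o.toL2 ((r : 𝕜) • w - z.snd)
    rw [map_sub, map_smul]
  · change energyForm w ψ = -inner 𝕜 (H2o.toL2 ψ)
      ((r : 𝕜) • ((r : 𝕜) • H2o.toL2 w - H2o.toL2 z.snd) - z.fst)
    have := hw ψ
    rw [inner_add_right, inner_smul_right, RCLike.ofReal_pow] at this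
    rw [inner_sub_right, inner_smul_right, inner_sub_right, inner_smul_right]
    linear_combination this

theorem exists_generates_waveOp (hΩ : IsOpen Ω)
    (hB : ∀ f : L2 𝕜 Ω, ∃ U : H2o 𝕜 Ω, H2o.toL2 U - H2o.laplacian U = f) :
    ∃ T : C0Semigroup 𝕜 (StateSpace 𝕜 Ω), Generates (waveOp 𝕜 Ω) T := by
  have := H2o.completeSpace (𝕜 := 𝕜) hΩ
  obtain ⟨C, hC⟩ := exists_norm_le_energyMap hΩ hB
  exact exists_generates_of_dissipative hC (fun _ _ => re_inner_energyMap_le hΩ)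
    fun _ hr => exists_sub_mem_waveOp_graph hΩ hB hr

end Plate

end

theorem mainTheorem4 {𝕜 : Type*} [RCLike 𝕜] {n : ℕ} (hn : n = 1 ∨ n = 2)
    (Ω : Set (EuclideanSpace ℝ (Fin n))) (hΩ_open : IsOpen Ω)
    (hΩ_bounded : Bornology.IsBounded Ω) (hΩ_smooth : Plate.HasSmoothBoundary Ω) :
    (∀ x : Plate.StateSpace 𝕜 Ω, x ∈ (Plate.waveOp 𝕜 Ω).domain ↔
      (∃ v ∈ Plate.H2o 𝕜 Ω, Plate.Jet.val v = x.fst) ∧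
      ∃ w ∈ Plate.H4o 𝕜 Ω, Plate.Jet.val w = Plate.H2o.toL2 x.snd) ∧
    ∃ T : Plate.C0Semigroup 𝕜 (Plate.StateSpace 𝕜 Ω), Plate.Generates (Plate.waveOp 𝕜 Ω) T := by
  exact ⟨Plate.mem_domain_waveOp_iff hn hΩ_open hΩ_bounded hΩ_smooth,
    Plate.exists_generates_waveOp hΩ_open
      (Plate.H2o.exists_sub_laplacian_eq hn hΩ_open hΩ_bounded hΩ_smooth)⟩
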